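/- Let $(\Omega,\mathcal F,\mathbb P)$ be a probability space and let $L=\{L(B):B\in\mathcal B_b(\mathbb R^2)\}$ be a homogeneous Lévy basis on $\mathbb R^2$ with characteristic triplet $(\gamma,b,\nu)$. That is, for pairwise disjoint bounded Borel sets $B_1,B_2,\dots$ the random variables $L(B_i)$ are independent; if moreover $\bigcup_iB_i$ is bounded, then $L(\bigcup_iB_i)=\sum_iL(B_i)$ almost surely; and $\mathbb E\,e^{izL(B)}=e^{\mathrm{Leb}(B)\psi(z)}$ for all bounded Borel sets $B$ and $z\in\mathbb R$, where $$\psi(z)=i\gamma z-\tfrac12b^2z^2+\int_{\mathbb R\setminus\{0\}}\big(e^{izx}-1-izx\mathbf 1_{|x|\le1}\big)\,\nu(dx),$$ $\gamma\in\mathbb R$, $b\ge0$, $\nu(\{0\})=0$ and $\int(1\wedge x^2)\,\nu(dx)<\infty$. For a Borel set $B$ of finite Lebesgue measure, $L(B)$ denotes the limit in probability of $L(B\cap[-m,m]^2)$ as $m\to\infty$. Let $L'$ be the Lévy seed, i.e. a random variable with characteristic function $e^{\psi}$, and assume $\mathrm{Var}(L')=1$. Let $a:[0,\infty)\to[0,\infty)$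 be non-increasing, continuous and integrable, let $A=\{(r,y):r\le0,\ 0\le y\le a(-r)\}$ with $\mathrm{Leb}(A)>0$, and let $X_t=L(A+(t,0))$, $t\in\mathbb R$, be the associated trawl process. Let $\Delta_n>0$ satisfy $\Delta_n\to0$ and $n\Delta_n\to\infty$ as $n\to\infty$. For $0\le l\le n-1$ and $l\Delta_n\le t<(l+1)\Delta_n$ put $$\hat a(t)=-\frac1{n\Delta_n}\sum_{k=l}^{n-1}\big(X_{(k-l)\Delta_n}-\bar X_n\big)\big(X_{(k+1)\Delta_n}-X_{k\Delta_n}\big),\qquad \bar X_n=\frac1n\sum_{k=0}^{n-1}X_{k\Delta_n},$$ and, for a function $g:\mathbb R\to\mathbb R$, $$\Lambda^n_t(g)=\Delta_n\sum_{l=\lfloor t/\Delta_n\rfloor}^{n-1}g(\hat a(l\Delta_n)),\qquad \Lambda_t(g)=\int_t^\infty g(a(s))\,ds,\qquad t\ge0$$ (an empty sum is $0$). Let $p,q>1$ and let $g$ be of class $C^1$ with $g(0)=0$, $g'(x)=O(|x|^p)$ as $x\to0$ and $g'(x)=O(|x|^q)$ as $|x|\to\infty$. Assume that $\mathbb E\big(|L'|^{2(\max(p,q)+1)}\big)<\infty$.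 Then $s\mapsto g(a(s))$ is integrable on $[0,\infty)$, and $\Lambda^n(g)\to\Lambda(g)$ uniformly on compacts in probability: for all $T>0$ and $\varepsilon>0$, $$\lim_{n\to\infty}\mathbb P\Big(\sup_{0\le t\le T}|\Lambda^n_t(g)-\Lambda_t(g)|>\varepsilon\Big)=0 .$$ -/

import Mathlib

open MeasureTheory ProbabilityTheory Filter Set Topology

namespace Trawl

noncomputable section

/-- A characteristic triplet `(γ, b, ν)`, where `ν` is a Lévy measure on `ℝ`. -/
structure Triplet where
  γ : ℝ
  b : ℝ
  ν : Measure ℝ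
  b_nonneg : 0 ≤ b
  ν_zero : ν {0} = 0
  ν_levy : ∫⁻ x, ENNReal.ofReal (min 1 (x ^ 2)) ∂ν < ⊤

/-- The characteristic exponent
`ψ(z) = i γ z - b² z² / 2 + ∫ (e^{izx} - 1 - i z x 1_{|x| ≤ 1}) ν(dx)`. -/
def Triplet.exponent (τ : Triplet) (z : ℝ) : ℂ :=
  Complex.I * τ.γ * z - (τ.b : ℂ) ^ 2 * (z : ℂ) ^ 2 / 2
    + ∫ x : ℝ, (Complex.exp (Complex.I * z * x) - 1
        - (if |x| ≤ 1 then Complex.I * z * x else 0)) ∂τ.ν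

/-- `μ` is the law of the Lévy seed, i.e. of the infinitely divisible random variable with
characteristic triplet `τ`. -/
def Triplet.IsSeedLaw (τ : Triplet) (μ : Measure ℝ) : Prop :=
  IsProbabilityMeasure μ ∧ ∀ z : ℝ, charFun μ z = Complex.exp (τ.exponent z)

/-- A homogeneous Lévy basis on `ℝ²` with characteristic triplet `τ`, indexed by the bounded Borel
sets. (The values of `L` at other sets are irrelevant.) The series in `additive` converges almost
surely, in general not absolutely, so it is stated through its partial sums. -/
structure IsLevyBasis {Ω : Type*} [MeasurableSpace Ω] (P : Measure Ω) (τ : Triplet)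
    (L : Set (ℝ × ℝ) → Ω → ℝ) : Prop where
  measurable : ∀ B, MeasurableSet B → Bornology.IsBounded B → Measurable (L B)
  independent : ∀ B : ℕ → Set (ℝ × ℝ), (∀ i, MeasurableSet (B i)) →
    (∀ i, Bornology.IsBounded (B i)) → Pairwise (fun i j => Disjoint (B i) (B j)) →
    iIndepFun (fun i => L (B i)) P
  additive : ∀ B : ℕ → Set (ℝ × ℝ), (∀ i, MeasurableSet (B i)) →
    Bornology.IsBounded (⋃ i, B i) → Pairwise (fun i j => Disjoint (B i) (B j)) →
    ∀ᵐ ω ∂P, Tendsto (fun N : ℕ => ∑ i ∈ Finset.range N, L (B i) ω) atTop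
      (𝓝 (L (⋃ i, B i) ω))
  charFun_eq : ∀ B, MeasurableSet B → Bornology.IsBounded B → ∀ z : ℝ,
    charFun (P.map (L B)) z = Complex.exp ((volume B).toReal * τ.exponent z)

/-- `Y = L(B)` for a Borel set `B` of finite Lebesgue measure, not necessarily bounded: `L(B)` is
the limit in probability of `L(B ∩ [-m, m]²)` as `m → ∞`. -/
def IsValue {Ω : Type*} [MeasurableSpace Ω] (P : Measure Ω) (L : Set (ℝ × ℝ) → Ω → ℝ)
    (B : Set (ℝ × ℝ)) (Y : Ω → ℝ) : Prop :=
  TendstoInMeasure P (fun m : ℕ => L (B ∩ Icc (-(m : ℝ)) m ×ˢ Icc (-(m : ℝ)) m)) atTop Y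

/-- The trawl set `A = {(r, y) : r ≤ 0, 0 ≤ y ≤ a(-r)}`. -/
def trawlSet (a : ℝ → ℝ) : Set (ℝ × ℝ) :=
  {x | x.1 ≤ 0 ∧ 0 ≤ x.2 ∧ x.2 ≤ a (-x.1)}

/-- The translated trawl set `A_t = A + (t, 0)`. -/
def trawlSetAt (a : ℝ → ℝ) (t : ℝ) : Set (ℝ × ℝ) :=
  {x | x - (t, 0) ∈ trawlSet a}

/-- A trawl function on `[0, ∞)`; the values of `a` on `(-∞, 0)` are irrelevant. -/
structure IsTrawlFunction (a : ℝ → ℝ) : Prop where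
  nonneg : ∀ s, 0 ≤ s → 0 ≤ a s
  antitone : AntitoneOn a (Ici 0)
  continuous : ContinuousOn a (Ici 0)
  integrable : IntegrableOn a (Ici 0)
  nontrivial : 0 < volume (trawlSet a)

/-- `X` is the trawl process `X_t = L(A_t)`. -/
def IsTrawlProcess {Ω : Type*} [MeasurableSpace Ω] (P : Measure Ω) (L : Set (ℝ × ℝ) → Ω → ℝ)
    (a : ℝ → ℝ) (X : ℝ → Ω → ℝ) : Prop :=
  ∀ t : ℝ, IsValue P L (trawlSetAt a t) (X t)

/-- The sample mean of `x_0, x_δ, …, x_{(n-1)δ}` for a path `x`. -/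
def sampleMean (x : ℝ → ℝ) (δ : ℝ) (n : ℕ) : ℝ :=
  (∑ k ∈ Finset.range n, x (k * δ)) / n

/-- The estimator `â(t)` computed from the path `x` observed at `0, δ, …, nδ`:
`â(t) = -(nδ)⁻¹ ∑_{k=l}^{n-1} (x_{(k-l)δ} - x̄_n) (x_{(k+1)δ} - x_{kδ})` for
`lδ ≤ t < (l+1)δ`. -/
def aHat (x : ℝ → ℝ) (δ : ℝ) (n : ℕ) (t : ℝ) : ℝ :=
  -(1 / (n * δ)) * ∑ k ∈ Finset.Ico ⌊t / δ⌋₊ n,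
    (x (((k : ℝ) - (⌊t / δ⌋₊ : ℝ)) * δ) - sampleMean x δ n)
      * (x (((k : ℝ) + 1) * δ) - x (k * δ))

/-- `Λⁿ_t(g) = δ ∑_{l=⌊t/δ⌋}^{n-1} g(â(lδ))`, computed from the path `x`. -/
def lambdaHat (g : ℝ → ℝ) (x : ℝ → ℝ) (δ : ℝ) (n : ℕ) (t : ℝ) : ℝ :=
  δ * ∑ l ∈ Finset.Ico ⌊t / δ⌋₊ n, g (aHat x δ n (l * δ))

/-- `Λ_t(g) = ∫_t^∞ g(a(s)) ds`. -/
def lambda (g a : ℝ → ℝ) (t : ℝ) : ℝ :=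
  ∫ s in Ioi t, g (a s)

/-- The class `𝔆^d_{p,q}`: `g` is of class `C^d`, `g^{(j)}(0) = 0` for `j < d`,
`g^{(d)}(x) = O(|x|^p)` as `x → 0` and `g^{(d)}(x) = O(|x|^q)` as `|x| → ∞`. -/
structure TestClass (d : ℕ) (p q : ℝ) (g : ℝ → ℝ) : Prop where
  contDiff : ContDiff ℝ d g
  zero : ∀ j < d, iteratedDeriv j g 0 = 0
  near_zero : iteratedDeriv d g =O[𝓝 0] fun x => |x| ^ p
  near_infty : iteratedDeriv d g =O[cocompact ℝ] fun x => |x| ^ q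

/-- Uniform convergence on compacts in probability of processes on `[0, ∞)`: for all `T` and
`ε > 0`, `P(sup_{0 ≤ t ≤ T} |Zⁿ_t - Z_t| > ε) → 0`. -/
def TendstoUCP {Ω : Type*} [MeasurableSpace Ω] (P : Measure Ω) (Zn : ℕ → ℝ → Ω → ℝ)
    (Z : ℝ → Ω → ℝ) : Prop :=
  ∀ T : ℝ, 0 < T → ∀ ε : ℝ, 0 < ε →
    Tendsto (fun n => P {ω | ∃ t ∈ Icc 0 T, ε < |Zn n t ω - Z t ω|}) atTop (𝓝 0)

end

end Trawl

/-!
Cut the trawl sets at the observation times into disjoint cells, the cell `(i, j)` being the part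
of the plane that belongs to the trawl sets exactly from the `i`-th to the `j`-th time. The values
of the centred Lévy basis on the cells are independent, and the lagged products in `â(lδ)`, minus
their means, split into four sums of martingale differences, each of variance `O(δ)`. A Rosenthal
type bound, proved by induction along the grid, yields `E|â(lδ) - m|^r = O((nδ)^(-r/2))` for a
deterministic `m` close to `a(lδ)`. The bound needs the `r`-th absolute moment of the centred basis
on a set to be at most linear in the volume; this holds because, up to a constant, these moments
are superadditive. Trawl sets are unbounded, so the estimate is made on their truncations to boxes
and passed to the limit by Fatou's lemma.

The growth of `g'` bounds `|g(â) - g(a)|` by `a |â - a| + |â - a|^(p+1) + |â - a|^(q+1)`. Summed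
over the grid with weight `δ`, the random parts contribute in mean `(nδ)^(-1/2)`, `(nδ)^((1-p)/2)`
and `(nδ)^((1-q)/2)`, which tend to zero since `p, q > 1`, while the bias and the discretization
error vanish by dominated convergence. Since the sum over the whole grid dominates the error for
every `t`, Markov's inequality gives uniform convergence.
-/

namespace Trawl

/-! ### Power inequalities -/

section PowerInequalities

variable {r : ℝ}

lemma abs_add_rpow_le_two_rpow_mul (hr : 1 ≤ r) (x y : ℝ) :
    |x + y| ^ r ≤ 2 ^ (r - 1) * (|x| ^ r + |y| ^ r) :=
  calc |x + y| ^ r ≤ (|x| + |y|) ^ r :=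
        Real.rpow_le_rpow (abs_nonneg _) (abs_add_le x y) (by linarith)
    _ ≤ 2 ^ (r - 1) * (|x| ^ r + |y| ^ r) := by
        exact_mod_cast NNReal.rpow_add_le_mul_rpow_add_rpow (Real.nnabs x) (Real.nnabs y) hr

lemma abs_mul_rpow_le (hr : 0 < r) (x y : ℝ) : |x * y| ^ r ≤ |x| ^ (2 * r) + |y| ^ (2 * r) := by
  rw [abs_mul, Real.mul_rpow (abs_nonneg _) (abs_nonneg _), two_mul,
    Real.rpow_add_of_nonneg (abs_nonneg _) hr.le hr.le,
    Real.rpow_add_of_nonneg (abs_nonneg _) hr.le hr.le]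
  nlinarith [sq_nonneg (|x| ^ r - |y| ^ r), mul_self_nonneg (|x| ^ r), mul_self_nonneg (|y| ^ r)]

lemma abs_sum_div_rpow_le {n : ℕ} (hn : n ≠ 0) (hr : 1 ≤ r) (x : ℕ → ℝ) :
    |(∑ k ∈ Finset.range n, x k) / n| ^ r ≤ (∑ k ∈ Finset.range n, |x k| ^ r) / n := by
  have hjensen := Real.rpow_arith_mean_le_arith_mean_rpow (Finset.range n) (fun _ => 1 / (n : ℝ))
    (fun k => |x k|) (fun _ _ => by positivity) (by simp [hn]) (fun _ _ => abs_nonneg _) hr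
  rw [← Finset.mul_sum, ← Finset.mul_sum, one_div_mul_eq_div, one_div_mul_eq_div] at hjensen
  refine (Real.rpow_le_rpow (abs_nonneg _) ?_ (by linarith)).trans hjensen
  rw [abs_div, Nat.abs_cast]
  gcongr
  exact Finset.abs_sum_le_sum_abs _ _

lemma abs_rpow_le_sq_add_rpow {s : ℝ} (hr : 2 ≤ r) (hrs : r ≤ s) (x : ℝ) :
    |x| ^ r ≤ x ^ 2 + |x| ^ s := by
  rcases le_total |x| 1 with h | h
  · have hsq : |x| ^ r ≤ x ^ 2 := by
      simpa using Real.rpow_le_rpow_of_exponent_ge_of_imp (abs_nonneg x) h hr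
        (fun _ hr0 => absurd hr0 (by linarith))
    linarith [Real.rpow_nonneg (abs_nonneg x) s]
  · linarith [Real.rpow_le_rpow_of_exponent_le h hrs, sq_nonneg x]

lemma abs_rpow_eq_rpow_sub_two_mul_sq (hr : 2 ≤ r) (x : ℝ) :
    |x| ^ r = |x| ^ (r - 2) * x ^ 2 := by
  rw [← sq_abs x, ← Real.rpow_two, ← Real.rpow_add_of_nonneg (abs_nonneg x) (by linarith)
    (by norm_num), sub_add_cancel]

lemma abs_rpow_mul_abs_one_add_div_rpow {x : ℝ} (hx : x ≠ 0) (y r : ℝ) :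
    |x| ^ r * |1 + y / x| ^ r = |x + y| ^ r := by
  rw [← Real.mul_rpow (abs_nonneg _) (abs_nonneg _), ← abs_mul, mul_add, mul_one,
    mul_div_cancel₀ y hx]

lemma abs_rpow_mul_abs_div_rpow {x : ℝ} (hx : x ≠ 0) (y r : ℝ) :
    |x| ^ r * |y / x| ^ r = |y| ^ r := by
  rw [← Real.mul_rpow (abs_nonneg _) (abs_nonneg _), ← abs_mul, mul_div_cancel₀ y hx]

lemma one_add_rpow_le_one_add_mul_rpow_sub_one (hr : 1 ≤ r) {t : ℝ} (ht : -1 < t) :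
    (1 + t) ^ r ≤ 1 + r * t * (1 + t) ^ (r - 1) := by
  have hpos : 0 < 1 + t := by linarith
  -- Bernoulli's inequality at the point `s` with `(1 + s) (1 + t) = 1`.
  have bernoulli : 1 + r * (-t / (1 + t)) ≤ ((1 + t) ^ r)⁻¹ := by
    have h := one_add_mul_self_le_rpow_one_add (s := -t / (1 + t))
      (by rw [le_div_iff₀ hpos]; linarith) hr
    rwa [show 1 + -t / (1 + t) = (1 + t)⁻¹ by field_simp; ring, Real.inv_rpow hpos.le] at h
  have hsplit : (1 + t) ^ r = (1 + t) ^ (r - 1) * (1 + t) := by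
    rw [← Real.rpow_add_one hpos.ne', sub_add_cancel]
  have hscaled := mul_le_mul_of_nonneg_right bernoulli (Real.rpow_nonneg hpos.le r)
  rw [inv_mul_cancel₀ (Real.rpow_pos_of_pos hpos r).ne'] at hscaled
  have hcancel : -t / (1 + t) * (1 + t) ^ r = -t * (1 + t) ^ (r - 1) := by
    rw [hsplit]; field_simp
  linear_combination hscaled - r * hcancel

lemma one_add_mul_le_abs_one_add_rpow (hr : 1 ≤ r) (t : ℝ) : 1 + r * t ≤ |1 + t| ^ r := by
  rcases le_or_gt (-1) t with h | h
  · rw [abs_of_nonneg (by linarith)]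
    exact one_add_mul_self_le_rpow_one_add h hr
  · nlinarith [Real.rpow_nonneg (abs_nonneg (1 + t)) r]

/-- The constant `r² 2ʳ + 2 r + 3ʳ` in the second order expansion of `|x + y| ^ r` around `x`. The
first summand serves `|y| ≤ |x| / 2`, the other two serve `|y| ≥ |x| / 2`. -/
noncomputable def expansionConst (r : ℝ) : ℝ := r ^ 2 * 2 ^ r + 2 * r + 3 ^ r

lemma one_le_expansionConst (hr : 2 ≤ r) : 1 ≤ expansionConst r := by
  have : 0 ≤ r ^ 2 * 2 ^ r + 2 * r := by positivity
  have : 1 ≤ (3 : ℝ) ^ r := Real.one_le_rpow (by norm_num) (by linarith)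
  unfold expansionConst
  linarith

lemma expansionConst_pos (hr : 2 ≤ r) : 0 < expansionConst r :=
  one_pos.trans_le (one_le_expansionConst hr)

lemma mul_one_add_rpow_sub_one_le (hr : 2 ≤ r) {t : ℝ} (ht : |t| ≤ 1 / 2) :
    t * ((1 + t) ^ (r - 1) - 1) ≤ r * 2 ^ r * t ^ 2 := by
  obtain ⟨ht₁, ht₂⟩ := abs_le.1 ht
  rcases le_total 0 t with ht0 | ht0
  · have hpow : (1 + t) ^ (r - 1 - 1) ≤ 2 ^ r :=
      (Real.rpow_le_rpow (by linarith) (by linarith) (by linarith)).trans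
        (Real.rpow_le_rpow_of_exponent_le (by norm_num) (by linarith))
    have hslope : (r - 1) * t * (1 + t) ^ (r - 1 - 1) ≤ r * t * 2 ^ r :=
      mul_le_mul (by nlinarith) hpow (Real.rpow_nonneg (by linarith) _) (by positivity)
    nlinarith [one_add_rpow_le_one_add_mul_rpow_sub_one (r := r - 1) (by linarith)
      (show -1 < t by linarith)]
  · have hbernoulli : t * ((1 + t) ^ (r - 1) - 1) ≤ (r - 1) * t ^ 2 := by
      nlinarith [one_add_mul_self_le_rpow_one_add (s := t) (by linarith) (p := r - 1)
        (by linarith)]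
    have htwo : 1 ≤ (2 : ℝ) ^ r := Real.one_le_rpow (by norm_num) (by linarith)
    have hr2 : r * 1 ≤ r * 2 ^ r := by gcongr
    nlinarith [sq_nonneg t]

lemma abs_one_add_rpow_le_expansion (hr : 2 ≤ r) (t : ℝ) :
    |1 + t| ^ r ≤ 1 + r * t + expansionConst r * (t ^ 2 + |t| ^ r) := by
  have htr : 0 ≤ |t| ^ r := by positivity
  have hthree : 0 < (3 : ℝ) ^ r := by positivity
  have htwo : 0 < r ^ 2 * 2 ^ r := by positivity
  unfold expansionConst
  rcases le_total |t| (1 / 2) with h | h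
  · have hpos : 0 < 1 + t := by linarith [(abs_le.1 h).1]
    rw [abs_of_pos hpos]
    have hfirst := one_add_rpow_le_one_add_mul_rpow_sub_one (r := r) (by linarith)
      (show -1 < t by linarith)
    have hsecond := mul_le_mul_of_nonneg_left (mul_one_add_rpow_sub_one_le hr h)
      (show 0 ≤ r by linarith)
    have hconst : r ^ 2 * 2 ^ r * t ^ 2 ≤
        (r ^ 2 * 2 ^ r + 2 * r + 3 ^ r) * (t ^ 2 + |t| ^ r) := by
      gcongr <;> linarith
    linarith
  · have hpower : |1 + t| ^ r ≤ 3 ^ r * |t| ^ r := by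
      rw [← Real.mul_rpow (by norm_num) (abs_nonneg t)]
      refine Real.rpow_le_rpow (abs_nonneg _) ?_ (by linarith)
      linarith [abs_add_le 1 t, abs_one (α := ℝ)]
    have hlinear : -(r * t) ≤ 2 * r * t ^ 2 := by
      have : |t| ≤ 2 * t ^ 2 := by rw [← sq_abs t]; nlinarith [abs_nonneg t]
      nlinarith [neg_le_abs t]
    nlinarith [mul_nonneg htwo.le (add_nonneg (sq_nonneg t) htr),
      mul_nonneg (show 0 ≤ r by linarith) htr, mul_nonneg hthree.le (sq_nonneg t)]

lemma abs_add_rpow_le_expansion (hr : 2 ≤ r) (x y : ℝ) :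
    |x + y| ^ r ≤ |x| ^ r + r * (|x| ^ (r - 2) * x) * y
      + expansionConst r * (|x| ^ (r - 2) * y ^ 2 + |y| ^ r) := by
  rcases eq_or_ne x 0 with rfl | hx
  · have hsq : 0 ≤ |(0 : ℝ)| ^ (r - 2) * y ^ 2 := by positivity
    have hy : 0 ≤ |y| ^ r := by positivity
    rw [zero_add, mul_zero, mul_zero, zero_mul, abs_zero, Real.zero_rpow (by linarith)]
    rw [abs_zero] at hsq
    nlinarith [one_le_expansionConst hr]
  · have hlinear : |x| ^ r * (r * (y / x)) = r * (|x| ^ (r - 2) * x) * y := by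
      rw [abs_rpow_eq_rpow_sub_two_mul_sq hr]; field_simp
    have hquadratic : |x| ^ r * (y / x) ^ 2 = |x| ^ (r - 2) * y ^ 2 := by
      rw [abs_rpow_eq_rpow_sub_two_mul_sq hr]; field_simp
    calc |x + y| ^ r = |x| ^ r * |1 + y / x| ^ r :=
          (abs_rpow_mul_abs_one_add_div_rpow hx y r).symm
      _ ≤ |x| ^ r * (1 + r * (y / x) + expansionConst r * ((y / x) ^ 2 + |y / x| ^ r)) :=
          mul_le_mul_of_nonneg_left (abs_one_add_rpow_le_expansion hr _) (by positivity)
      _ = _ := by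
          linear_combination hlinear + expansionConst r * hquadratic
            + expansionConst r * abs_rpow_mul_abs_div_rpow hx y r

lemma tangent_le_abs_add_rpow (hr : 2 ≤ r) (x y : ℝ) :
    |x| ^ r + r * (|x| ^ (r - 2) * x) * y ≤ |x + y| ^ r := by
  rcases eq_or_ne x 0 with rfl | hx
  · rw [zero_add, mul_zero, mul_zero, zero_mul, abs_zero, Real.zero_rpow (by linarith), add_zero]
    positivity
  · have hlinear : |x| ^ r * (r * (y / x)) = r * (|x| ^ (r - 2) * x) * y := by
      rw [abs_rpow_eq_rpow_sub_two_mul_sq hr]; field_simp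
    calc |x| ^ r + r * (|x| ^ (r - 2) * x) * y = |x| ^ r * (1 + r * (y / x)) := by
          rw [mul_add, hlinear, mul_one]
      _ ≤ |x| ^ r * |1 + y / x| ^ r :=
          mul_le_mul_of_nonneg_left (one_add_mul_le_abs_one_add_rpow (by linarith) _)
            (by positivity)
      _ = |x + y| ^ r := abs_rpow_mul_abs_one_add_div_rpow hx y r

lemma clarkson_abs_rpow (hr : 2 ≤ r) (u v : ℝ) :
    2 * |(u + v) / 2| ^ r + 2 * |(u - v) / 2| ^ r ≤ |u| ^ r + |v| ^ r := by
  have hr2 : 1 ≤ r / 2 := by linarith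
  have habs (x : ℝ) : |x| ^ r = (x ^ 2) ^ (r / 2) := by
    rw [← sq_abs x, ← Real.rpow_two, ← Real.rpow_mul (abs_nonneg x), mul_div_cancel₀ r two_ne_zero]
  have hsuper := Real.add_rpow_le_rpow_add (sq_nonneg ((u + v) / 2)) (sq_nonneg ((u - v) / 2)) hr2
  have hconvex := (convexOn_rpow hr2).2 (mem_Ici.2 (sq_nonneg u)) (mem_Ici.2 (sq_nonneg v))
    (show (0 : ℝ) ≤ 1 / 2 by norm_num) (show (0 : ℝ) ≤ 1 / 2 by norm_num) (by norm_num)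
  simp only [smul_eq_mul] at hconvex
  have hparallelogram : ((u + v) / 2) ^ 2 + ((u - v) / 2) ^ 2 = 1 / 2 * u ^ 2 + 1 / 2 * v ^ 2 := by
    ring
  rw [hparallelogram] at hsuper
  rw [habs, habs, habs u, habs v]
  linarith

lemma tangent_add_le_abs_add_rpow (hr : 2 ≤ r) (x y : ℝ) :
    |x| ^ r + r * (|x| ^ (r - 2) * x) * y + 2 * |y / 2| ^ r ≤ |x + y| ^ r := by
  have hclarkson := clarkson_abs_rpow hr (x + y) x
  rw [show (x + y + x) / 2 = x + y / 2 by ring, show (x + y - x) / 2 = y / 2 by ring] at hclarkson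
  linarith [tangent_le_abs_add_rpow hr x (y / 2)]

lemma rpow_sub_two_mul_sq_le (hr : 2 ≤ r) {T : ℝ} (hT : 0 < T) (x y : ℝ) :
    |x| ^ (r - 2) * y ^ 2 ≤ T⁻¹ * |x| ^ r + T ^ (r / 2 - 1) * |y| ^ r := by
  have hsqrt : 0 < √T := Real.sqrt_pos.2 hT
  rcases le_total |x| (√T * |y|) with h | h
  · have hpow : |x| ^ (r - 2) ≤ T ^ (r / 2 - 1) * |y| ^ (r - 2) :=
      calc |x| ^ (r - 2) ≤ (√T * |y|) ^ (r - 2) :=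
            Real.rpow_le_rpow (abs_nonneg x) h (by linarith)
        _ = T ^ (r / 2 - 1) * |y| ^ (r - 2) := by
            rw [Real.mul_rpow hsqrt.le (abs_nonneg y), Real.sqrt_eq_rpow, ← Real.rpow_mul hT.le]
            ring_nf
    have hx : 0 ≤ T⁻¹ * |x| ^ r := by positivity
    rw [abs_rpow_eq_rpow_sub_two_mul_sq hr y, ← mul_assoc]
    linarith [mul_le_mul_of_nonneg_right hpow (sq_nonneg y)]
  · have hsq : y ^ 2 ≤ T⁻¹ * x ^ 2 := by
      rw [inv_mul_eq_div, le_div_iff₀ hT, ← sq_abs x, ← sq_abs y, mul_comm,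
        ← Real.sq_sqrt hT.le, ← mul_pow]
      gcongr
    have hy : 0 ≤ T ^ (r / 2 - 1) * |y| ^ r := by positivity
    rw [abs_rpow_eq_rpow_sub_two_mul_sq hr x]
    nlinarith [mul_le_mul_of_nonneg_left hsq (Real.rpow_nonneg (abs_nonneg x) (r - 2))]

lemma abs_rpow_sub_two_mul_self_mul_le (hr : 2 ≤ r) (x y : ℝ) :
    |(|x| ^ (r - 2) * x) * y| ≤ |x| ^ r + |y| ^ r := by
  have hpow : 0 ≤ |x| ^ (r - 2) := by positivity
  have hyoung : |x| ^ (r - 2) * y ^ 2 ≤ |x| ^ r + |y| ^ r := by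
    simpa using rpow_sub_two_mul_sq_le hr one_pos x y
  have hamgm : |x| * |y| ≤ (x ^ 2 + y ^ 2) / 2 := by
    rw [← sq_abs x, ← sq_abs y]; nlinarith [sq_nonneg (|x| - |y|)]
  have hy : 0 ≤ |y| ^ r := by positivity
  calc |(|x| ^ (r - 2) * x) * y| = |x| ^ (r - 2) * (|x| * |y|) := by
        rw [abs_mul, abs_mul, abs_of_nonneg hpow, mul_assoc]
    _ ≤ |x| ^ (r - 2) * ((x ^ 2 + y ^ 2) / 2) := by gcongr
    _ = (|x| ^ r + |x| ^ (r - 2) * y ^ 2) / 2 := by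
        rw [abs_rpow_eq_rpow_sub_two_mul_sq hr x]; ring
    _ ≤ |x| ^ r + |y| ^ r := by linarith

end PowerInequalities

/-! ### Absolute moments -/

section AbsoluteMoments

variable {Ω : Type*} [MeasurableSpace Ω] {P : Measure Ω} {r : ℝ} {S : Ω → ℝ}

lemma memLp_ofReal_iff_integrable_abs_rpow (hr : 0 < r) (hS : AEStronglyMeasurable S P) :
    MemLp S (ENNReal.ofReal r) P ↔ Integrable (fun ω => |S ω| ^ r) P := by
  rw [← integrable_norm_rpow_iff hS (by simpa using hr) ENNReal.ofReal_ne_top,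
    ENNReal.toReal_ofReal hr.le]
  rfl

lemma integrable_abs_rpow_of_memLp (hr : 0 < r) (hS : MemLp S (ENNReal.ofReal r) P) :
    Integrable (fun ω => |S ω| ^ r) P :=
  (memLp_ofReal_iff_integrable_abs_rpow hr hS.1).1 hS

lemma memLp_two_of_memLp_ofReal [IsFiniteMeasure P] (hr : 2 ≤ r)
    (hS : MemLp S (ENNReal.ofReal r) P) : MemLp S 2 P :=
  hS.mono_exponent (by simpa using ENNReal.ofReal_le_ofReal hr)

/-- The absolute moment of order `r` of the random variable `X` is finite and at most `M`. The
integral alone would not do, since it takes the value `0` when the moment is infinite. -/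
structure HasMomentLE (P : Measure Ω) (X : Ω → ℝ) (r M : ℝ) : Prop where
  memLp : MemLp X (ENNReal.ofReal r) P
  integral_le : ∫ ω, |X ω| ^ r ∂P ≤ M

namespace HasMomentLE

variable {X Y : Ω → ℝ} {A B : ℝ}

lemma integrable (hX : HasMomentLE P X r A) (hr : 0 < r) : Integrable (fun ω => |X ω| ^ r) P :=
  integrable_abs_rpow_of_memLp hr hX.memLp

lemma mono (hX : HasMomentLE P X r A) (hAB : A ≤ B) : HasMomentLE P X r B :=
  ⟨hX.memLp, hX.integral_le.trans hAB⟩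

lemma congr_ae (hX : HasMomentLE P X r A) (hXY : X =ᵐ[P] Y) : HasMomentLE P Y r A :=
  ⟨hX.memLp.ae_eq hXY, (integral_congr_ae (hXY.mono fun ω hω => by simp only [hω])).symm.trans_le
    hX.integral_le⟩

lemma of_abs_rpow_le (hr : 0 < r) (hX : AEStronglyMeasurable X P) {G : Ω → ℝ} (hG : Integrable G P)
    (hXG : ∀ ω, |X ω| ^ r ≤ G ω) : HasMomentLE P X r (∫ ω, G ω ∂P) := by
  have hpow : Measurable fun x : ℝ => |x| ^ r := by fun_prop
  have hinteg : Integrable (fun ω => |X ω| ^ r) P :=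
    hG.mono' (hpow.comp_aemeasurable hX.aemeasurable).aestronglyMeasurable (ae_of_all _ fun ω => by
      rw [Real.norm_of_nonneg (by positivity)]
      exact hXG ω)
  exact ⟨(memLp_ofReal_iff_integrable_abs_rpow hr hX).2 hinteg, integral_mono hinteg hG hXG⟩

lemma neg (hX : HasMomentLE P X r A) : HasMomentLE P (fun ω => -X ω) r A :=
  ⟨hX.memLp.neg, by simpa only [abs_neg] using hX.integral_le⟩

lemma const_mul (hX : HasMomentLE P X r A) (c : ℝ) :
    HasMomentLE P (fun ω => c * X ω) r (|c| ^ r * A) := by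
  refine ⟨hX.memLp.const_mul c, ?_⟩
  simp only [abs_mul, Real.mul_rpow (abs_nonneg _) (abs_nonneg _), integral_const_mul]
  exact mul_le_mul_of_nonneg_left hX.integral_le (by positivity)

lemma add (hX : HasMomentLE P X r A) (hY : HasMomentLE P Y r B) (hr : 1 ≤ r) :
    HasMomentLE P (fun ω => X ω + Y ω) r (2 ^ (r - 1) * (A + B)) := by
  have hr0 : 0 < r := by linarith
  have hinteg := (hX.integrable hr0).add (hY.integrable hr0)
  refine (of_abs_rpow_le hr0 (hX.memLp.1.add hY.memLp.1) (hinteg.const_mul (2 ^ (r - 1)))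
    fun ω => abs_add_rpow_le_two_rpow_mul hr _ _).mono ?_
  rw [integral_const_mul, integral_add' (hX.integrable hr0) (hY.integrable hr0)]
  gcongr
  exacts [hX.integral_le, hY.integral_le]

lemma sub (hX : HasMomentLE P X r A) (hY : HasMomentLE P Y r B) (hr : 1 ≤ r) :
    HasMomentLE P (fun ω => X ω - Y ω) r (2 ^ (r - 1) * (A + B)) := by
  simpa only [sub_eq_add_neg] using hX.add hY.neg hr

lemma mul (hX : HasMomentLE P X (2 * r) A) (hY : HasMomentLE P Y (2 * r) B) (hr : 0 < r) :
    HasMomentLE P (fun ω => X ω * Y ω) r (A + B) := by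
  have h2r : 0 < 2 * r := by linarith
  refine (of_abs_rpow_le hr (hX.memLp.1.mul hY.memLp.1)
    ((hX.integrable h2r).add (hY.integrable h2r)) fun ω => abs_mul_rpow_le hr _ _).mono ?_
  rw [integral_add' (hX.integrable h2r) (hY.integrable h2r)]
  exact add_le_add hX.integral_le hY.integral_le

lemma sum_div {n : ℕ} (hn : n ≠ 0) {X : ℕ → Ω → ℝ} (hX : ∀ k < n, HasMomentLE P (X k) r A)
    (hr : 1 ≤ r) : HasMomentLE P (fun ω => (∑ k ∈ Finset.range n, X k ω) / n) r A := by
  have hr0 : 0 < r := by linarith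
  have hinteg : ∀ k ∈ Finset.range n, Integrable (fun ω => |X k ω| ^ r) P := fun k hk =>
    (hX k (Finset.mem_range.1 hk)).integrable hr0
  have hmeas : AEStronglyMeasurable (fun ω => (∑ k ∈ Finset.range n, X k ω) / n) P :=
    ((Finset.aestronglyMeasurable_fun_sum _ fun k hk => (hX k (Finset.mem_range.1 hk)).memLp.1
      ).aemeasurable.div_const _).aestronglyMeasurable
  refine (of_abs_rpow_le hr0 hmeas ((integrable_finsetSum _ hinteg).div_const (n : ℝ))
    fun ω => abs_sum_div_rpow_le hn hr _).mono ?_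
  rw [integral_div, integral_finsetSum _ hinteg, div_le_iff₀ (by positivity)]
  refine (Finset.sum_le_sum fun k hk => (hX k (Finset.mem_range.1 hk)).integral_le).trans ?_
  simp [mul_comm]

/-- Fatou's lemma. -/
lemma of_tendsto (hr : 0 < r) {X : ℕ → Ω → ℝ} (hX : ∀ j, HasMomentLE P (X j) r A)
    (hlim : ∀ᵐ ω ∂P, Tendsto (fun j => X j ω) atTop (𝓝 (Y ω))) : HasMomentLE P Y r A := by
  have hpow : Continuous fun x : ℝ => |x| ^ r := continuous_abs.rpow_const fun _ => Or.inr hr.le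
  have hY : AEStronglyMeasurable Y P :=
    aestronglyMeasurable_of_tendsto_ae atTop (fun j => (hX j).memLp.1) hlim
  have hle : ∫⁻ ω, ENNReal.ofReal (|Y ω| ^ r) ∂P ≤ ENNReal.ofReal A :=
    calc ∫⁻ ω, ENNReal.ofReal (|Y ω| ^ r) ∂P
        = ∫⁻ ω, liminf (fun j => ENNReal.ofReal (|X j ω| ^ r)) atTop ∂P :=
          lintegral_congr_ae (hlim.mono fun ω hω =>
            (((ENNReal.continuous_ofReal.comp hpow).tendsto _).comp hω).liminf_eq.symm)
      _ ≤ liminf (fun j => ∫⁻ ω, ENNReal.ofReal (|X j ω| ^ r) ∂P) atTop :=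
          lintegral_liminf_le' fun j => (ENNReal.measurable_ofReal.comp
            hpow.measurable).comp_aemeasurable (hX j).memLp.1.aemeasurable
      _ ≤ ENNReal.ofReal A := liminf_le_of_le (by isBoundedDefault) fun b hb => by
          obtain ⟨j, hj⟩ := hb.exists
          refine hj.trans ?_
          rw [← ofReal_integral_eq_lintegral_ofReal ((hX j).integrable hr)
            (ae_of_all _ fun ω => by positivity)]
          exact ENNReal.ofReal_le_ofReal (hX j).integral_le
  have hA : 0 ≤ A := (integral_nonneg fun ω => by positivity).trans (hX 0).integral_le
  have hinteg : Integrable (fun ω => |Y ω| ^ r) P :=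
    ⟨hpow.comp_aestronglyMeasurable hY, (hasFiniteIntegral_iff_ofReal
      (ae_of_all _ fun ω => by positivity)).2 (hle.trans_lt ENNReal.ofReal_lt_top)⟩
  refine ⟨(memLp_ofReal_iff_integrable_abs_rpow hr hY).2 hinteg, ?_⟩
  rwa [← ENNReal.ofReal_le_ofReal_iff hA,
    ofReal_integral_eq_lintegral_ofReal hinteg (ae_of_all _ fun ω => by positivity)]

end HasMomentLE

end AbsoluteMoments

/-! ### Moments of sums of martingale differences -/

section MartingaleDifferences

variable {Ω : Type*} [MeasurableSpace Ω] {P : Measure Ω} {r : ℝ} {S D Y N : Ω → ℝ}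

lemma memLp_mul_of_indepFun (hr : 0 < r) (hY : MemLp Y (ENNReal.ofReal r) P)
    (hN : MemLp N (ENNReal.ofReal r) P) (h : IndepFun Y N P) :
    MemLp (fun ω => Y ω * N ω) (ENNReal.ofReal r) P := by
  refine (memLp_ofReal_iff_integrable_abs_rpow hr (hY.1.mul hN.1)).2 ?_
  have hm : Measurable (fun x : ℝ => |x| ^ r) := by fun_prop
  refine ((h.comp hm hm).integrable_mul (integrable_abs_rpow_of_memLp hr hY)
    (integrable_abs_rpow_of_memLp hr hN)).congr (ae_of_all _ fun ω => ?_)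
  simp [abs_mul, Real.mul_rpow]

lemma integrable_rpow_sub_two_mul_self_mul (hr : 2 ≤ r) (hS : MemLp S (ENNReal.ofReal r) P)
    (hD : MemLp D (ENNReal.ofReal r) P) :
    Integrable (fun ω => |S ω| ^ (r - 2) * S ω * D ω) P := by
  have hr0 : 0 < r := by linarith
  have hm : Measurable (fun x : ℝ => |x| ^ (r - 2)) := by fun_prop
  exact ((integrable_abs_rpow_of_memLp hr0 hS).add (integrable_abs_rpow_of_memLp hr0 hD)).mono'
    (((hm.comp_aemeasurable hS.1.aemeasurable).mul hS.1.aemeasurable).mul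
      hD.1.aemeasurable).aestronglyMeasurable
    (ae_of_all _ fun ω => abs_rpow_sub_two_mul_self_mul_le hr _ _)

lemma integrable_rpow_sub_two_mul_sq (hr : 2 ≤ r) (hS : MemLp S (ENNReal.ofReal r) P)
    (hD : MemLp D (ENNReal.ofReal r) P) :
    Integrable (fun ω => |S ω| ^ (r - 2) * D ω ^ 2) P := by
  have hr0 : 0 < r := by linarith
  have hm : Measurable (fun x : ℝ => |x| ^ (r - 2)) := by fun_prop
  refine ((integrable_abs_rpow_of_memLp hr0 hS).add (integrable_abs_rpow_of_memLp hr0 hD)).mono'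
    ((hm.comp_aemeasurable hS.1.aemeasurable).mul
      (hD.1.aemeasurable.pow_const 2)).aestronglyMeasurable (ae_of_all _ fun ω => ?_)
  rw [Real.norm_of_nonneg (by positivity)]
  simpa using rpow_sub_two_mul_sq_le hr one_pos (S ω) (D ω)

lemma integral_rpow_sub_two_mul_sq_le (hr : 2 ≤ r) {T : ℝ} (hT : 0 < T)
    (hS : MemLp S (ENNReal.ofReal r) P) (hD : MemLp D (ENNReal.ofReal r) P) :
    ∫ ω, |S ω| ^ (r - 2) * D ω ^ 2 ∂P
      ≤ T⁻¹ * ∫ ω, |S ω| ^ r ∂P + T ^ (r / 2 - 1) * ∫ ω, |D ω| ^ r ∂P := by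
  have hSr := (integrable_abs_rpow_of_memLp (by linarith) hS).const_mul T⁻¹
  have hDr := (integrable_abs_rpow_of_memLp (by linarith) hD).const_mul (T ^ (r / 2 - 1))
  rw [← integral_const_mul, ← integral_const_mul, ← integral_add hSr hDr]
  exact integral_mono (integrable_rpow_sub_two_mul_sq hr hS hD) (hSr.add hDr)
    fun ω => rpow_sub_two_mul_sq_le hr hT _ _

lemma integral_abs_add_rpow_le (hr : 2 ≤ r) (hS : MemLp S (ENNReal.ofReal r) P)
    (hD : MemLp D (ENNReal.ofReal r) P)
    (horth : ∫ ω, |S ω| ^ (r - 2) * S ω * D ω ∂P = 0) :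
    ∫ ω, |S ω + D ω| ^ r ∂P ≤ ∫ ω, |S ω| ^ r ∂P + expansionConst r *
      (∫ ω, |S ω| ^ (r - 2) * D ω ^ 2 ∂P + ∫ ω, |D ω| ^ r ∂P) := by
  have hr0 : 0 < r := by linarith
  have hSr := integrable_abs_rpow_of_memLp hr0 hS
  have hDr := integrable_abs_rpow_of_memLp hr0 hD
  have hlin := (integrable_rpow_sub_two_mul_self_mul hr hS hD).const_mul r
  have hquad := integrable_rpow_sub_two_mul_sq hr hS hD
  have hrem := (hquad.add hDr).const_mul (expansionConst r)
  calc ∫ ω, |S ω + D ω| ^ r ∂P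
      ≤ ∫ ω, (|S ω| ^ r + r * (|S ω| ^ (r - 2) * S ω * D ω)
          + expansionConst r * (|S ω| ^ (r - 2) * D ω ^ 2 + |D ω| ^ r)) ∂P :=
        integral_mono (integrable_abs_rpow_of_memLp hr0 (hS.add hD)) ((hSr.add hlin).add hrem)
          fun ω => by
            simpa only [Pi.add_apply, mul_assoc] using abs_add_rpow_le_expansion hr (S ω) (D ω)
    _ = _ := by
        rw [integral_add (by exact hSr.add hlin) (by exact hrem), integral_add hSr hlin,
          integral_const_mul, integral_const_mul, integral_add hquad hDr, horth]
        ring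

lemma integral_abs_rpow_add_le_integral_abs_add_rpow (hr : 2 ≤ r)
    (hS : MemLp S (ENNReal.ofReal r) P) (hD : MemLp D (ENNReal.ofReal r) P)
    (horth : ∫ ω, |S ω| ^ (r - 2) * S ω * D ω ∂P = 0) :
    ∫ ω, |S ω| ^ r ∂P + 2 * (2 ^ r)⁻¹ * ∫ ω, |D ω| ^ r ∂P ≤ ∫ ω, |S ω + D ω| ^ r ∂P := by
  have hr0 : 0 < r := by linarith
  have hSr := integrable_abs_rpow_of_memLp hr0 hS
  have hDr := (integrable_abs_rpow_of_memLp hr0 hD).const_mul (2 * (2 ^ r)⁻¹)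
  have hlin := (integrable_rpow_sub_two_mul_self_mul hr hS hD).const_mul r
  calc _ = ∫ ω, (|S ω| ^ r + r * (|S ω| ^ (r - 2) * S ω * D ω)
          + 2 * (2 ^ r)⁻¹ * |D ω| ^ r) ∂P := by
        rw [integral_add (by exact hSr.add hlin) hDr, integral_add hSr hlin,
          integral_const_mul, integral_const_mul, horth]
        ring
    _ ≤ ∫ ω, |S ω + D ω| ^ r ∂P :=
        integral_mono ((hSr.add hlin).add hDr) (integrable_abs_rpow_of_memLp hr0 (hS.add hD))
          fun ω => by
            refine le_trans (le_of_eq ?_) (tangent_add_le_abs_add_rpow hr (S ω) (D ω))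
            rw [abs_div, abs_two, Real.div_rpow (abs_nonneg _) zero_le_two]
            ring

lemma integral_rpow_sub_two_mul_self_mul_eq_zero (hr : 2 ≤ r)
    (hS : MemLp S (ENNReal.ofReal r) P) (hY : MemLp Y (ENNReal.ofReal r) P)
    (hN : Integrable N P) (hind : IndepFun (fun ω => (S ω, Y ω)) N P)
    (hmean : ∫ ω, N ω ∂P = 0) :
    ∫ ω, |S ω| ^ (r - 2) * S ω * (Y ω * N ω) ∂P = 0 := by
  have hind' : IndepFun (fun ω => |S ω| ^ (r - 2) * S ω * Y ω) N P :=
    hind.comp (φ := fun z : ℝ × ℝ => |z.1| ^ (r - 2) * z.1 * z.2) (ψ := id)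
      (by fun_prop) measurable_id
  have hfactor := hind'.integral_mul_eq_mul_integral
    (integrable_rpow_sub_two_mul_self_mul hr hS hY).1 hN.1
  simpa only [Pi.mul_def, hmean, mul_zero, mul_assoc] using hfactor

lemma memLp_sum_mul_of_indepFun (hr : 0 < r) {n : ℕ} {Y N : ℕ → Ω → ℝ}
    (hY : ∀ k < n, MemLp (Y k) (ENNReal.ofReal r) P)
    (hN : ∀ k < n, MemLp (N k) (ENNReal.ofReal r) P)
    (hind : ∀ k < n, IndepFun (Y k) (N k) P) :
    MemLp (fun ω => ∑ j ∈ Finset.range n, Y j ω * N j ω) (ENNReal.ofReal r) P :=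
  memLp_finsetSum _ fun k hk =>
    have hk := Finset.mem_range.1 hk
    memLp_mul_of_indepFun hr (hY k hk) (hN k hk) (hind k hk)

variable [IsProbabilityMeasure P]

lemma integral_abs_add_mul_rpow_le (hr : 2 ≤ r) {T : ℝ} (hT : 0 < T)
    (hS : MemLp S (ENNReal.ofReal r) P) (hY : MemLp Y (ENNReal.ofReal r) P)
    (hN : MemLp N (ENNReal.ofReal r) P)
    (hind : IndepFun (fun ω => (S ω, Y ω)) N P) (hmean : ∫ ω, N ω ∂P = 0) :
    ∫ ω, |S ω + Y ω * N ω| ^ r ∂P ≤ ∫ ω, |S ω| ^ r ∂P + expansionConst r *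
      ((T⁻¹ * ∫ ω, |S ω| ^ r ∂P + T ^ (r / 2 - 1) * ∫ ω, |Y ω| ^ r ∂P) * ∫ ω, N ω ^ 2 ∂P
        + (∫ ω, |Y ω| ^ r ∂P) * ∫ ω, |N ω| ^ r ∂P) := by
  have hr0 : 0 < r := by linarith
  have hYN : IndepFun Y N P := hind.comp measurable_snd measurable_id
  have hN2 := memLp_two_of_memLp_ofReal hr hN
  have horth := integral_rpow_sub_two_mul_self_mul_eq_zero hr hS hY
    (hN2.integrable (by norm_num)) hind hmean
  have hquad : ∫ ω, |S ω| ^ (r - 2) * (Y ω * N ω) ^ 2 ∂P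
      = (∫ ω, |S ω| ^ (r - 2) * Y ω ^ 2 ∂P) * ∫ ω, N ω ^ 2 ∂P := by
    have h := (hind.comp (φ := fun z : ℝ × ℝ => |z.1| ^ (r - 2) * z.2 ^ 2) (ψ := fun x => x ^ 2)
      (by fun_prop) (by fun_prop)).integral_mul_eq_mul_integral
      (integrable_rpow_sub_two_mul_sq hr hS hY).1 hN2.integrable_sq.1
    simpa only [Pi.mul_def, Function.comp_def, mul_pow, mul_assoc] using h
  have hpow : ∫ ω, |Y ω * N ω| ^ r ∂P = (∫ ω, |Y ω| ^ r ∂P) * ∫ ω, |N ω| ^ r ∂P := by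
    have h := (hYN.comp (φ := fun x : ℝ => |x| ^ r) (ψ := fun x : ℝ => |x| ^ r)
      (by fun_prop) (by fun_prop)).integral_mul_eq_mul_integral
      (integrable_abs_rpow_of_memLp hr0 hY).1 (integrable_abs_rpow_of_memLp hr0 hN).1
    simpa only [Pi.mul_def, Function.comp_def, abs_mul,
      Real.mul_rpow (abs_nonneg _) (abs_nonneg _)] using h
  have hexpand := integral_abs_add_rpow_le hr hS (memLp_mul_of_indepFun hr0 hY hN hYN) horth
  rw [hquad, hpow] at hexpand
  have hyoung := integral_rpow_sub_two_mul_sq_le hr hT hS hY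
  have hE := expansionConst_pos hr
  exact hexpand.trans (by gcongr)

lemma le_mul_exp_of_succ_le {e : ℕ → ℝ} {x M : ℝ} (hx : 0 ≤ x) (hM : 0 ≤ M) (hzero : e 0 ≤ 0)
    {n : ℕ} (hsucc : ∀ k < n, e (k + 1) ≤ (1 + x) * e k + x * M) :
    e n ≤ M * Real.exp (n * x) := by
  have hgeom : ∀ k ≤ n, e k ≤ M * ((1 + x) ^ k - 1) := by
    intro k
    induction k with
    | zero => intro _; simpa using hzero
    | succ k ih =>
      intro hk
      have hprev := mul_le_mul_of_nonneg_left (ih (by omega)) (show 0 ≤ 1 + x by linarith)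
      rw [pow_succ]
      linarith [hsucc k hk]
  have hexp : (1 + x) ^ n ≤ Real.exp (n * x) := by
    rw [Real.exp_nat_mul, add_comm]
    gcongr
    exact Real.add_one_le_exp x
  exact (hgeom n le_rfl).trans (by gcongr; linarith)

/-- The constant in `hasMomentLE_sum_mul`, the Rosenthal type bound for the `r`-th moment
of a martingale; `K` bounds the moments of the factors of its increments. -/
noncomputable def rosenthalConst (r K : ℝ) : ℝ :=
  Real.exp (expansionConst r * (K + 2 * K ^ 2))

lemma expansion_step_le {K δ T e : ℝ} (hr : 2 ≤ r) (hK : 0 ≤ K) (hδ : 0 ≤ δ) (hT : 1 ≤ T)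
    (he : 0 ≤ e) :
    e + expansionConst r * ((T⁻¹ * e + T ^ (r / 2 - 1) * K) * (K * δ) + K * (K * δ))
      ≤ (1 + expansionConst r * (K + 2 * K ^ 2) * δ / T) * e
        + expansionConst r * (K + 2 * K ^ 2) * δ / T * T ^ (r / 2) := by
  have hT0 : 0 < T := by linarith
  have hE := expansionConst_pos hr
  have hTr : 1 ≤ T ^ (r / 2 - 1) := Real.one_le_rpow hT (by linarith)
  have hsplit : T ^ (r / 2) = T ^ (r / 2 - 1) * T := by
    rw [← Real.rpow_add_one hT0.ne', sub_add_cancel]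
  have hlast : K * (K * δ) ≤ T ^ (r / 2 - 1) * (K * (K * δ)) :=
    le_mul_of_one_le_left (by positivity) hTr
  have hslack₁ : 0 ≤ expansionConst r * K * δ * T ^ (r / 2 - 1) := by positivity
  have hslack₂ : 0 ≤ expansionConst r * (2 * K ^ 2) * δ * (T⁻¹ * e) := by positivity
  calc _ ≤ e + expansionConst r *
        ((T⁻¹ * e + T ^ (r / 2 - 1) * K) * (K * δ) + T ^ (r / 2 - 1) * (K * (K * δ))) := by gcongr
    _ ≤ e + expansionConst r * (K + 2 * K ^ 2) * δ * (T⁻¹ * e)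
        + expansionConst r * (K + 2 * K ^ 2) * δ * T ^ (r / 2 - 1) := by linarith
    _ = _ := by rw [hsplit]; field_simp

/-- The factor `N k` of the increment `Y k * N k` is centred and independent of the past, so its
first order contribution to the `r`-th moment vanishes, and a step adds only `O(δ)` to that
moment. -/
theorem hasMomentLE_sum_mul {K δ T : ℝ} (hr : 2 ≤ r) (hK : 0 ≤ K) (hδ : 0 ≤ δ)
    (hT : 1 ≤ T) {n : ℕ} (hn : n * δ ≤ T) {Y N : ℕ → Ω → ℝ}
    (hY : ∀ k < n, HasMomentLE P (Y k) r K) (hN : ∀ k < n, HasMomentLE P (N k) r (K * δ))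
    (hN2 : ∀ k < n, ∫ ω, N k ω ^ 2 ∂P ≤ K * δ) (hmean : ∀ k < n, ∫ ω, N k ω ∂P = 0)
    (hind : ∀ k < n, IndepFun (fun ω => (∑ j ∈ Finset.range k, Y j ω * N j ω, Y k ω)) (N k) P) :
    HasMomentLE P (fun ω => ∑ j ∈ Finset.range n, Y j ω * N j ω) r
      (rosenthalConst r K * T ^ (r / 2)) := by
  have hr0 : 0 < r := by linarith
  have hT0 : 0 < T := by linarith
  have hE := expansionConst_pos hr
  have hYN : ∀ k < n, IndepFun (Y k) (N k) P := fun k hk =>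
    (hind k hk).comp measurable_snd measurable_id
  have hS : ∀ k ≤ n,
      MemLp (fun ω => ∑ j ∈ Finset.range k, Y j ω * N j ω) (ENNReal.ofReal r) P := fun k hk =>
    memLp_sum_mul_of_indepFun hr0 (fun j hj => (hY j (hj.trans_le hk)).memLp)
      (fun j hj => (hN j (hj.trans_le hk)).memLp) fun j hj => hYN j (hj.trans_le hk)
  have hgronwall := le_mul_exp_of_succ_le (n := n) (M := T ^ (r / 2))
    (x := expansionConst r * (K + 2 * K ^ 2) * δ / T)
    (e := fun k => ∫ ω, |∑ j ∈ Finset.range k, Y j ω * N j ω| ^ r ∂P)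
    (by positivity) (by positivity) (by simp [Real.zero_rpow hr0.ne']) fun k hk => by
      have hstep := integral_abs_add_mul_rpow_le hr hT0 (hS k hk.le) (hY k hk).memLp
        (hN k hk).memLp (hind k hk) (hmean k hk)
      have he : 0 ≤ ∫ ω, |∑ j ∈ Finset.range k, Y j ω * N j ω| ^ r ∂P :=
        integral_nonneg fun ω => by positivity
      simp only [Finset.sum_range_succ]
      refine (hstep.trans ?_).trans (expansion_step_le hr hK hδ hT he)
      gcongr
      exacts [(hY k hk).integral_le, hN2 k hk, (hY k hk).integral_le, (hN k hk).integral_le]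
  have hexponent : (n : ℝ) * (expansionConst r * (K + 2 * K ^ 2) * δ / T)
      ≤ expansionConst r * (K + 2 * K ^ 2) :=
    calc _ = expansionConst r * (K + 2 * K ^ 2) * (n * δ / T) := by ring
      _ ≤ _ := mul_le_of_le_one_right (by positivity) ((div_le_one hT0).2 hn)
  refine ⟨hS n le_rfl, ?_⟩
  rw [mul_comm (rosenthalConst r K)]
  exact hgronwall.trans (mul_le_mul_of_nonneg_left (Real.exp_le_exp.2 hexponent) (by positivity))

end MartingaleDifferences

/-! ### Values of a Lévy basis on bounded Borel sets -/

section LevyBasis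

lemma exists_nat_indicator_Icc_comp_ne_zero {Ω : Type*} [MeasurableSpace Ω] {P : Measure Ω}
    [NeZero P] (Y : Ω → ℝ) :
    ∃ M : ℕ, ¬ (fun ω => (Icc (-(M : ℝ)) M).indicator (fun _ => (1 : ℝ)) (Y ω)) =ᵐ[P] 0 := by
  by_contra! hzero
  obtain ⟨ω, hω⟩ := (ae_all_iff.2 hzero).exists
  obtain ⟨M, hM⟩ := exists_nat_ge |Y ω|
  have hmem : Y ω ∈ Icc (-(M : ℝ)) M := abs_le.1 hM
  simpa [hmem] using hω M

/-- On the event `|Y| ≤ M`, which is independent of `X`, the moments of `X` are controlled by those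
of `X + Y`. -/
lemma memLp_left_of_indepFun_add {Ω : Type*} [MeasurableSpace Ω] {P : Measure Ω}
    [IsProbabilityMeasure P] {X Y : Ω → ℝ} {r : ℝ} (hr : 1 ≤ r) (hX : Measurable X)
    (hY : Measurable Y) (hind : IndepFun X Y P)
    (hadd : MemLp (fun ω => X ω + Y ω) (ENNReal.ofReal r) P) : MemLp X (ENNReal.ofReal r) P := by
  have hr0 : 0 < r := by linarith
  obtain ⟨M, hM⟩ := exists_nat_indicator_Icc_comp_ne_zero (P := P) Y
  have hpow : Measurable fun x : ℝ => |x| ^ r := by fun_prop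
  have hcut : Measurable ((Icc (-(M : ℝ)) M).indicator fun _ => (1 : ℝ)) :=
    measurable_const.indicator measurableSet_Icc
  have hdom : Integrable (fun ω => 2 ^ (r - 1) * (|X ω + Y ω| ^ r + (M : ℝ) ^ r)) P :=
    ((integrable_abs_rpow_of_memLp hr0 hadd).add (integrable_const _)).const_mul _
  rw [memLp_ofReal_iff_integrable_abs_rpow hr0 hX.aestronglyMeasurable]
  refine (hind.comp hpow hcut).integrable_left_of_integrable_op (fun x y => x * y) 1 one_ne_zero
    (fun x y => by simp [enorm_mul]) ?_ (hpow.comp hX).aestronglyMeasurable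
    (hcut.comp hY).aestronglyMeasurable hM
  refine hdom.mono' ((hpow.comp hX).mul (hcut.comp hY)).aestronglyMeasurable
    (ae_of_all _ fun ω => ?_)
  simp only [Function.comp_apply]
  by_cases hYM : Y ω ∈ Icc (-(M : ℝ)) M
  · rw [indicator_of_mem hYM, mul_one, Real.norm_of_nonneg (by positivity)]
    have hsplit := abs_add_rpow_le_two_rpow_mul hr (X ω + Y ω) (-Y ω)
    rw [add_neg_cancel_right, abs_neg] at hsplit
    exact hsplit.trans (by gcongr; exact abs_le.2 hYM)
  · rw [indicator_of_notMem hYM, mul_zero, norm_zero]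
    positivity

/-- Membership in `𝓑_b(ℝ²)`, the class of sets that indexes a Lévy basis. -/
structure IsBoundedBorel (B : Set (ℝ × ℝ)) : Prop where
  measurableSet : MeasurableSet B
  isBounded : Bornology.IsBounded B

namespace IsBoundedBorel

lemma empty : IsBoundedBorel ∅ := ⟨MeasurableSet.empty, Bornology.isBounded_empty⟩

lemma union {A B : Set (ℝ × ℝ)} (hA : IsBoundedBorel A) (hB : IsBoundedBorel B) :
    IsBoundedBorel (A ∪ B) :=
  ⟨hA.measurableSet.union hB.measurableSet, hA.isBounded.union hB.isBounded⟩

lemma biUnion_finset {ι : Type*} {C : ι → Set (ℝ × ℝ)} (hC : ∀ i, IsBoundedBorel (C i))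
    (s : Finset ι) : IsBoundedBorel (⋃ i ∈ s, C i) :=
  ⟨s.measurableSet_biUnion fun i _ => (hC i).measurableSet,
    (Bornology.isBounded_biUnion s.finite_toSet).2 fun i _ => (hC i).isBounded⟩

end IsBoundedBorel

/-- The rectangle `[u, v) × [0, 1)`, a bounded Borel set of volume `v - u`. -/
def strip (u v : ℝ) : Set (ℝ × ℝ) := Ico u v ×ˢ Ico 0 1

lemma isBoundedBorel_strip (u v : ℝ) : IsBoundedBorel (strip u v) :=
  ⟨measurableSet_Ico.prod measurableSet_Ico,
    (Metric.isBounded_Ico u v).prod (Metric.isBounded_Ico 0 1)⟩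

lemma volume_real_strip {u v : ℝ} (huv : u ≤ v) : volume.real (strip u v) = v - u := by
  rw [strip, Measure.volume_eq_prod, measureReal_prod_prod]
  simp [Real.volume_real_Ico, huv]

lemma volume_real_strip_zero {v : ℝ} (hv : 0 ≤ v) : volume.real (strip 0 v) = v := by
  rw [volume_real_strip hv, sub_zero]

lemma strip_union_strip {u v w : ℝ} (huv : u ≤ v) (hvw : v ≤ w) :
    strip u v ∪ strip v w = strip u w := by
  rw [strip, strip, strip, ← Set.union_prod, Ico_union_Ico_eq_Ico huv hvw]

lemma disjoint_strip_strip (u v w : ℝ) : Disjoint (strip u v) (strip v w) :=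
  Set.disjoint_left.2 fun _ hz hz' => hz.1.2.not_ge hz'.1.1

/-- The sequence `A, B, ∅, ∅, …`, which turns statements about sequences of sets into statements
about pairs. -/
def pairSeq (A B : Set (ℝ × ℝ)) : ℕ → Set (ℝ × ℝ)
  | 0 => A
  | 1 => B
  | _ => ∅

lemma IsBoundedBorel.pairSeq {A B : Set (ℝ × ℝ)} (hA : IsBoundedBorel A) (hB : IsBoundedBorel B) :
    ∀ i, IsBoundedBorel (pairSeq A B i)
  | 0 => hA
  | 1 => hB
  | _ + 2 => .empty

lemma pairwise_disjoint_pairSeq {A B : Set (ℝ × ℝ)} (hAB : Disjoint A B) :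
    Pairwise fun i j => Disjoint (pairSeq A B i) (pairSeq A B j)
  | 0, 0, h => (h rfl).elim
  | 0, 1, _ => hAB
  | 0, _ + 2, _ => disjoint_empty A
  | 1, 0, _ => hAB.symm
  | 1, 1, h => (h rfl).elim
  | 1, _ + 2, _ => disjoint_empty B
  | _ + 2, _, _ => empty_disjoint _

lemma iUnion_pairSeq (A B : Set (ℝ × ℝ)) : ⋃ i, pairSeq A B i = A ∪ B := by
  refine Subset.antisymm (iUnion_subset ?_)
    (union_subset (subset_iUnion (pairSeq A B) 0) (subset_iUnion (pairSeq A B) 1))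
  rintro (_ | _ | _)
  exacts [subset_union_left, subset_union_right, empty_subset _]

namespace IsLevyBasis

variable {Ω : Type*} [MeasurableSpace Ω] {P : Measure Ω} {τ : Triplet} {L : Set (ℝ × ℝ) → Ω → ℝ}
  {A B : Set (ℝ × ℝ)}

lemma aemeasurable (hL : IsLevyBasis P τ L) (hB : IsBoundedBorel B) : AEMeasurable (L B) P :=
  (hL.measurable B hB.1 hB.2).aemeasurable

lemma iIndepFun_of_denumerable {ι : Type*} [Denumerable ι] (hL : IsLevyBasis P τ L)
    {C : ι → Set (ℝ × ℝ)} (hC : ∀ i, IsBoundedBorel (C i))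
    (hdisj : Pairwise fun i j => Disjoint (C i) (C j)) : iIndepFun (fun i => L (C i)) P := by
  have hnat := hL.independent (fun k => C ((Denumerable.eqv ι).symm k)) (fun _ => (hC _).1)
    (fun _ => (hC _).2) fun i j hij => hdisj fun h => hij ((Denumerable.eqv ι).symm.injective h)
  simpa using hnat.precomp (Denumerable.eqv ι).injective

lemma indepFun (hL : IsLevyBasis P τ L) (hA : IsBoundedBorel A) (hB : IsBoundedBorel B)
    (hAB : Disjoint A B) : IndepFun (L A) (L B) P :=
  (hL.independent (pairSeq A B) (fun i => (hA.pairSeq hB i).1) (fun i => (hA.pairSeq hB i).2)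
    (pairwise_disjoint_pairSeq hAB)).indepFun zero_ne_one

variable [IsProbabilityMeasure P]

lemma identDistrib (hL : IsLevyBasis P τ L) (hA : IsBoundedBorel A) (hB : IsBoundedBorel B)
    (hvol : volume.real A = volume.real B) : IdentDistrib (L A) (L B) P P := by
  have := Measure.isProbabilityMeasure_map (hL.aemeasurable hA)
  have := Measure.isProbabilityMeasure_map (hL.aemeasurable hB)
  refine ⟨hL.aemeasurable hA, hL.aemeasurable hB, Measure.ext_of_charFun (funext fun z => ?_)⟩
  rw [hL.charFun_eq A hA.1 hA.2, hL.charFun_eq B hB.1 hB.2]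
  exact congrArg (fun v : ℝ => Complex.exp (v * τ.exponent z)) hvol

lemma identDistrib_seed (hL : IsLevyBasis P τ L) {seed : Measure ℝ} (hseed : τ.IsSeedLaw seed)
    (hB : IsBoundedBorel B) (hvol : volume.real B = 1) : IdentDistrib (L B) id P seed := by
  have := Measure.isProbabilityMeasure_map (hL.aemeasurable hB)
  have := hseed.1
  refine ⟨hL.aemeasurable hB, aemeasurable_id, Measure.ext_of_charFun (funext fun z => ?_)⟩
  rw [Measure.map_id, hL.charFun_eq B hB.1 hB.2, hseed.2, ← measureReal_def, hvol,
    Complex.ofReal_one, one_mul]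

lemma ae_eq_zero (hL : IsLevyBasis P τ L) (hB : IsBoundedBorel B) (hvol : volume.real B = 0) :
    ∀ᵐ ω ∂P, L B ω = 0 := by
  have := Measure.isProbabilityMeasure_map (hL.aemeasurable hB)
  have hdirac : P.map (L B) = Measure.dirac 0 := by
    refine Measure.ext_of_charFun (funext fun z => ?_)
    rw [hL.charFun_eq B hB.1 hB.2, ← measureReal_def, hvol, charFun_dirac]
    simp
  refine ae_of_ae_map (p := (· = 0)) (hL.aemeasurable hB) ?_
  rw [hdirac, ae_dirac_eq, eventually_pure]

lemma ae_union (hL : IsLevyBasis P τ L) (hA : IsBoundedBorel A) (hB : IsBoundedBorel B)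
    (hAB : Disjoint A B) : ∀ᵐ ω ∂P, L (A ∪ B) ω = L A ω + L B ω := by
  have hlim := hL.additive (pairSeq A B) (fun i => (hA.pairSeq hB i).1)
    (by rw [iUnion_pairSeq]; exact (hA.union hB).2) (pairwise_disjoint_pairSeq hAB)
  filter_upwards [hlim, hL.ae_eq_zero .empty measureReal_empty] with ω hlimω hempty
  rw [iUnion_pairSeq] at hlimω
  refine tendsto_nhds_unique hlimω (tendsto_const_nhds.congr' ?_)
  filter_upwards [eventually_ge_atTop 2] with N hN
  obtain ⟨k, rfl⟩ := Nat.exists_eq_add_of_le' hN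
  simp [Finset.sum_range_succ', pairSeq, hempty, add_comm]

lemma ae_biUnion_finset {ι : Type*} (hL : IsLevyBasis P τ L) {C : ι → Set (ℝ × ℝ)}
    (hC : ∀ i, IsBoundedBorel (C i)) (hdisj : Pairwise fun i j => Disjoint (C i) (C j))
    (s : Finset ι) : ∀ᵐ ω ∂P, L (⋃ i ∈ s, C i) ω = ∑ i ∈ s, L (C i) ω := by
  classical
  induction s using Finset.induction_on with
  | empty => simpa using hL.ae_eq_zero .empty measureReal_empty
  | insert i s hi ih =>
    have hunion := hL.ae_union (hC i) (.biUnion_finset hC s)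
      (disjoint_iUnion₂_right.2 fun j hj => hdisj fun h => hi (h ▸ hj))
    filter_upwards [ih, hunion] with ω hs hinsert
    rw [Finset.set_biUnion_insert, hinsert, Finset.sum_insert hi, hs]

lemma ae_strip (hL : IsLevyBasis P τ L) {u v w : ℝ} (huv : u ≤ v) (hvw : v ≤ w) :
    ∀ᵐ ω ∂P, L (strip u w) ω = L (strip u v) ω + L (strip v w) ω := by
  rw [← strip_union_strip huv hvw]
  exact hL.ae_union (isBoundedBorel_strip u v) (isBoundedBorel_strip v w)
    (disjoint_strip_strip u v w)

lemma memLp_strip_nat (hL : IsLevyBasis P τ L) {seed : Measure ℝ} (hseed : τ.IsSeedLaw seed)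
    {r : ℝ} (hmom : MemLp id (ENNReal.ofReal r) seed) (N : ℕ) :
    MemLp (L (strip 0 N)) (ENNReal.ofReal r) P := by
  induction N with
  | zero =>
    have hzero := hL.ae_eq_zero (isBoundedBorel_strip 0 ((0 : ℕ) : ℝ)) (by simp [strip])
    exact (MemLp.zero (ε := ℝ)).ae_eq (hzero.mono fun ω h => h.symm)
  | succ N ih =>
    have hstep : (N : ℝ) ≤ (N + 1 : ℕ) := by push_cast; linarith
    have hunit : MemLp (L (strip N (N + 1 : ℕ))) (ENNReal.ofReal r) P := by
      rwa [(hL.identDistrib_seed hseed (isBoundedBorel_strip _ _)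
          (by rw [volume_real_strip hstep]; simp)).memLp_iff]
    exact (ih.add hunit).ae_eq ((hL.ae_strip N.cast_nonneg hstep).mono fun ω h => h.symm)

lemma memLp (hL : IsLevyBasis P τ L) {seed : Measure ℝ} (hseed : τ.IsSeedLaw seed)
    {r : ℝ} (hr : 1 ≤ r) (hmom : MemLp id (ENNReal.ofReal r) seed) (hB : IsBoundedBorel B) :
    MemLp (L B) (ENNReal.ofReal r) P := by
  have hvol : 0 ≤ volume.real B := measureReal_nonneg
  have hstrip := isBoundedBorel_strip
  obtain ⟨N, hN⟩ := exists_nat_ge (volume.real B)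
  rw [(hL.identDistrib hB (hstrip 0 (volume.real B)) (volume_real_strip_zero hvol).symm).memLp_iff]
  exact memLp_left_of_indepFun_add hr (hL.measurable _ (hstrip _ _).1 (hstrip _ _).2)
    (hL.measurable _ (hstrip _ _).1 (hstrip _ _).2)
    (hL.indepFun (hstrip _ _) (hstrip _ _) (disjoint_strip_strip _ _ _))
    ((hL.memLp_strip_nat hseed hmom N).ae_eq (hL.ae_strip hvol hN))

end IsLevyBasis

end LevyBasis

/-! ### Moments of a Lévy basis -/

section LevyMoments

lemma eq_mul_of_nonneg_of_additive {f : ℝ → ℝ} (hnonneg : ∀ v, 0 ≤ v → 0 ≤ f v)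
    (hadd : ∀ v w, 0 ≤ v → 0 ≤ w → f (v + w) = f v + f w) {v : ℝ} (hv : 0 ≤ v) :
    f v = v * f 1 := by
  have hmul : ∀ (k : ℕ) (w : ℝ), 0 ≤ w → f (k * w) = k * f w := by
    intro k w hw
    induction k with
    | zero => simpa using hadd 0 0 le_rfl le_rfl
    | succ k ih =>
      push_cast
      rw [add_mul, add_mul, one_mul, one_mul, hadd _ _ (by positivity) hw, ih]
  have hmono : ∀ u w, 0 ≤ u → u ≤ w → f u ≤ f w := fun u w hu huw => by
    have hsplit := hadd u (w - u) hu (by linarith)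
    rw [add_sub_cancel] at hsplit
    linarith [hnonneg (w - u) (by linarith)]
  have hnat : ∀ k : ℕ, f k = k * f 1 := fun k => by simpa using hmul k 1 zero_le_one
  have hbound : ∀ k : ℕ, (k : ℝ) * |f v - v * f 1| ≤ f 1 := by
    intro k
    have hkv : 0 ≤ (k : ℝ) * v := by positivity
    have hfloor := Nat.floor_le hkv
    have hceil : (k : ℝ) * v ≤ (⌊(k : ℝ) * v⌋₊ + 1 : ℕ) := by
      exact_mod_cast (Nat.lt_floor_add_one ((k : ℝ) * v)).le
    have hlower := hmono _ _ (by positivity) hfloor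
    have hupper := hmono _ _ hkv hceil
    rw [hnat, hmul k v hv] at hlower hupper
    push_cast at hupper hceil
    rw [← abs_of_nonneg (Nat.cast_nonneg (α := ℝ) k), ← abs_mul, abs_le]
    constructor <;> nlinarith [hnonneg 1 zero_le_one]
  by_contra hne
  have hpos : 0 < |f v - v * f 1| := abs_pos.2 (sub_ne_zero.2 hne)
  obtain ⟨k, hk⟩ := exists_nat_gt (f 1 / |f v - v * f 1|)
  rw [div_lt_iff₀ hpos] at hk
  linarith [hbound k]

/-- Subdividing `[0, V]` into about `V / v` intervals of length `v` gives `F V ≥ c (V / v) F v`, up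
to the rounding that costs the factor `2`. -/
lemma le_mul_of_superadditive {F : ℝ → ℝ} {c v V : ℝ} (hc : 0 < c)
    (hnonneg : ∀ u, 0 ≤ u → 0 ≤ F u)
    (hsuper : ∀ u w, 0 ≤ u → 0 ≤ w → F u + c * F w ≤ F (u + w)) (hv : 0 ≤ v) (hvV : v ≤ V) :
    F v ≤ 2 / c * (F V / V) * v := by
  rcases hv.eq_or_lt with rfl | hvpos
  · have hzero := hsuper 0 0 le_rfl le_rfl
    rw [add_zero] at hzero
    nlinarith
  have hVpos : 0 < V := hvpos.trans_le hvV
  have hmultiple : ∀ k : ℕ, k * (c * F v) ≤ F (k * v) := by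
    intro k
    induction k with
    | zero => simpa using hnonneg 0 le_rfl
    | succ k ih =>
      push_cast
      rw [add_mul, add_mul, one_mul, one_mul]
      linarith [hsuper (k * v) v (by positivity) hv]
  have hm_le : ⌊V / v⌋₊ * v ≤ V :=
    (le_div_iff₀ hvpos).1 (Nat.floor_le (div_nonneg hVpos.le hv))
  have hm_ge : V ≤ 2 * ⌊V / v⌋₊ * v := by
    have hone : (1 : ℝ) ≤ ⌊V / v⌋₊ := by
      exact_mod_cast Nat.one_le_floor_iff _ |>.2 ((one_le_div hvpos).2 hvV)
    rw [← div_le_iff₀ hvpos]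
    linarith [Nat.lt_floor_add_one (V / v)]
  have hFm : ⌊V / v⌋₊ * (c * F v) ≤ F V := by
    have hrest := hsuper (⌊V / v⌋₊ * v) (V - ⌊V / v⌋₊ * v) (by positivity) (by linarith)
    rw [add_sub_cancel] at hrest
    nlinarith [hmultiple ⌊V / v⌋₊, hnonneg (V - ⌊V / v⌋₊ * v) (by linarith)]
  have hFv := mul_nonneg hc.le (hnonneg v hv)
  have hkey : V * (c * F v) ≤ 2 * F V * v :=
    calc V * (c * F v) ≤ 2 * ⌊V / v⌋₊ * v * (c * F v) := by gcongr
      _ = 2 * (⌊V / v⌋₊ * (c * F v)) * v := by ring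
      _ ≤ 2 * F V * v := by gcongr
  rw [show 2 / c * (F V / V) * v = 2 * F V * v / (V * c) by field_simp, le_div_iff₀ (by positivity)]
  linarith

lemma hasDerivAt_charFun_zero {μ : Measure ℝ} [IsProbabilityMeasure μ] (hμ : MemLp id 1 μ) :
    HasDerivAt (charFun μ) (Complex.I * (∫ x, x ∂μ : ℝ)) 0 := by
  have hμ' : MemLp id ((1 : ℕ) : ENNReal) μ := by simpa using hμ
  have hdiff : DifferentiableAt ℝ (charFun μ) 0 :=
    ((contDiff_charFun hμ').differentiable (by norm_num)).differentiableAt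
  have hderiv := iteratedDeriv_charFun_zero hμ'
  rw [iteratedDeriv_one] at hderiv
  simpa [hderiv] using hdiff.hasDerivAt

lemma mul_integral_exp_mul (c : ℂ) :
    c * ∫ v in (0 : ℝ)..1, Complex.exp (v * c) = Complex.exp c - 1 := by
  rcases eq_or_ne c 0 with rfl | hc
  · simp
  · simp_rw [mul_comm _ c]
    rw [integral_exp_mul_complex hc, mul_div_cancel₀ _ hc]
    simp

lemma Triplet.exponent_zero (τ : Triplet) : τ.exponent 0 = 0 := by
  simp [Triplet.exponent]

variable {Ω : Type*} [MeasurableSpace Ω] {P : Measure Ω} {τ : Triplet} {L : Set (ℝ × ℝ) → Ω → ℝ}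
  {A B : Set (ℝ × ℝ)}

/-- The Lévy basis minus its mean. By `IsLevyBasis.integral_eq_volume_real_mul` that mean is the
volume times the mean of `L` on a set of unit volume. -/
noncomputable def centred (P : Measure Ω) (L : Set (ℝ × ℝ) → Ω → ℝ) (B : Set (ℝ × ℝ)) (ω : Ω) : ℝ :=
  L B ω - volume.real B * ∫ ω', L (strip 0 1) ω' ∂P

namespace IsLevyBasis

lemma measurable_centred (hL : IsLevyBasis P τ L) (hB : IsBoundedBorel B) :
    Measurable (centred P L B) :=
  (hL.measurable B hB.1 hB.2).sub_const _

lemma indepFun_centred (hL : IsLevyBasis P τ L) (hA : IsBoundedBorel A) (hB : IsBoundedBorel B)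
    (hAB : Disjoint A B) : IndepFun (centred P L A) (centred P L B) P :=
  (hL.indepFun hA hB hAB).comp (measurable_id.sub_const _) (measurable_id.sub_const _)

variable [IsProbabilityMeasure P] {seed : Measure ℝ} {r : ℝ}

lemma ae_centred_union (hL : IsLevyBasis P τ L) (hA : IsBoundedBorel A) (hB : IsBoundedBorel B)
    (hAB : Disjoint A B) :
    ∀ᵐ ω ∂P, centred P L (A ∪ B) ω = centred P L A ω + centred P L B ω := by
  filter_upwards [hL.ae_union hA hB hAB] with ω hω
  rw [centred, centred, centred, hω, measureReal_union hAB hB.1 hA.2.measure_lt_top.ne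
    hB.2.measure_lt_top.ne]
  ring

lemma identDistrib_centred (hL : IsLevyBasis P τ L) (hA : IsBoundedBorel A)
    (hB : IsBoundedBorel B) (hvol : volume.real A = volume.real B) :
    IdentDistrib (centred P L A) (centred P L B) P P := by
  unfold centred
  rw [hvol]
  exact (hL.identDistrib hA hB hvol).comp (measurable_id.sub_const _)

lemma memLp_centred (hL : IsLevyBasis P τ L) (hseed : τ.IsSeedLaw seed) (hr : 1 ≤ r)
    (hmom : MemLp id (ENNReal.ofReal r) seed) (hB : IsBoundedBorel B) :
    MemLp (centred P L B) (ENNReal.ofReal r) P :=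
  (hL.memLp hseed hr hmom hB).sub (memLp_const _)

lemma memLp_one (hL : IsLevyBasis P τ L) (hseed : τ.IsSeedLaw seed) (hr : 1 ≤ r)
    (hmom : MemLp id (ENNReal.ofReal r) seed) (hB : IsBoundedBorel B) : MemLp (L B) 1 P :=
  (hL.memLp hseed hr hmom hB).mono_exponent (ENNReal.one_le_ofReal.2 hr)

lemma hasDerivAt_exp_volume_mul_exponent (hL : IsLevyBasis P τ L) (hseed : τ.IsSeedLaw seed)
    (hr : 1 ≤ r) (hmom : MemLp id (ENNReal.ofReal r) seed) (hB : IsBoundedBorel B) :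
    HasDerivAt (fun z : ℝ => Complex.exp (volume.real B * τ.exponent z))
      (Complex.I * (∫ ω, L B ω ∂P : ℝ)) 0 := by
  have := Measure.isProbabilityMeasure_map (hL.aemeasurable hB)
  have hderiv := hasDerivAt_charFun_zero ((memLp_map_measure_iff aestronglyMeasurable_id
    (hL.aemeasurable hB)).2 (hL.memLp_one hseed hr hmom hB))
  rw [integral_map (hL.aemeasurable hB) (by fun_prop)] at hderiv
  exact hderiv.congr_of_eventuallyEq (.of_forall fun z => (hL.charFun_eq B hB.1 hB.2 z).symm)

lemma norm_exp_mul_exponent_le_one (hL : IsLevyBasis P τ L) {v : ℝ} (hv : 0 ≤ v) (z : ℝ) :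
    ‖Complex.exp (v * τ.exponent z)‖ ≤ 1 := by
  have hstrip := isBoundedBorel_strip 0 v
  have := Measure.isProbabilityMeasure_map (hL.aemeasurable hstrip)
  have hnorm := norm_charFun_le_one (μ := P.map (L (strip 0 v))) z
  rwa [hL.charFun_eq _ hstrip.1 hstrip.2, ← measureReal_def, volume_real_strip_zero hv] at hnorm

lemma tendsto_integral_exp_mul_exponent (hL : IsLevyBasis P τ L) (hseed : τ.IsSeedLaw seed)
    (hr : 1 ≤ r) (hmom : MemLp id (ENNReal.ofReal r) seed) :
    Tendsto (fun z : ℝ => ∫ v in (0 : ℝ)..1, Complex.exp (v * τ.exponent z)) (𝓝 0) (𝓝 1) := by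
  have hlim : Tendsto (fun z : ℝ => ∫ v in (0 : ℝ)..1, Complex.exp (v * τ.exponent z)) (𝓝 0)
      (𝓝 (∫ _ in (0 : ℝ)..1, (1 : ℂ))) := by
    refine intervalIntegral.tendsto_integral_filter_of_dominated_convergence (fun _ => 1)
      (.of_forall fun z => Continuous.aestronglyMeasurable (by fun_prop)) (.of_forall fun z => ?_)
      (by simp) ?_
    · refine ae_of_all _ fun _ hv => ?_
      rw [uIoc_of_le zero_le_one] at hv
      exact hL.norm_exp_mul_exponent_le_one hv.1.le z
    · refine ae_of_all _ fun v hv => ?_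
      rw [uIoc_of_le zero_le_one] at hv
      have hcont := (hL.hasDerivAt_exp_volume_mul_exponent hseed hr hmom
        (isBoundedBorel_strip 0 v)).continuousAt.tendsto
      rwa [volume_real_strip_zero hv.1.le, τ.exponent_zero, mul_zero, Complex.exp_zero] at hcont
  simpa using hlim

/-- Taking logarithms of characteristic functions is avoided by dividing the difference quotient of
`exp ∘ ψ` by `∫₀¹ exp (v ψ) dv = (exp ψ - 1) / ψ`. -/
lemma hasDerivAt_exponent_zero (hL : IsLevyBasis P τ L) (hseed : τ.IsSeedLaw seed) (hr : 1 ≤ r)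
    (hmom : MemLp id (ENNReal.ofReal r) seed) :
    HasDerivAt τ.exponent (Complex.I * (∫ ω, L (strip 0 1) ω ∂P : ℝ)) 0 := by
  have hexp := hL.hasDerivAt_exp_volume_mul_exponent hseed hr hmom (isBoundedBorel_strip 0 1)
  rw [volume_real_strip_zero zero_le_one, hasDerivAt_iff_tendsto_slope] at hexp
  have hlim := (hL.tendsto_integral_exp_mul_exponent hseed hr hmom).mono_left
    (nhdsWithin_le_nhds (s := {0}ᶜ))
  have hquot := hexp.div hlim one_ne_zero
  rw [div_one] at hquot
  rw [hasDerivAt_iff_tendsto_slope]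
  refine hquot.congr' ?_
  filter_upwards [hlim.eventually_ne one_ne_zero] with z hz
  rw [Pi.div_apply, div_eq_iff hz, slope_def_module, slope_def_module]
  simp only [Complex.ofReal_one, one_mul, τ.exponent_zero, Complex.exp_zero, sub_zero]
  rw [← mul_integral_exp_mul, smul_mul_assoc]

lemma integral_eq_volume_real_mul (hL : IsLevyBasis P τ L) (hseed : τ.IsSeedLaw seed) (hr : 1 ≤ r)
    (hmom : MemLp id (ENNReal.ofReal r) seed) (hB : IsBoundedBorel B) :
    ∫ ω, L B ω ∂P = volume.real B * ∫ ω, L (strip 0 1) ω ∂P := by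
  have hderiv := (hL.hasDerivAt_exp_volume_mul_exponent hseed hr hmom hB).unique
    ((hL.hasDerivAt_exponent_zero hseed hr hmom).const_mul (volume.real B : ℂ)).cexp
  rw [τ.exponent_zero, mul_zero, Complex.exp_zero, one_mul, mul_left_comm] at hderiv
  exact_mod_cast mul_left_cancel₀ Complex.I_ne_zero hderiv

lemma integral_centred (hL : IsLevyBasis P τ L) (hseed : τ.IsSeedLaw seed) (hr : 1 ≤ r)
    (hmom : MemLp id (ENNReal.ofReal r) seed) (hB : IsBoundedBorel B) :
    ∫ ω, centred P L B ω ∂P = 0 := by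
  unfold centred
  rw [integral_sub (memLp_one_iff_integrable.1 (hL.memLp_one hseed hr hmom hB))
    (integrable_const _), hL.integral_eq_volume_real_mul hseed hr hmom hB]
  simp

lemma variance_eq_volume_real (hL : IsLevyBasis P τ L) (hseed : τ.IsSeedLaw seed) (hr : 2 ≤ r)
    (hmom : MemLp id (ENNReal.ofReal r) seed) (hvar : Var[id; seed] = 1) (hB : IsBoundedBorel B) :
    Var[L B; P] = volume.real B := by
  have hstrip := isBoundedBorel_strip
  have hL2 : ∀ u v, MemLp (L (strip u v)) 2 P := fun u v =>
    memLp_two_of_memLp_ofReal hr (hL.memLp hseed (by linarith) hmom (hstrip u v))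
  have hunit : Var[L (strip 0 1); P] = 1 :=
    (hL.identDistrib_seed hseed (hstrip 0 1) (volume_real_strip_zero zero_le_one)).variance_eq.trans
      hvar
  have hadd : ∀ v w : ℝ, 0 ≤ v → 0 ≤ w →
      Var[L (strip 0 (v + w)); P] = Var[L (strip 0 v); P] + Var[L (strip 0 w); P] := by
    intro v w hv hw
    have hshift : volume.real (strip 0 w) = volume.real (strip v (v + w)) := by
      rw [volume_real_strip_zero hw, volume_real_strip (by linarith), add_sub_cancel_left]
    rw [variance_congr (hL.ae_strip hv (by linarith : v ≤ v + w)),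
      (hL.identDistrib (hstrip _ _) (hstrip _ _) hshift).variance_eq]
    exact IndepFun.variance_fun_add (hL2 _ _) (hL2 _ _)
      (hL.indepFun (hstrip _ _) (hstrip _ _) (disjoint_strip_strip _ _ _))
  have hvol : 0 ≤ volume.real B := measureReal_nonneg
  rw [(hL.identDistrib hB (hstrip _ _) (volume_real_strip_zero hvol).symm).variance_eq,
    eq_mul_of_nonneg_of_additive (f := fun v => Var[L (strip 0 v); P])
      (fun v _ => variance_nonneg _ _) hadd hvol, hunit, mul_one]

lemma integral_centred_sq (hL : IsLevyBasis P τ L) (hseed : τ.IsSeedLaw seed) (hr : 2 ≤ r)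
    (hmom : MemLp id (ENNReal.ofReal r) seed) (hvar : Var[id; seed] = 1) (hB : IsBoundedBorel B) :
    ∫ ω, centred P L B ω ^ 2 ∂P = volume.real B := by
  rw [← hL.variance_eq_volume_real hseed hr hmom hvar hB,
    variance_eq_integral (hL.aemeasurable hB),
    hL.integral_eq_volume_real_mul hseed (by linarith) hmom hB]
  rfl

lemma integral_abs_centred_union_rpow_ge (hL : IsLevyBasis P τ L) (hseed : τ.IsSeedLaw seed)
    (hr : 2 ≤ r) (hmom : MemLp id (ENNReal.ofReal r) seed) (hA : IsBoundedBorel A)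
    (hB : IsBoundedBorel B) (hAB : Disjoint A B) :
    ∫ ω, |centred P L A ω| ^ r ∂P + 2 * (2 ^ r)⁻¹ * ∫ ω, |centred P L B ω| ^ r ∂P
      ≤ ∫ ω, |centred P L (A ∪ B) ω| ^ r ∂P := by
  have hr1 : 1 ≤ r := by linarith
  have hmA := hL.memLp_centred hseed hr1 hmom hA
  have hmB := hL.memLp_centred hseed hr1 hmom hB
  have hind : IndepFun (fun ω => (centred P L A ω, (1 : ℝ))) (centred P L B) P :=
    (hL.indepFun_centred hA hB hAB).comp (φ := fun x => (x, (1 : ℝ))) (by fun_prop) measurable_id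
  have horth := integral_rpow_sub_two_mul_self_mul_eq_zero hr hmA (memLp_const 1)
    (hmB.integrable (ENNReal.one_le_ofReal.2 hr1)) hind (hL.integral_centred hseed hr1 hmom hB)
  simp only [one_mul] at horth
  refine (integral_abs_rpow_add_le_integral_abs_add_rpow hr hmA hmB horth).trans_eq ?_
  exact integral_congr_ae ((hL.ae_centred_union hA hB hAB).mono fun ω hω => by simp only [hω])

theorem exists_hasMomentLE_centred (hL : IsLevyBasis P τ L) (hseed : τ.IsSeedLaw seed)
    (hr : 2 ≤ r) (hmom : MemLp id (ENNReal.ofReal r) seed) {V : ℝ} (hV : 0 ≤ V) :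
    ∃ K : ℝ, 0 ≤ K ∧ ∀ B, IsBoundedBorel B → volume.real B ≤ V →
      HasMomentLE P (centred P L B) r (K * volume.real B) := by
  have hstrip := isBoundedBorel_strip
  set F : ℝ → ℝ := fun v => ∫ ω, |centred P L (strip 0 v) ω| ^ r ∂P
  have hpow : Measurable fun x : ℝ => |x| ^ r := by fun_prop
  have hnonneg : ∀ v, 0 ≤ F v := fun v => integral_nonneg fun ω => by positivity
  have hlaw : ∀ B, IsBoundedBorel B → ∫ ω, |centred P L B ω| ^ r ∂P = F (volume.real B) :=
    fun B hB => ((hL.identDistrib_centred hB (hstrip _ _)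
      (volume_real_strip_zero measureReal_nonneg).symm).comp hpow).integral_eq
  have hsuper : ∀ u w, 0 ≤ u → 0 ≤ w → F u + 2 * (2 ^ r)⁻¹ * F w ≤ F (u + w) := by
    intro u w hu hw
    have hge := hL.integral_abs_centred_union_rpow_ge hseed hr hmom (hstrip 0 u)
      (hstrip u (u + w)) (disjoint_strip_strip _ _ _)
    rwa [strip_union_strip hu (by linarith), hlaw (strip u (u + w)) (hstrip _ _),
      volume_real_strip (by linarith), add_sub_cancel_left] at hge
  refine ⟨2 / (2 * (2 ^ r)⁻¹) * (F V / V), by have := hnonneg V; positivity, fun B hB hBV => ?_⟩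
  refine ⟨hL.memLp_centred hseed (by linarith) hmom hB, ?_⟩
  rw [hlaw B hB]
  exact le_mul_of_superadditive (by positivity) (fun u _ => hnonneg u) hsuper measureReal_nonneg hBV

end IsLevyBasis

end LevyMoments

/-! ### Quadratic forms in independent cells -/

section Cells

variable {Ω : Type*} {n : ℕ} {ξ : ℕ × ℕ → Ω → ℝ} {w : ℕ × ℕ → ℝ}

/-- The pairs `(i, j)` with `i, j ≤ n` that satisfy `p`. The cell `(i, j)` stands for the part of
the Lévy basis that is alive exactly at the observation times `i, i + 1, …, j`. -/
def cells (n : ℕ) (p : ℕ × ℕ → Prop) [DecidablePred p] : Finset (ℕ × ℕ) :=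
  (Finset.range (n + 1) ×ˢ Finset.range (n + 1)).filter p

/-- The sum of the values `ξ c` of the cells `c` that satisfy `p`. -/
def cellSum (n : ℕ) (ξ : ℕ × ℕ → Ω → ℝ) (p : ℕ × ℕ → Prop) [DecidablePred p] (ω : Ω) : ℝ :=
  ∑ c ∈ cells n p, ξ c ω

/-- The σ-algebra generated by the values of the cells in `S`. -/
abbrev cellSigma (ξ : ℕ × ℕ → Ω → ℝ) (S : Set (ℕ × ℕ)) : MeasurableSpace Ω :=
  ⨆ c ∈ S, MeasurableSpace.comap (ξ c) inferInstance

/-- The cells alive at time `k`. -/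
abbrev alive (k : ℕ) : ℕ × ℕ → Prop := fun c => c.1 ≤ k ∧ k ≤ c.2

/-- The cells born between the times `k` and `k + 1`. -/
abbrev born (k : ℕ) : ℕ × ℕ → Prop := fun c => c.1 = k + 1 ∧ k + 1 ≤ c.2

/-- The cells that die between the times `k` and `k + 1`. -/
abbrev dies (k : ℕ) : ℕ × ℕ → Prop := fun c => c.1 ≤ k ∧ c.2 = k

/-- The cells alive at time `i` that die before time `k`. -/
abbrev diesBefore (i k : ℕ) : ℕ × ℕ → Prop := fun c => c.1 ≤ i ∧ i ≤ c.2 ∧ c.2 < k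

/-- The cells alive at time `i` that are still alive after time `k`, for `i ≤ k`. -/
abbrev survives (i k : ℕ) : ℕ × ℕ → Prop := fun c => c.1 ≤ i ∧ k < c.2

/-- The cells alive at time `i` that die between the times `k` and `k + 1`, for `i ≤ k`. -/
abbrev aliveDies (i k : ℕ) : ℕ × ℕ → Prop := fun c => c.1 ≤ i ∧ c.2 = k

lemma measurable_cellSum {S : Set (ℕ × ℕ)} {p : ℕ × ℕ → Prop} [DecidablePred p]
    (hp : ∀ c, p c → c ∈ S) : Measurable[cellSigma ξ S] (cellSum n ξ p) := by
  refine Finset.measurable_sum (cells n p) (f := ξ) fun c hc => ?_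
  have hle : MeasurableSpace.comap (ξ c) inferInstance ≤ cellSigma ξ S :=
    le_iSup₂_of_le c (hp c (Finset.mem_filter.1 hc).2) le_rfl
  exact fun t ht => hle _ ⟨t, ht, rfl⟩

lemma cellSum_eq_add {p q q' : ℕ × ℕ → Prop} [DecidablePred p] [DecidablePred q]
    [DecidablePred q'] (hp : ∀ c, p c ↔ q c ∨ q' c) (hqq' : ∀ c, q c → ¬ q' c) (ω : Ω) :
    cellSum n ξ p ω = cellSum n ξ q ω + cellSum n ξ q' ω := by
  simp only [cellSum, cells, Finset.sum_filter]
  rw [← Finset.sum_add_distrib]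
  refine Finset.sum_congr rfl fun c _ => ?_
  have := hp c
  have := hqq' c
  split_ifs <;> first | tauto | ring

lemma cellSum_alive_succ_sub (k : ℕ) (ω : Ω) :
    cellSum n ξ (alive (k + 1)) ω - cellSum n ξ (alive k) ω
      = cellSum n ξ (born k) ω - cellSum n ξ (dies k) ω := by
  have hsucc := cellSum_eq_add (n := n) (ξ := ξ) (p := alive (k + 1)) (q := survives k k)
    (q' := born k) (by intro c; omega) (by intro c; omega) ω
  have hcurr := cellSum_eq_add (n := n) (ξ := ξ) (p := alive k) (q := survives k k)
    (q' := dies k) (by intro c; omega) (by intro c; omega) ω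
  linarith

lemma cellSum_alive_eq (l i : ℕ) (ω : Ω) :
    cellSum n ξ (alive i) ω = cellSum n ξ (diesBefore i (l + i)) ω
      + cellSum n ξ (survives i (l + i)) ω + cellSum n ξ (aliveDies i (l + i)) ω := by
  have hafter := cellSum_eq_add (n := n) (ξ := ξ) (p := fun c => c.1 ≤ i ∧ l + i ≤ c.2)
    (q := survives i (l + i)) (q' := aliveDies i (l + i)) (by intro c; omega)
    (by intro c; omega) ω
  have halive := cellSum_eq_add (n := n) (ξ := ξ) (p := alive i) (q := diesBefore i (l + i))
    (q' := fun c => c.1 ≤ i ∧ l + i ≤ c.2) (by intro c; omega) (by intro c; omega) ω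
  linarith

/-- The contribution of the cells with second index `k` to the product of the process at time `i`
with its losses between the times `k` and `k + 1`, minus its expectation. -/
def centredLoss (n : ℕ) (ξ : ℕ × ℕ → Ω → ℝ) (w : ℕ × ℕ → ℝ) (i k : ℕ) (ω : Ω) : ℝ :=
  cellSum n ξ (aliveDies i k) ω * cellSum n ξ (dies k) ω - ∑ c ∈ cells n (aliveDies i k), w c

/-- The sum of the products of the process with its increments `l` steps later, minus its
expectation. -/
def laggedForm (n : ℕ) (ξ : ℕ × ℕ → Ω → ℝ) (w : ℕ × ℕ → ℝ) (l : ℕ) (ω : Ω) : ℝ :=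
  ∑ i ∈ Finset.range (n - l), (cellSum n ξ (alive i) ω *
    (cellSum n ξ (alive (l + i + 1)) ω - cellSum n ξ (alive (l + i)) ω)
      + ∑ c ∈ cells n (aliveDies i (l + i)), w c)

/-- The first two sums and the last one are martingales in `i`; the third is a martingale in
reversed time. -/
lemma laggedForm_eq (l : ℕ) (ω : Ω) :
    laggedForm n ξ w l ω
      = (∑ i ∈ Finset.range (n - l), cellSum n ξ (alive i) ω * cellSum n ξ (born (l + i)) ω
        - ∑ i ∈ Finset.range (n - l),
          cellSum n ξ (diesBefore i (l + i)) ω * cellSum n ξ (dies (l + i)) ω)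
      - (∑ i ∈ Finset.range (n - l),
          cellSum n ξ (survives i (l + i)) ω * cellSum n ξ (dies (l + i)) ω
        + ∑ i ∈ Finset.range (n - l), centredLoss n ξ w i (l + i) ω) := by
  simp only [laggedForm, centredLoss, ← Finset.sum_add_distrib, ← Finset.sum_sub_distrib]
  refine Finset.sum_congr rfl fun i _ => ?_
  rw [cellSum_alive_succ_sub]
  linear_combination (-cellSum n ξ (dies (l + i)) ω) * cellSum_alive_eq (n := n) (ξ := ξ) l i ω

/-- A constant that, together with its product by `δ`, dominates the moments of order `r` in
`CellModel`. -/
noncomputable def momentConst (K V κ r : ℝ) : ℝ :=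
  1 + (1 + K) * V + 2 ^ r * ((1 + K) + V ^ (r - 1)) * κ

/-- The constant in `CellModel.hasMomentLE_laggedForm`; the factor `4 ^ r` accounts for the four
sums in `laggedForm_eq`. -/
noncomputable def quadConst (K V κ r : ℝ) : ℝ :=
  4 ^ r * rosenthalConst r (momentConst K V κ r)

variable [MeasurableSpace Ω]

/-- Independent centred cells with variances `w`, on the grid `0, δ, …, n δ`. The moments of order
`s` are controlled by `K` times the variance, the variance of the process by `V`, and the rates of
birth and of death by `κ`. -/
structure CellModel (P : Measure Ω) (n : ℕ) (ξ : ℕ × ℕ → Ω → ℝ) (w : ℕ × ℕ → ℝ)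
    (s K V κ δ : ℝ) : Prop where
  measurable : ∀ c, Measurable (ξ c)
  indep : iIndepFun ξ P
  memLp : ∀ S : Finset (ℕ × ℕ), MemLp (fun ω => ∑ c ∈ S, ξ c ω) (ENNReal.ofReal s) P
  mean : ∀ S : Finset (ℕ × ℕ), ∫ ω, ∑ c ∈ S, ξ c ω ∂P = 0
  sq : ∀ S : Finset (ℕ × ℕ), ∫ ω, (∑ c ∈ S, ξ c ω) ^ 2 ∂P = ∑ c ∈ S, w c
  moment : ∀ S : Finset (ℕ × ℕ), ∑ c ∈ S, w c ≤ V →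
    ∫ ω, |∑ c ∈ S, ξ c ω| ^ s ∂P ≤ K * ∑ c ∈ S, w c
  w_nonneg : ∀ c, 0 ≤ w c
  K_nonneg : 0 ≤ K
  κ_nonneg : 0 ≤ κ
  δ_nonneg : 0 ≤ δ
  alive_le : ∀ k ≤ n, ∑ c ∈ cells n (alive k), w c ≤ V
  born_le : ∀ k < n, ∑ c ∈ cells n (born k), w c ≤ κ * δ
  dies_le : ∀ k < n, ∑ c ∈ cells n (dies k), w c ≤ κ * δ

namespace CellModel

variable {P : Measure Ω} {s K V κ δ r T : ℝ} {i k l m : ℕ}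

lemma indepFun_of_disjoint (h : CellModel P n ξ w s K V κ δ) {β : Type*} [MeasurableSpace β]
    {A B : Set (ℕ × ℕ)} (hAB : Disjoint A B) {X : Ω → β} {N : Ω → ℝ}
    (hX : Measurable[cellSigma ξ A] X) (hN : Measurable[cellSigma ξ B] N) : IndepFun X N P :=
  have hsigma : Indep (cellSigma ξ A) (cellSigma ξ B) P :=
    indep_iSup_of_disjoint (fun c => (h.measurable c).comap_le) h.indep hAB
  indep_of_indep_of_le_left (indep_of_indep_of_le_right hsigma hN.comap_le) hX.comap_le

lemma weight_mono (h : CellModel P n ξ w s K V κ δ) {p q : ℕ × ℕ → Prop} [DecidablePred p]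
    [DecidablePred q] (hpq : ∀ c, p c → q c) : ∑ c ∈ cells n p, w c ≤ ∑ c ∈ cells n q, w c :=
  Finset.sum_le_sum_of_subset_of_nonneg
    (Finset.monotone_filter_right _ fun c _ => hpq c) fun c _ _ => h.w_nonneg c

lemma weight_nonneg (h : CellModel P n ξ w s K V κ δ) (p : ℕ × ℕ → Prop) [DecidablePred p] :
    0 ≤ ∑ c ∈ cells n p, w c := Finset.sum_nonneg fun c _ => h.w_nonneg c

lemma V_nonneg (h : CellModel P n ξ w s K V κ δ) : 0 ≤ V :=
  (h.weight_nonneg _).trans (h.alive_le 0 n.zero_le)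

lemma weight_le_of_imp_alive (h : CellModel P n ξ w s K V κ δ) (hk : k ≤ n)
    {p : ℕ × ℕ → Prop} [DecidablePred p] (hp : ∀ c, p c → alive k c) :
    ∑ c ∈ cells n p, w c ≤ V :=
  (h.weight_mono hp).trans (h.alive_le k hk)

lemma one_le_momentConst (h : CellModel P n ξ w s K V κ δ) : 1 ≤ momentConst K V κ r := by
  have := h.K_nonneg
  have := h.V_nonneg
  have := h.κ_nonneg
  rw [momentConst, add_assoc]
  exact le_add_of_nonneg_right (by positivity)

lemma mul_V_le_momentConst (h : CellModel P n ξ w s K V κ δ) :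
    (1 + K) * V ≤ momentConst K V κ r := by
  have := h.K_nonneg
  have := h.V_nonneg
  have := h.κ_nonneg
  have : 0 ≤ 2 ^ r * ((1 + K) + V ^ (r - 1)) * κ := by positivity
  unfold momentConst
  linarith

lemma rpow_mul_κ_le_momentConst (h : CellModel P n ξ w s K V κ δ) :
    2 ^ r * ((1 + K) + V ^ (r - 1)) * κ ≤ momentConst K V κ r := by
  have : 0 ≤ (1 + K) * V := mul_nonneg (by linarith [h.K_nonneg]) h.V_nonneg
  unfold momentConst
  linarith

lemma two_mul_κ_le_momentConst (h : CellModel P n ξ w s K V κ δ) (hr : 1 ≤ r) :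
    2 * ((1 + K) * κ) ≤ momentConst K V κ r := by
  have hK := h.K_nonneg
  have hκ := h.κ_nonneg
  have hVr : 0 ≤ V ^ (r - 1) := Real.rpow_nonneg h.V_nonneg _
  have htwo : (2 : ℝ) ≤ 2 ^ r := by
    simpa using Real.rpow_le_rpow_of_exponent_le one_le_two hr
  calc 2 * ((1 + K) * κ) = 2 * (1 + K) * κ := by ring
    _ ≤ 2 ^ r * ((1 + K) + V ^ (r - 1)) * κ :=
        mul_le_mul_of_nonneg_right
          (mul_le_mul htwo (le_add_of_nonneg_right hVr) (by positivity) (by positivity)) hκ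
    _ ≤ _ := h.rpow_mul_κ_le_momentConst

variable [IsProbabilityMeasure P]

lemma memLp_cellSum (h : CellModel P n ξ w s K V κ δ) (hrs : r ≤ s) (p : ℕ × ℕ → Prop)
    [DecidablePred p] : MemLp (cellSum n ξ p) (ENNReal.ofReal r) P :=
  (h.memLp (cells n p)).mono_exponent (ENNReal.ofReal_le_ofReal hrs)

lemma hasMomentLE_cellSum (h : CellModel P n ξ w s K V κ δ) (hr : 2 ≤ r) (hrs : r ≤ s)
    {p : ℕ × ℕ → Prop} [DecidablePred p] (hV : ∑ c ∈ cells n p, w c ≤ V) :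
    HasMomentLE P (cellSum n ξ p) r ((1 + K) * ∑ c ∈ cells n p, w c) := by
  have hsq := (memLp_two_of_memLp_ofReal hr (h.memLp_cellSum hrs p)).integrable_sq
  have hmom := integrable_abs_rpow_of_memLp (by linarith) (h.memLp_cellSum le_rfl p)
  refine (HasMomentLE.of_abs_rpow_le (by linarith) (h.memLp_cellSum hrs p).1 (hsq.add hmom)
    fun ω => abs_rpow_le_sq_add_rpow hr hrs _).mono ?_
  rw [integral_add' hsq hmom, one_add_mul]
  exact add_le_add (h.sq _).le (h.moment _ hV)

/-- The set `A i` collects the cells that enter the sum before the factor `cellSum n ξ (q i)`. -/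
lemma hasMomentLE_sum_cellSum_mul (h : CellModel P n ξ w s K V κ δ) (hT : 1 ≤ T) (hr : 2 ≤ r)
    (hrs : r ≤ s) (hm : m * δ ≤ T) {p q : ℕ → ℕ × ℕ → Prop} [∀ i, DecidablePred (p i)]
    [∀ i, DecidablePred (q i)] (A : ℕ → Set (ℕ × ℕ))
    (hpA : ∀ i < m, ∀ j ≤ i, ∀ c, p j c → c ∈ A i)
    (hqA : ∀ i < m, ∀ j < i, ∀ c, q j c → c ∈ A i) (hqA' : ∀ i < m, ∀ c, q i c → c ∉ A i)
    (hpV : ∀ i < m, ∑ c ∈ cells n (p i), w c ≤ V) (hqV : ∀ i < m, ∑ c ∈ cells n (q i), w c ≤ V)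
    (hqδ : ∀ i < m, ∑ c ∈ cells n (q i), w c ≤ κ * δ) :
    HasMomentLE P (fun ω => ∑ i ∈ Finset.range m, cellSum n ξ (p i) ω * cellSum n ξ (q i) ω) r
      (rosenthalConst r (momentConst K V κ r) * T ^ (r / 2)) := by
  have hK := h.K_nonneg
  have hδ := h.δ_nonneg
  have hκ := h.κ_nonneg
  have hconst := h.two_mul_κ_le_momentConst (show 1 ≤ r by linarith)
  have hrate : ∀ i < m, (1 + K) * ∑ c ∈ cells n (q i), w c ≤ momentConst K V κ r * δ := fun i hi =>
    calc (1 + K) * ∑ c ∈ cells n (q i), w c ≤ (1 + K) * (κ * δ) := by gcongr; exact hqδ i hi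
      _ = (1 + K) * κ * δ := by ring
      _ ≤ _ := by gcongr; linarith [show 0 ≤ (1 + K) * κ by positivity]
  refine hasMomentLE_sum_mul hr (zero_le_one.trans h.one_le_momentConst) hδ hT hm
    (fun i hi => (h.hasMomentLE_cellSum hr hrs (hpV i hi)).mono ?_)
    (fun i hi => (h.hasMomentLE_cellSum hr hrs (hqV i hi)).mono (hrate i hi))
    (fun i hi => (h.sq _).trans_le (le_trans ?_ (hrate i hi))) (fun i _ => h.mean _)
    fun i hi => h.indepFun_of_disjoint (A := A i) disjoint_compl_right
      (Measurable.prodMk (Finset.measurable_fun_sum _ fun j hj => ?_)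
        (measurable_cellSum (hpA i hi i le_rfl))) (measurable_cellSum (hqA' i hi))
  · exact (mul_le_mul_of_nonneg_left (hpV i hi) (by positivity)).trans h.mul_V_le_momentConst
  · exact le_mul_of_one_le_left (h.weight_nonneg _) (by linarith)
  · have hj := Finset.mem_range.1 hj
    exact (measurable_cellSum (hpA i hi j hj.le)).mul (measurable_cellSum (hqA i hi j hj))

lemma integral_aliveDies_mul_dies (h : CellModel P n ξ w s K V κ δ) (hs : 2 ≤ s) (hik : i ≤ k) :
    ∫ ω, cellSum n ξ (aliveDies i k) ω * cellSum n ξ (dies k) ω ∂P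
      = ∑ c ∈ cells n (aliveDies i k), w c := by
  let bornAfter : ℕ × ℕ → Prop := fun c => i < c.1 ∧ c.1 ≤ k ∧ c.2 = k
  have hdies : ∀ ω, cellSum n ξ (dies k) ω
      = cellSum n ξ (aliveDies i k) ω + cellSum n ξ bornAfter ω :=
    cellSum_eq_add (fun c => by simp only [bornAfter]; omega)
      (fun c => by simp only [bornAfter]; omega)
  have hind : IndepFun (cellSum n ξ (aliveDies i k)) (cellSum n ξ bornAfter) P :=
    h.indepFun_of_disjoint (A := {c | c.1 ≤ i}) disjoint_compl_right
      (measurable_cellSum fun c hc => hc.1) (measurable_cellSum fun c hc => not_le.2 hc.1)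
  have hmem := fun (p : ℕ × ℕ → Prop) [DecidablePred p] =>
    memLp_two_of_memLp_ofReal hs (h.memLp_cellSum le_rfl p)
  have hprod := hind.integral_mul_eq_mul_integral (hmem _).1 (hmem _).1
  have hmul := hind.integrable_mul ((hmem _).integrable (by norm_num))
    ((hmem _).integrable (by norm_num))
  rw [show ∫ ω, cellSum n ξ bornAfter ω ∂P = 0 from h.mean _, mul_zero] at hprod
  calc _ = ∫ ω, (cellSum n ξ (aliveDies i k) ω ^ 2
        + cellSum n ξ (aliveDies i k) ω * cellSum n ξ bornAfter ω) ∂P := by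
        congr 1; funext ω; rw [hdies]; ring
    _ = ∫ ω, cellSum n ξ (aliveDies i k) ω ^ 2 ∂P
        + ∫ ω, cellSum n ξ (aliveDies i k) ω * cellSum n ξ bornAfter ω ∂P :=
        integral_add (hmem _).integrable_sq hmul
    _ = _ := by
        rw [show ∫ ω, cellSum n ξ (aliveDies i k) ω * cellSum n ξ bornAfter ω ∂P = 0 from hprod,
          add_zero]
        exact h.sq _

lemma hasMomentLE_aliveDies_mul_dies (h : CellModel P n ξ w s K V κ δ) (hr : 1 ≤ r)
    (hrs : 2 * r ≤ s) (hik : i ≤ k) (hk : k < n) :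
    HasMomentLE P (fun ω => cellSum n ξ (aliveDies i k) ω * cellSum n ξ (dies k) ω) r
      (2 * ((1 + K) * (κ * δ))) := by
  have hK := h.K_nonneg
  have hfactor : ∀ (p : ℕ × ℕ → Prop) [DecidablePred p], (∀ c, p c → dies k c) →
      HasMomentLE P (cellSum n ξ p) (2 * r) ((1 + K) * (κ * δ)) := fun p _ hp =>
    (h.hasMomentLE_cellSum (by linarith) hrs (h.weight_le_of_imp_alive hk.le
      fun c hc => ⟨(hp c hc).1, (hp c hc).2.ge⟩)).mono
      (mul_le_mul_of_nonneg_left ((h.weight_mono hp).trans (h.dies_le k hk)) (by positivity))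
  rw [two_mul (_ * _)]
  exact (hfactor _ fun c hc => ⟨hc.1.trans hik, hc.2⟩).mul (hfactor _ fun c hc => hc)
    (by linarith)

lemma integral_centredLoss (h : CellModel P n ξ w s K V κ δ) (hs : 2 ≤ s) (hik : i ≤ k)
    (hk : k < n) : ∫ ω, centredLoss n ξ w i k ω ∂P = 0 := by
  have hinteg := (h.hasMomentLE_aliveDies_mul_dies le_rfl (by linarith) hik hk).memLp.integrable
    (by simp)
  simp only [centredLoss]
  rw [integral_sub hinteg (integrable_const _), h.integral_aliveDies_mul_dies hs hik]
  simp

lemma integral_centredLoss_sq_le (h : CellModel P n ξ w s K V κ δ) (hr : 1 ≤ r) (hs : 4 ≤ s)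
    (hik : i ≤ k) (hk : k < n) :
    ∫ ω, centredLoss n ξ w i k ω ^ 2 ∂P ≤ momentConst K V κ r * δ := by
  have hprod := h.hasMomentLE_aliveDies_mul_dies one_le_two (by linarith) hik hk
  have hvar := variance_le_expectation_sq hprod.memLp.1
  rw [variance_eq_integral hprod.memLp.1.aemeasurable,
    h.integral_aliveDies_mul_dies (by linarith) hik] at hvar
  calc ∫ ω, centredLoss n ξ w i k ω ^ 2 ∂P ≤ 2 * ((1 + K) * (κ * δ)) :=
        hvar.trans (by simpa only [Real.rpow_two, sq_abs, Pi.pow_apply] using hprod.integral_le)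
    _ = 2 * ((1 + K) * κ) * δ := by ring
    _ ≤ _ := mul_le_mul_of_nonneg_right (h.two_mul_κ_le_momentConst hr) h.δ_nonneg

lemma hasMomentLE_centredLoss (h : CellModel P n ξ w s K V κ δ) (hr : 1 ≤ r) (hrs : 2 * r ≤ s)
    (hik : i ≤ k) (hk : k < n) :
    HasMomentLE P (centredLoss n ξ w i k) r (momentConst K V κ r * δ) := by
  have hV := h.V_nonneg
  have hδ := h.δ_nonneg
  have hκ := h.κ_nonneg
  set e := ∑ c ∈ cells n (aliveDies i k), w c
  have he0 : 0 ≤ e := h.weight_nonneg _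
  have hle : e ≤ ∑ c ∈ cells n (dies k), w c := h.weight_mono fun c hc => ⟨hc.1.trans hik, hc.2⟩
  have heV : e ≤ V := hle.trans (h.weight_le_of_imp_alive hk.le fun c hc => ⟨hc.1, hc.2.ge⟩)
  have her : e ^ r ≤ 2 * (V ^ (r - 1) * (κ * δ)) :=
    calc e ^ r = e ^ (r - 1) * e := by
          rw [← Real.rpow_add_one' he0 (by linarith), sub_add_cancel]
      _ ≤ V ^ (r - 1) * (κ * δ) :=
          mul_le_mul (Real.rpow_le_rpow he0 heV (by linarith)) (hle.trans (h.dies_le k hk)) he0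
            (by positivity)
      _ ≤ _ := by linarith [show 0 ≤ V ^ (r - 1) * (κ * δ) by positivity]
  have hmean : HasMomentLE P (fun _ => e) r (2 * (V ^ (r - 1) * (κ * δ))) :=
    ⟨memLp_const _, by simpa [abs_of_nonneg he0] using her⟩
  refine ((h.hasMomentLE_aliveDies_mul_dies hr hrs hik hk).sub hmean hr).mono ?_
  calc 2 ^ (r - 1) * (2 * ((1 + K) * (κ * δ)) + 2 * (V ^ (r - 1) * (κ * δ)))
      = 2 ^ r * ((1 + K) + V ^ (r - 1)) * κ * δ := by rw [Real.rpow_sub_one two_ne_zero]; ring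
    _ ≤ _ := mul_le_mul_of_nonneg_right h.rpow_mul_κ_le_momentConst hδ

lemma hasMomentLE_sum_centredLoss (h : CellModel P n ξ w s K V κ δ) (hT : 1 ≤ T) (hr : 2 ≤ r)
    (hrs : 2 * r ≤ s) (hm : m * δ ≤ T) (hlm : l + m ≤ n) :
    HasMomentLE P (fun ω => ∑ i ∈ Finset.range m, centredLoss n ξ w i (l + i) ω) r
      (rosenthalConst r (momentConst K V κ r) * T ^ (r / 2)) := by
  have hmeas : ∀ {A : Set (ℕ × ℕ)} (i k : ℕ), (∀ c : ℕ × ℕ, c.2 = k → c ∈ A) →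
      Measurable[cellSigma ξ A] (centredLoss n ξ w i k) := fun i k hA =>
    ((measurable_cellSum fun c hc => hA c hc.2).mul
      (measurable_cellSum fun c hc => hA c hc.2)).sub measurable_const
  simpa only [one_mul] using hasMomentLE_sum_mul (P := P) (K := momentConst K V κ r)
    (Y := fun _ _ => 1) (N := fun i => centredLoss n ξ w i (l + i)) hr
    (zero_le_one.trans h.one_le_momentConst) h.δ_nonneg hT hm
    (fun i _ => ⟨memLp_const _, by simpa using h.one_le_momentConst⟩)
    (fun i hi => h.hasMomentLE_centredLoss (by linarith) hrs (by omega) (by omega))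
    (fun i hi => h.integral_centredLoss_sq_le (by linarith) (by linarith) (by omega) (by omega))
    (fun i hi => h.integral_centredLoss (by linarith) (by omega) (by omega))
    fun i _ => h.indepFun_of_disjoint (A := {c | c.2 < l + i}) disjoint_compl_right
      (Measurable.prodMk (Finset.measurable_fun_sum _ fun j hj => measurable_const.mul
        (hmeas j _ fun c hc => hc.trans_lt (by simpa using hj))) measurable_const)
      (hmeas i _ fun c hc => not_lt.2 hc.ge)

lemma hasMomentLE_sum_alive_mul_born (h : CellModel P n ξ w s K V κ δ) (hT : 1 ≤ T) (hr : 2 ≤ r)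
    (hrs : r ≤ s) (hm : m * δ ≤ T) (hlm : l + m ≤ n) :
    HasMomentLE P
      (fun ω => ∑ i ∈ Finset.range m, cellSum n ξ (alive i) ω * cellSum n ξ (born (l + i)) ω) r
      (rosenthalConst r (momentConst K V κ r) * T ^ (r / 2)) := by
  refine h.hasMomentLE_sum_cellSum_mul hT hr hrs hm (p := fun i => alive i)
    (q := fun i => born (l + i)) (fun i => {c | c.1 ≤ l + i}) ?_ ?_ ?_
    (fun i hi => h.alive_le i (by omega))
    (fun i hi => h.weight_le_of_imp_alive (k := l + i + 1) (by omega) fun c hc => ⟨hc.1.le, hc.2⟩)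
    fun i hi => h.born_le _ (by omega)
  all_goals intros; simp only [mem_ofPred_eq] at *; omega

lemma hasMomentLE_sum_diesBefore_mul_dies (h : CellModel P n ξ w s K V κ δ) (hT : 1 ≤ T)
    (hr : 2 ≤ r) (hrs : r ≤ s) (hm : m * δ ≤ T) (hlm : l + m ≤ n) :
    HasMomentLE P (fun ω => ∑ i ∈ Finset.range m,
      cellSum n ξ (diesBefore i (l + i)) ω * cellSum n ξ (dies (l + i)) ω) r
      (rosenthalConst r (momentConst K V κ r) * T ^ (r / 2)) := by
  refine h.hasMomentLE_sum_cellSum_mul hT hr hrs hm (p := fun i => diesBefore i (l + i))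
    (q := fun i => dies (l + i)) (fun i => {c | c.2 < l + i}) ?_ ?_ ?_
    (fun i hi => h.weight_le_of_imp_alive (k := i) (by omega) fun c hc => ⟨hc.1, hc.2.1⟩)
    (fun i hi => h.weight_le_of_imp_alive (k := l + i) (by omega) fun c hc => ⟨hc.1, hc.2.ge⟩)
    fun i hi => h.dies_le _ (by omega)
  all_goals intros; simp only [mem_ofPred_eq] at *; omega

lemma hasMomentLE_sum_survives_mul_dies (h : CellModel P n ξ w s K V κ δ) (hT : 1 ≤ T)
    (hr : 2 ≤ r) (hrs : r ≤ s) (hm : m * δ ≤ T) (hlm : l + m ≤ n) :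
    HasMomentLE P (fun ω => ∑ i ∈ Finset.range m,
      cellSum n ξ (survives i (l + i)) ω * cellSum n ξ (dies (l + i)) ω) r
      (rosenthalConst r (momentConst K V κ r) * T ^ (r / 2)) := by
  have hreflect : ∀ ω, ∑ i ∈ Finset.range m,
      cellSum n ξ (survives i (l + i)) ω * cellSum n ξ (dies (l + i)) ω
      = ∑ i ∈ Finset.range m, cellSum n ξ (survives (m - 1 - i) (l + (m - 1 - i))) ω
        * cellSum n ξ (dies (l + (m - 1 - i))) ω := fun ω =>
    (Finset.sum_range_reflect
      (fun i => cellSum n ξ (survives i (l + i)) ω * cellSum n ξ (dies (l + i)) ω) m).symm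
  simp only [hreflect]
  refine h.hasMomentLE_sum_cellSum_mul hT hr hrs hm
    (p := fun i => survives (m - 1 - i) (l + (m - 1 - i))) (q := fun i => dies (l + (m - 1 - i)))
    (fun i => {c | l + (m - 1 - i) < c.2}) ?_ ?_ ?_
    (fun i hi => h.weight_le_of_imp_alive (k := m - 1 - i) (by omega) fun c hc => ⟨hc.1, by omega⟩)
    (fun i hi => h.weight_le_of_imp_alive (k := l + (m - 1 - i)) (by omega)
      fun c hc => ⟨hc.1, hc.2.ge⟩)
    fun i hi => h.dies_le _ (by omega)
  all_goals intros; simp only [mem_ofPred_eq] at *; omega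

theorem hasMomentLE_laggedForm (h : CellModel P n ξ w s K V κ δ) (hT : 1 ≤ T) (hr : 2 ≤ r)
    (hrs : 2 * r ≤ s) (hn : n * δ ≤ T) (hl : l ≤ n) :
    HasMomentLE P (laggedForm n ξ w l) r (quadConst K V κ r * T ^ (r / 2)) := by
  have hδ := h.δ_nonneg
  have hr1 : 1 ≤ r := by linarith
  have hrs' : r ≤ s := by linarith
  have hm : ((n - l : ℕ) : ℝ) * δ ≤ T := le_trans (by gcongr; omega) hn
  have hlm : l + (n - l) ≤ n := by omega
  have hsum := ((h.hasMomentLE_sum_alive_mul_born hT hr hrs' hm hlm).sub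
    (h.hasMomentLE_sum_diesBefore_mul_dies hT hr hrs' hm hlm) hr1).sub
    ((h.hasMomentLE_sum_survives_mul_dies hT hr hrs' hm hlm).add
    (h.hasMomentLE_sum_centredLoss hT hr hrs hm hlm) hr1) hr1
  rw [funext (laggedForm_eq (n := n) (ξ := ξ) (w := w) l)]
  refine hsum.mono (le_of_eq ?_)
  have hfour : (4 : ℝ) ^ r = 2 ^ r * 2 ^ r := by
    rw [← Real.mul_rpow two_pos.le two_pos.le]; norm_num
  rw [quadConst, hfour, Real.rpow_sub_one two_ne_zero]
  ring

end CellModel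

end Cells

/-! ### Geometry of trawl sets -/

section Geometry

/-- A trawl function together with an extension to the whole line that keeps it continuous,
non-increasing and nonnegative; its values on `(-∞, 0)` do not affect the trawl sets. -/
structure IsGlobalTrawlFunction (a : ℝ → ℝ) : Prop where
  nonneg : ∀ u, 0 ≤ a u
  antitone : Antitone a
  continuous : Continuous a
  integrable : IntegrableOn a (Ici 0)

variable {a : ℝ → ℝ} {s t δ : ℝ}

lemma mem_trawlSetAt {x : ℝ × ℝ} :
    x ∈ trawlSetAt a t ↔ x.1 ≤ t ∧ 0 ≤ x.2 ∧ x.2 ≤ a (t - x.1) := by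
  simp [trawlSetAt, trawlSet]

lemma measurableSet_trawlSetAt (ha : Measurable a) (t : ℝ) : MeasurableSet (trawlSetAt a t) := by
  have hset : trawlSetAt a t = {x | x.1 ≤ t} ∩ ({x | 0 ≤ x.2} ∩ {x | x.2 ≤ a (t - x.1)}) :=
    Set.ext fun _ => mem_trawlSetAt
  rw [hset]
  exact (measurableSet_le measurable_fst measurable_const).inter
    ((measurableSet_le measurable_const measurable_snd).inter
      (measurableSet_le measurable_snd (ha.comp (by fun_prop))))

lemma trawlSetAt_inter_subset (ha : Antitone a) {u : ℝ} (hst : s ≤ t) (htu : t ≤ u) :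
    trawlSetAt a s ∩ trawlSetAt a u ⊆ trawlSetAt a t := by
  rintro x ⟨hxs, hxu⟩
  rw [mem_trawlSetAt] at *
  exact ⟨hxs.1.trans hst, hxs.2.1, hxu.2.2.trans (ha (by linarith))⟩

lemma preimage_trawlSetAt_inter (ha : Antitone a) (hst : s ≤ t) (x : ℝ) :
    Prod.mk x ⁻¹' (trawlSetAt a s ∩ trawlSetAt a t) = if x ≤ s then Icc 0 (a (t - x)) else ∅ := by
  ext y
  simp only [mem_preimage, mem_inter_iff, mem_trawlSetAt]
  split_ifs with hx
  · exact ⟨fun hy => hy.2.2, fun hy =>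
      ⟨⟨hx, hy.1, hy.2.trans (ha (by linarith))⟩, hx.trans hst, hy⟩⟩
  · simp only [hx, false_and, mem_empty_iff_false]

namespace IsGlobalTrawlFunction

lemma integrableOn_Ici (ha : IsGlobalTrawlFunction a) (ht : 0 ≤ t) : IntegrableOn a (Ici t) :=
  ha.integrable.mono_set (Ici_subset_Ici.2 ht)

lemma volume_trawlSetAt_inter (ha : IsGlobalTrawlFunction a) (hst : s ≤ t) :
    volume (trawlSetAt a s ∩ trawlSetAt a t) = ENNReal.ofReal (∫ u in Ici (t - s), a u) := by
  have hmeas := measurableSet_trawlSetAt ha.continuous.measurable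
  rw [ofReal_integral_eq_lintegral_ofReal (ha.integrableOn_Ici (sub_nonneg.2 hst))
      (ae_of_all _ ha.nonneg),
    Measure.volume_eq_prod, Measure.prod_apply ((hmeas s).inter (hmeas t)),
    ← lintegral_indicator measurableSet_Ici,
    ← lintegral_sub_left_eq_self (μ := volume)
      ((Ici (t - s)).indicator fun u => ENNReal.ofReal (a u)) t]
  refine lintegral_congr fun x => ?_
  rw [preimage_trawlSetAt_inter ha.antitone hst]
  by_cases hx : x ≤ s
  · rw [if_pos hx, Real.volume_Icc, sub_zero, indicator_of_mem (mem_Ici.2 (by linarith))]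
  · rw [if_neg hx, measure_empty, indicator_of_notMem fun h => hx (by linarith [mem_Ici.1 h])]

lemma volume_trawlSetAt_inter_ne_top (ha : IsGlobalTrawlFunction a) (hst : s ≤ t) :
    volume (trawlSetAt a s ∩ trawlSetAt a t) ≠ ⊤ := by
  rw [ha.volume_trawlSetAt_inter hst]
  exact ENNReal.ofReal_ne_top

lemma volume_real_trawlSetAt_inter (ha : IsGlobalTrawlFunction a) (hst : s ≤ t) :
    volume.real (trawlSetAt a s ∩ trawlSetAt a t) = ∫ u in Ici (t - s), a u := by
  rw [measureReal_def, ha.volume_trawlSetAt_inter hst,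
    ENNReal.toReal_ofReal (setIntegral_nonneg measurableSet_Ici fun u _ => ha.nonneg u)]

lemma volume_trawlSetAt_ne_top (ha : IsGlobalTrawlFunction a) (t : ℝ) :
    volume (trawlSetAt a t) ≠ ⊤ := by
  simpa using ha.volume_trawlSetAt_inter_ne_top (le_refl t)

lemma volume_real_trawlSetAt (ha : IsGlobalTrawlFunction a) (t : ℝ) :
    volume.real (trawlSetAt a t) = ∫ u in Ici 0, a u := by
  simpa using ha.volume_real_trawlSetAt_inter (le_refl t)

lemma volume_real_trawlSetAt_inter_diff (ha : IsGlobalTrawlFunction a) (hst : s ≤ t) (hδ : 0 ≤ δ) :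
    volume.real ((trawlSetAt a s ∩ trawlSetAt a t) \ trawlSetAt a (t + δ))
      = ∫ u in Ico (t - s) (t - s + δ), a u := by
  have hmeas := measurableSet_trawlSetAt ha.continuous.measurable
  have hdiff : (trawlSetAt a s ∩ trawlSetAt a t) \ trawlSetAt a (t + δ)
      = (trawlSetAt a s ∩ trawlSetAt a t) \ (trawlSetAt a s ∩ trawlSetAt a (t + δ)) := by
    ext x
    simp only [mem_inter_iff, Set.mem_sdiff]
    tauto
  have hsub : trawlSetAt a s ∩ trawlSetAt a (t + δ) ⊆ trawlSetAt a s ∩ trawlSetAt a t :=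
    subset_inter inter_subset_left (trawlSetAt_inter_subset ha.antitone hst (by linarith))
  have hunion : ∫ u in Ici (t - s), a u
      = (∫ u in Ico (t - s) (t - s + δ), a u) + ∫ u in Ici (t - s + δ), a u := by
    rw [← Ico_union_Ici_eq_Ici (show t - s ≤ t - s + δ by linarith)]
    exact setIntegral_union (Set.disjoint_left.2 fun u hu hu' => absurd hu.2 (not_lt.2 hu'))
      measurableSet_Ici ((ha.integrableOn_Ici (sub_nonneg.2 hst)).mono_set Ico_subset_Ici_self)
      (ha.integrableOn_Ici (by linarith))
  rw [hdiff, measureReal_sdiff hsub ((hmeas s).inter (hmeas _))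
      (ha.volume_trawlSetAt_inter_ne_top hst),
    ha.volume_real_trawlSetAt_inter hst, ha.volume_real_trawlSetAt_inter (by linarith), hunion,
    show t + δ - s = t - s + δ by ring, add_sub_cancel_right]

lemma setIntegral_Ico_le (ha : IsGlobalTrawlFunction a) (ht : 0 ≤ t) (hδ : 0 ≤ δ) :
    ∫ u in Ico t (t + δ), a u ≤ a t * δ := by
  calc ∫ u in Ico t (t + δ), a u ≤ ∫ _ in Ico t (t + δ), a t :=
        setIntegral_mono_on ((ha.integrableOn_Ici ht).mono_set Ico_subset_Ici_self)
          (integrableOn_const (by simp)) measurableSet_Ico fun u hu => ha.antitone hu.1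
    _ = a t * δ := by
        rw [setIntegral_const, Real.volume_real_Ico_of_le (by linarith), smul_eq_mul,
          add_sub_cancel_left, mul_comm]

lemma le_setIntegral_Ico (ha : IsGlobalTrawlFunction a) (ht : 0 ≤ t) (hδ : 0 ≤ δ) :
    a (t + δ) * δ ≤ ∫ u in Ico t (t + δ), a u := by
  calc a (t + δ) * δ = ∫ _ in Ico t (t + δ), a (t + δ) := by
        rw [setIntegral_const, Real.volume_real_Ico_of_le (by linarith), smul_eq_mul,
          add_sub_cancel_left, mul_comm]
    _ ≤ ∫ u in Ico t (t + δ), a u :=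
        setIntegral_mono_on (integrableOn_const (by simp))
          ((ha.integrableOn_Ici ht).mono_set Ico_subset_Ici_self) measurableSet_Ico
          fun u hu => ha.antitone hu.2.le

lemma volume_real_trawlSetAt_diff_le (ha : IsGlobalTrawlFunction a) (t : ℝ) (hδ : 0 ≤ δ) :
    volume.real (trawlSetAt a t \ trawlSetAt a (t + δ)) ≤ a 0 * δ := by
  have hloss := ha.volume_real_trawlSetAt_inter_diff (le_refl t) hδ
  rw [inter_self, sub_self] at hloss
  exact hloss.trans_le (ha.setIntegral_Ico_le le_rfl hδ)

end IsGlobalTrawlFunction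

lemma trawlSetAt_add_diff_subset (ha : Antitone a) (hδ : 0 ≤ δ) :
    trawlSetAt a (t + δ) \ trawlSetAt a t ⊆ Icc t (t + δ) ×ˢ Icc 0 (a 0) := by
  rintro x ⟨hx, hxt⟩
  rw [mem_trawlSetAt] at hx hxt
  have htx : t ≤ x.1 := by
    by_contra! hlt
    exact hxt ⟨hlt.le, hx.2.1, hx.2.2.trans (ha (by linarith))⟩
  exact ⟨⟨htx, hx.1⟩, hx.2.1, hx.2.2.trans (ha (by linarith [hx.1]))⟩

lemma volume_real_trawlSetAt_add_diff_le (ha : Antitone a) (ha0 : 0 ≤ a 0) (t : ℝ) (hδ : 0 ≤ δ) :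
    volume.real (trawlSetAt a (t + δ) \ trawlSetAt a t) ≤ a 0 * δ := by
  have hbdd : Bornology.IsBounded (Icc t (t + δ) ×ˢ Icc 0 (a 0)) :=
    (Metric.isBounded_Icc _ _).prod (Metric.isBounded_Icc _ _)
  refine (measureReal_mono (trawlSetAt_add_diff_subset ha hδ) hbdd.measure_lt_top.ne).trans_eq ?_
  rw [Measure.volume_eq_prod, measureReal_prod_prod, Real.volume_real_Icc_of_le (by linarith),
    Real.volume_real_Icc_of_le ha0]
  ring

/-- The square `[-m, m]²`. -/
def box (m : ℕ) : Set (ℝ × ℝ) := Icc (-(m : ℝ)) m ×ˢ Icc (-(m : ℝ)) m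

lemma isBoundedBorel_inter_box {B : Set (ℝ × ℝ)} (hB : MeasurableSet B) (m : ℕ) :
    IsBoundedBorel (B ∩ box m) :=
  ⟨hB.inter (measurableSet_Icc.prod measurableSet_Icc),
    ((Metric.isBounded_Icc _ _).prod (Metric.isBounded_Icc _ _)).subset inter_subset_right⟩

lemma monotone_box : Monotone box := fun m m' hm => by
  have hcast : (m : ℝ) ≤ m' := Nat.cast_le.2 hm
  exact prod_mono (Icc_subset_Icc (neg_le_neg hcast) hcast)
    (Icc_subset_Icc (neg_le_neg hcast) hcast)

lemma iUnion_box : ⋃ m, box m = univ := eq_univ_of_forall fun x => by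
  obtain ⟨m, hm⟩ := exists_nat_ge (max |x.1| |x.2|)
  exact mem_iUnion.2 ⟨m, abs_le.1 ((le_max_left _ _).trans hm),
    abs_le.1 ((le_max_right _ _).trans hm)⟩

lemma tendsto_volume_real_inter_box {B : Set (ℝ × ℝ)} (hB : volume B ≠ ⊤) :
    Tendsto (fun m => volume.real (B ∩ box m)) atTop (𝓝 (volume.real B)) := by
  have hlim := tendsto_measure_iUnion_atTop (μ := volume) (s := fun m => B ∩ box m)
    fun _ _ hm => inter_subset_inter_right B (monotone_box hm)
  rw [← inter_iUnion, iUnion_box, inter_univ] at hlim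
  exact (ENNReal.tendsto_toReal hB).comp hlim

end Geometry

/-! ### The cells of a family of sets -/

section CellSets

/-- The part of the plane alive exactly from time `c.1` to time `c.2`, that is, the points that
belong to `E k`, for `k ≤ n`, if and only if `c.1 ≤ k ≤ c.2`. -/
def cellSet (n : ℕ) (E : ℕ → Set (ℝ × ℝ)) (c : ℕ × ℕ) : Set (ℝ × ℝ) :=
  {x | c.1 ≤ c.2 ∧ c.2 ≤ n ∧ ∀ k ≤ n, x ∈ E k ↔ c.1 ≤ k ∧ k ≤ c.2}

variable {n i k : ℕ} {E : ℕ → Set (ℝ × ℝ)}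

lemma pairwise_disjoint_cellSet :
    Pairwise fun c d => Disjoint (cellSet n E c) (cellSet n E d) := by
  intro c d hcd
  refine Set.disjoint_left.2 fun x ⟨hc, hcn, hxc⟩ ⟨hd, hdn, hxd⟩ => hcd ?_
  have hcd₁ := (hxd c.1 (hc.trans hcn)).1 ((hxc c.1 (hc.trans hcn)).2 ⟨le_rfl, hc⟩)
  have hcd₂ := (hxd c.2 hcn).1 ((hxc c.2 hcn).2 ⟨hc, le_rfl⟩)
  have hdc₁ := (hxc d.1 (hd.trans hdn)).1 ((hxd d.1 (hd.trans hdn)).2 ⟨le_rfl, hd⟩)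
  have hdc₂ := (hxc d.2 hdn).1 ((hxd d.2 hdn).2 ⟨hd, le_rfl⟩)
  exact Prod.ext (by omega) (by omega)

lemma cellSet_subset (c : ℕ × ℕ) : cellSet n E c ⊆ E c.1 := fun _ hx =>
  (hx.2.2 c.1 (hx.1.trans hx.2.1)).2 ⟨le_rfl, hx.1⟩

lemma isBoundedBorel_cellSet (hE : ∀ k, IsBoundedBorel (E k)) (c : ℕ × ℕ) :
    IsBoundedBorel (cellSet n E c) := by
  have hset : cellSet n E c = {_x | c.1 ≤ c.2} ∩ ({_x | c.2 ≤ n} ∩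
      ⋂ k, ⋂ (_ : k ≤ n), {x | x ∈ E k ↔ c.1 ≤ k ∧ k ≤ c.2}) := by
    ext x
    simp [cellSet]
  refine ⟨?_, (hE c.1).isBounded.subset (cellSet_subset c)⟩
  rw [hset]
  exact (MeasurableSet.const _).inter ((MeasurableSet.const _).inter
    (MeasurableSet.iInter fun k => MeasurableSet.iInter fun _ =>
      (hE k).measurableSet.iff (MeasurableSet.const _)))

lemma exists_mem_cellSet (hbetween : ∀ i k j, i ≤ k → k ≤ j → E i ∩ E j ⊆ E k) (hk : k ≤ n)
    {x : ℝ × ℝ} (hx : x ∈ E k) :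
    ∃ c : ℕ × ℕ, c.1 ≤ k ∧ k ≤ c.2 ∧ c.2 ≤ n ∧ x ∈ cellSet n E c := by
  classical
  let times : Finset ℕ := (Finset.range (n + 1)).filter fun j => x ∈ E j
  have mem_times : ∀ j, j ∈ times ↔ j ≤ n ∧ x ∈ E j := fun j => by simp [times]
  have hkt : k ∈ times := (mem_times k).2 ⟨hk, hx⟩
  have hne : times.Nonempty := ⟨k, hkt⟩
  obtain ⟨-, hmin⟩ := (mem_times _).1 (times.min'_mem hne)
  obtain ⟨hmaxn, hmax⟩ := (mem_times _).1 (times.max'_mem hne)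
  refine ⟨(times.min' hne, times.max' hne), times.min'_le k hkt, times.le_max' k hkt, hmaxn,
    (times.min'_le k hkt).trans (times.le_max' k hkt), hmaxn, fun j hj => ⟨fun hxj => ?_, ?_⟩⟩
  · have hjt := (mem_times j).2 ⟨hj, hxj⟩
    exact ⟨times.min'_le j hjt, times.le_max' j hjt⟩
  · rintro ⟨hlower, hupper⟩
    exact hbetween _ _ _ hlower hupper ⟨hmin, hmax⟩

lemma mem_cells {p : ℕ × ℕ → Prop} [DecidablePred p] {c : ℕ × ℕ} :
    c ∈ cells n p ↔ c.1 ≤ n ∧ c.2 ≤ n ∧ p c := by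
  simp [cells, and_assoc]

lemma biUnion_alive (hbetween : ∀ i k j, i ≤ k → k ≤ j → E i ∩ E j ⊆ E k) (hk : k ≤ n) :
    ⋃ c ∈ cells n (alive k), cellSet n E c = E k := by
  refine Subset.antisymm
    (iUnion₂_subset fun c hc x hx => (hx.2.2 k hk).2 (mem_cells.1 hc).2.2) fun x hx => ?_
  obtain ⟨c, hck, hkc, hcn, hxc⟩ := exists_mem_cellSet hbetween hk hx
  exact mem_iUnion₂.2 ⟨c, mem_cells.2 ⟨by omega, hcn, hck, hkc⟩, hxc⟩

lemma biUnion_born_subset (hk : k < n) :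
    ⋃ c ∈ cells n (born k), cellSet n E c ⊆ E (k + 1) \ E k := by
  refine iUnion₂_subset fun c hc x hx => ?_
  obtain ⟨-, -, hborn, halive⟩ := mem_cells.1 hc
  refine ⟨(hx.2.2 (k + 1) hk).2 ⟨hborn.le, halive⟩, fun hxk => ?_⟩
  have := (hx.2.2 k hk.le).1 hxk
  omega

lemma biUnion_dies_subset (hk : k < n) :
    ⋃ c ∈ cells n (dies k), cellSet n E c ⊆ E k \ E (k + 1) := by
  refine iUnion₂_subset fun c hc x hx => ?_
  obtain ⟨-, -, halive, hdies⟩ := mem_cells.1 hc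
  refine ⟨(hx.2.2 k hk.le).2 ⟨halive, hdies.ge⟩, fun hxk => ?_⟩
  have := (hx.2.2 (k + 1) hk).1 hxk
  omega

lemma biUnion_aliveDies (hbetween : ∀ i k j, i ≤ k → k ≤ j → E i ∩ E j ⊆ E k) (hik : i ≤ k)
    (hk : k < n) :
    ⋃ c ∈ cells n (aliveDies i k), cellSet n E c = (E i ∩ E k) \ E (k + 1) := by
  refine Subset.antisymm (iUnion₂_subset fun c hc x hx => ?_) ?_
  · obtain ⟨-, -, halive, hdies⟩ := mem_cells.1 hc
    refine ⟨⟨(hx.2.2 i (by omega)).2 ⟨halive, by omega⟩,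
      (hx.2.2 k hk.le).2 ⟨by omega, hdies.ge⟩⟩, fun hxk => ?_⟩
    have := (hx.2.2 (k + 1) hk).1 hxk
    omega
  · rintro x ⟨⟨hxi, hxk⟩, hxk'⟩
    obtain ⟨c, hck, hkc, hcn, hxc⟩ := exists_mem_cellSet hbetween hk.le hxk
    have halive := (hxc.2.2 i (by omega)).1 hxi
    have hdies : ¬ (c.1 ≤ k + 1 ∧ k + 1 ≤ c.2) := fun hc => hxk' ((hxc.2.2 (k + 1) hk).2 hc)
    exact mem_iUnion₂.2 ⟨c, mem_cells.2 ⟨by omega, hcn, halive.1, by omega⟩, hxc⟩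

lemma sum_volume_real_cellSet (hE : ∀ k, IsBoundedBorel (E k)) (S : Finset (ℕ × ℕ)) :
    ∑ c ∈ S, volume.real (cellSet n E c) = volume.real (⋃ c ∈ S, cellSet n E c) :=
  (measureReal_biUnion_finset (fun _ _ _ _ h => pairwise_disjoint_cellSet h)
    (fun c _ => (isBoundedBorel_cellSet hE c).measurableSet)
    fun c _ => (isBoundedBorel_cellSet hE c).isBounded.measure_lt_top.ne).symm

lemma sum_volume_real_aliveDies (hE : ∀ k, IsBoundedBorel (E k))
    (hbetween : ∀ i k j, i ≤ k → k ≤ j → E i ∩ E j ⊆ E k) (hik : i ≤ k) (hk : k < n) :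
    ∑ c ∈ cells n (aliveDies i k), volume.real (cellSet n E c)
      = volume.real ((E i ∩ E k) \ E (k + 1)) := by
  rw [sum_volume_real_cellSet hE, biUnion_aliveDies hbetween hik hk]

variable {Ω : Type*} [MeasurableSpace Ω] {P : Measure Ω} {τ : Triplet} {L : Set (ℝ × ℝ) → Ω → ℝ}

lemma ae_sum_centred_cellSet [IsProbabilityMeasure P] (hL : IsLevyBasis P τ L)
    (hE : ∀ k, IsBoundedBorel (E k)) (S : Finset (ℕ × ℕ)) :
    (fun ω => ∑ c ∈ S, centred P L (cellSet n E c) ω)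
      =ᵐ[P] centred P L (⋃ c ∈ S, cellSet n E c) := by
  filter_upwards [hL.ae_biUnion_finset (isBoundedBorel_cellSet hE) pairwise_disjoint_cellSet S]
    with ω hω
  simp only [centred]
  rw [hω, Finset.sum_sub_distrib, ← Finset.sum_mul, sum_volume_real_cellSet hE]

lemma ae_cellSum_alive [IsProbabilityMeasure P] (hL : IsLevyBasis P τ L)
    (hE : ∀ k, IsBoundedBorel (E k)) (hbetween : ∀ i k j, i ≤ k → k ≤ j → E i ∩ E j ⊆ E k)
    (hk : k ≤ n) :
    cellSum n (fun c => centred P L (cellSet n E c)) (alive k) =ᵐ[P] centred P L (E k) := by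
  rw [← biUnion_alive hbetween hk]
  exact ae_sum_centred_cellSet hL hE _

lemma cellModel_cellSet [IsProbabilityMeasure P] (hL : IsLevyBasis P τ L) {seed : Measure ℝ}
    (hseed : τ.IsSeedLaw seed) (hvar : Var[id; seed] = 1) {s K V κ δ : ℝ} (hs : 2 ≤ s)
    (hmom : MemLp id (ENNReal.ofReal s) seed)
    (hKV : ∀ B, IsBoundedBorel B → volume.real B ≤ V →
      HasMomentLE P (centred P L B) s (K * volume.real B))
    (hK : 0 ≤ K) (hκ : 0 ≤ κ) (hδ : 0 ≤ δ) (hE : ∀ k, IsBoundedBorel (E k))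
    (hbetween : ∀ i k j, i ≤ k → k ≤ j → E i ∩ E j ⊆ E k)
    (halive : ∀ k, volume.real (E k) ≤ V)
    (hborn : ∀ k, volume.real (E (k + 1) \ E k) ≤ κ * δ)
    (hdies : ∀ k, volume.real (E k \ E (k + 1)) ≤ κ * δ) :
    CellModel P n (fun c => centred P L (cellSet n E c)) (fun c => volume.real (cellSet n E c))
      s K V κ δ := by
  have hcell := isBoundedBorel_cellSet (n := n) hE
  have hunion := IsBoundedBorel.biUnion_finset hcell
  have hsum := ae_sum_centred_cellSet (n := n) hL hE
  have hdiff : ∀ j k, volume (E j \ E k) ≠ ⊤ := fun j k =>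
    ((hE j).isBounded.subset sdiff_subset).measure_lt_top.ne
  refine
    { measurable := fun c => hL.measurable_centred (hcell c)
      indep := (hL.iIndepFun_of_denumerable hcell pairwise_disjoint_cellSet).comp
        (fun c x => x - volume.real (cellSet n E c) * ∫ ω, L (strip 0 1) ω ∂P)
        fun c => by fun_prop
      memLp := fun S =>
        memLp_finsetSum S fun c _ => hL.memLp_centred hseed (by linarith) hmom (hcell c)
      mean := fun S => ?_
      sq := fun S => ?_
      moment := fun S hS => ?_
      w_nonneg := fun c => measureReal_nonneg
      K_nonneg := hK
      κ_nonneg := hκ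
      δ_nonneg := hδ
      alive_le := fun k hk => ?_
      born_le := fun k hk => ?_
      dies_le := fun k hk => ?_ }
  · rw [integral_congr_ae (hsum S)]
    exact hL.integral_centred hseed (by linarith) hmom (hunion S)
  · rw [sum_volume_real_cellSet hE, ← hL.integral_centred_sq hseed hs hmom hvar (hunion S)]
    exact integral_congr_ae ((hsum S).fun_comp (· ^ 2))
  · rw [sum_volume_real_cellSet hE] at hS ⊢
    exact ((hKV _ (hunion S) hS).congr_ae (hsum S).symm).integral_le
  · rw [sum_volume_real_cellSet hE, biUnion_alive hbetween hk]
    exact halive k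
  · rw [sum_volume_real_cellSet hE]
    exact (measureReal_mono (biUnion_born_subset hk) (hdiff _ _)).trans (hborn k)
  · rw [sum_volume_real_cellSet hE]
    exact (measureReal_mono (biUnion_dies_subset hk) (hdiff _ _)).trans (hdies k)

end CellSets

/-! ### Moments of the estimator -/

section Estimator

variable {δ : ℝ} {n l : ℕ}

lemma aHat_natCast_mul (x : ℝ → ℝ) (hδ : 0 < δ) (n l : ℕ) :
    aHat x δ n (l * δ) = -(1 / (n * δ)) * ∑ i ∈ Finset.range (n - l),
      (x (i * δ) - sampleMean x δ n) * (x ((l + i + 1 : ℕ) * δ) - x ((l + i : ℕ) * δ)) := by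
  have hfloor : ⌊(l : ℝ) * δ / δ⌋₊ = l := by
    rw [mul_div_cancel_right₀ _ hδ.ne', Nat.floor_natCast]
  rw [aHat, hfloor, Finset.sum_Ico_eq_sum_range]
  congr 1
  refine Finset.sum_congr rfl fun i _ => ?_
  push_cast
  ring_nf

lemma sampleMean_sub_const (x : ℝ → ℝ) (c δ : ℝ) (hn : n ≠ 0) :
    sampleMean (fun s => x s - c) δ n = sampleMean x δ n - c := by
  simp only [sampleMean, Finset.sum_sub_distrib, Finset.sum_const, Finset.card_range,
    nsmul_eq_mul]
  rw [sub_div, mul_div_cancel_left₀ _ (Nat.cast_ne_zero.2 hn)]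

lemma aHat_sub_const (x : ℝ → ℝ) (c δ : ℝ) (hn : n ≠ 0) (t : ℝ) :
    aHat (fun s => x s - c) δ n t = aHat x δ n t := by
  simp only [aHat, sampleMean_sub_const x c δ hn, sub_sub_sub_cancel_right]

lemma aHat_sub_eq (x : ℝ → ℝ) (hδ : 0 < δ) (hl : l ≤ n) (v : ℕ → ℝ) :
    aHat x δ n (l * δ) - 1 / (n * δ) * ∑ i ∈ Finset.range (n - l), v i
      = 1 / (n * δ) * (sampleMean x δ n * (x (n * δ) - x (l * δ))
        - ∑ i ∈ Finset.range (n - l),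
          (x (i * δ) * (x ((l + i + 1 : ℕ) * δ) - x ((l + i : ℕ) * δ)) + v i)) := by
  have htelescope : ∑ i ∈ Finset.range (n - l), (x ((l + i + 1 : ℕ) * δ) - x ((l + i : ℕ) * δ))
      = x (n * δ) - x (l * δ) := by
    simpa only [Nat.add_sub_cancel' hl, add_zero, add_assoc] using
      Finset.sum_range_sub (fun i => x ((l + i : ℕ) * δ)) (n - l)
  rw [aHat_natCast_mul x hδ, ← htelescope]
  simp only [sub_mul, Finset.sum_sub_distrib, Finset.sum_add_distrib, ← Finset.mul_sum]
  ring

lemma tendsto_sampleMean {x : ℕ → ℝ → ℝ} {y : ℝ → ℝ}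
    (hx : ∀ k < n, Tendsto (fun j => x j (k * δ)) atTop (𝓝 (y (k * δ)))) :
    Tendsto (fun j => sampleMean (x j) δ n) atTop (𝓝 (sampleMean y δ n)) :=
  (tendsto_finsetSum _ fun k hk => hx k (Finset.mem_range.1 hk)).div_const _

lemma tendsto_aHat {x : ℕ → ℝ → ℝ} {y : ℝ → ℝ} (hδ : 0 < δ) (l : ℕ)
    (hx : ∀ k ≤ n, Tendsto (fun j => x j (k * δ)) atTop (𝓝 (y (k * δ)))) :
    Tendsto (fun j => aHat (x j) δ n (l * δ)) atTop (𝓝 (aHat y δ n (l * δ))) := by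
  simp only [aHat_natCast_mul _ hδ]
  refine Tendsto.const_mul _ (tendsto_finsetSum _ fun i hi => ?_)
  have hi := Finset.mem_range.1 hi
  exact ((hx i (by omega)).sub (tendsto_sampleMean fun k hk => hx k hk.le)).mul
    ((hx (l + i + 1) (by omega)).sub (hx (l + i) (by omega)))

/-- The constant in `CellModel.hasMomentLE_aHat_sub`. -/
noncomputable def estimatorConst (K V κ r : ℝ) : ℝ :=
  2 ^ (r - 1) * (quadConst K V κ r + (1 + 2 ^ (2 * r)) * ((1 + K) * V))

variable {Ω : Type*} [MeasurableSpace Ω] {P : Measure Ω} {r : ℝ}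

lemma hasMomentLE_sampleMean_mul_sub {Y : ℝ → Ω → ℝ} {M : ℝ} (hr : 1 ≤ r) (hn : n ≠ 0)
    (hl : l ≤ n) (hY : ∀ k : ℕ, k ≤ n → HasMomentLE P (Y (k * δ)) (2 * r) M) :
    HasMomentLE P
      (fun ω => sampleMean (fun t => Y t ω) δ n * (Y (n * δ) ω - Y (l * δ) ω)) r
      ((1 + 2 ^ (2 * r)) * M) := by
  have hmean : HasMomentLE P (fun ω => sampleMean (fun t => Y t ω) δ n) (2 * r) M :=
    HasMomentLE.sum_div hn (fun k hk => hY k hk.le) (by linarith)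
  refine (hmean.mul ((hY n le_rfl).sub (hY l hl) (by linarith)) (by linarith)).mono (le_of_eq ?_)
  rw [Real.rpow_sub_one two_ne_zero]
  ring

variable {ξ : ℕ × ℕ → Ω → ℝ} {w : ℕ × ℕ → ℝ} {s K V κ : ℝ}

lemma ae_aHat_sub_eq {Y : ℝ → Ω → ℝ} (hδ : 0 < δ) (hl : l ≤ n)
    (hY : ∀ k : ℕ, k ≤ n → Y (k * δ) =ᵐ[P] cellSum n ξ (alive k)) :
    (fun ω => aHat (fun t => Y t ω) δ n (l * δ) - 1 / (n * δ) *
        ∑ i ∈ Finset.range (n - l), ∑ c ∈ cells n (aliveDies i (l + i)), w c)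
      =ᵐ[P] fun ω => 1 / (n * δ) * (sampleMean (fun t => Y t ω) δ n *
        (Y (n * δ) ω - Y (l * δ) ω) - laggedForm n ξ w l ω) := by
  have hgrid : ∀ᵐ ω ∂P, ∀ k : ℕ, k ≤ n → Y (k * δ) ω = cellSum n ξ (alive k) ω :=
    ae_all_iff.2 fun k => eventually_imp_distrib_left.2 (hY k)
  filter_upwards [hgrid] with ω hω
  rw [aHat_sub_eq _ hδ hl, laggedForm]
  congr 2
  refine Finset.sum_congr rfl fun i hi => ?_
  have hi := Finset.mem_range.1 hi
  rw [hω i (by omega), hω (l + i + 1) (by omega), hω (l + i) (by omega)]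

theorem CellModel.hasMomentLE_aHat_sub [IsProbabilityMeasure P]
    (h : CellModel P n ξ w s K V κ δ) (hδ : 0 < δ) (hT : 1 ≤ n * δ) (hr : 2 ≤ r)
    (hrs : 2 * r ≤ s) (hl : l ≤ n) {Y : ℝ → Ω → ℝ}
    (hY : ∀ k : ℕ, k ≤ n → Y (k * δ) =ᵐ[P] cellSum n ξ (alive k)) :
    HasMomentLE P (fun ω => aHat (fun t => Y t ω) δ n (l * δ) - 1 / (n * δ) *
        ∑ i ∈ Finset.range (n - l), ∑ c ∈ cells n (aliveDies i (l + i)), w c) r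
      (estimatorConst K V κ r * (n * δ) ^ (-(r / 2))) := by
  have hn : n ≠ 0 := by
    rintro rfl
    norm_num at hT
  have hK := h.K_nonneg
  have hV := h.V_nonneg
  have hvalue : ∀ k : ℕ, k ≤ n → HasMomentLE P (Y (k * δ)) (2 * r) ((1 + K) * V) := fun k hk =>
    ((h.hasMomentLE_cellSum (by linarith) hrs (h.alive_le k hk)).congr_ae (hY k hk).symm).mono
      (mul_le_mul_of_nonneg_left (h.alive_le k hk) (by linarith))
  refine ((((hasMomentLE_sampleMean_mul_sub (by linarith) hn hl hvalue).sub
    (h.hasMomentLE_laggedForm hT hr hrs le_rfl hl) (by linarith)).const_mul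
    (1 / (n * δ))).congr_ae (ae_aHat_sub_eq hδ hl hY).symm).mono ?_
  set T : ℝ := n * δ
  have hT0 : 0 < T := by linarith
  have hTr : 1 ≤ T ^ (r / 2) := Real.one_le_rpow hT (by linarith)
  have hscale : |1 / T| ^ r = T ^ (-r) := by
    rw [abs_of_pos (by positivity), one_div, Real.inv_rpow hT0.le, Real.rpow_neg hT0.le]
  calc |1 / T| ^ r * (2 ^ (r - 1) * ((1 + 2 ^ (2 * r)) * ((1 + K) * V)
        + quadConst K V κ r * T ^ (r / 2)))
      ≤ T ^ (-r) * (2 ^ (r - 1) * ((1 + 2 ^ (2 * r)) * ((1 + K) * V) * T ^ (r / 2)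
        + quadConst K V κ r * T ^ (r / 2))) := by
        rw [hscale]
        gcongr ?_ * (_ * (?_ + _))
        exact le_mul_of_one_le_right (by positivity) hTr
    _ = estimatorConst K V κ r * (T ^ (-r) * T ^ (r / 2)) := by
        rw [estimatorConst]
        ring
    _ = estimatorConst K V κ r * T ^ (-(r / 2)) := by
        rw [← Real.rpow_add hT0, show -r + r / 2 = -(r / 2) by ring]

end Estimator

/-! ### The estimator of a trawl process -/

section TrawlEstimator

variable {Ω : Type*} [MeasurableSpace Ω] {P : Measure Ω} {a : ℝ → ℝ} {r s δ : ℝ} {n l : ℕ}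

lemma exists_strictMono_forall_tendsto_ae {ι : Type*} {f : ι → ℕ → Ω → ℝ} {g : ι → Ω → ℝ}
    (h : ∀ i, TendstoInMeasure P (f i) atTop (g i)) (S : Finset ι) :
    ∃ ns : ℕ → ℕ, StrictMono ns ∧
      ∀ᵐ ω ∂P, ∀ i ∈ S, Tendsto (fun j => f i (ns j) ω) atTop (𝓝 (g i ω)) := by
  classical
  induction S using Finset.induction_on with
  | empty => exact ⟨id, strictMono_id, by simp⟩
  | insert i S _ ih =>
    obtain ⟨ns, hns, hS⟩ := ih
    obtain ⟨ms, hms, hi⟩ := ((h i).comp hns.tendsto_atTop).exists_seq_tendsto_ae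
    refine ⟨ns ∘ ms, hns.comp hms, ?_⟩
    filter_upwards [hS, hi] with ω hωS hωi
    exact (Finset.forall_mem_insert _ _ _).2 ⟨hωi, fun j hj => (hωS j hj).comp hms.tendsto_atTop⟩

/-- The part of the trawl sets at the times `iδ` and `(l + i)δ` that is lost between `(l + i)δ` and
`(l + i + 1)δ`. -/
def lossSet (a : ℝ → ℝ) (δ : ℝ) (l i : ℕ) : Set (ℝ × ℝ) :=
  (trawlSetAt a (i * δ) ∩ trawlSetAt a ((l + i : ℕ) * δ)) \ trawlSetAt a ((l + i + 1 : ℕ) * δ)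

/-- The deterministic quantity around which `â(lδ)` concentrates. -/
noncomputable def aHatCentre (a : ℝ → ℝ) (δ : ℝ) (n l : ℕ) : ℝ :=
  ((n - l : ℕ) : ℝ) / (n * δ) * ∫ u in Ico (l * δ) (l * δ + δ), a u

lemma IsGlobalTrawlFunction.volume_real_lossSet (ha : IsGlobalTrawlFunction a) (hδ : 0 ≤ δ)
    (l i : ℕ) : volume.real (lossSet a δ l i) = ∫ u in Ico (l * δ) (l * δ + δ), a u := by
  have hlag : ((l + i : ℕ) : ℝ) * δ - i * δ = l * δ := by
    push_cast
    ring
  have hle : (i : ℝ) * δ ≤ (l + i : ℕ) * δ := by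
    gcongr
    omega
  rw [lossSet, Nat.cast_succ, add_one_mul, ha.volume_real_trawlSetAt_inter_diff hle hδ, hlag]

lemma IsGlobalTrawlFunction.volume_lossSet_ne_top (ha : IsGlobalTrawlFunction a) (l i : ℕ) :
    volume (lossSet a δ l i) ≠ ⊤ :=
  measure_ne_top_of_subset (sdiff_subset.trans inter_subset_left)
    (ha.volume_trawlSetAt_ne_top (i * δ))

lemma IsGlobalTrawlFunction.one_div_mul_sum_volume_real_lossSet (ha : IsGlobalTrawlFunction a)
    (hδ : 0 ≤ δ) (n l : ℕ) :
    1 / (n * δ) * ∑ i ∈ Finset.range (n - l), volume.real (lossSet a δ l i)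
      = aHatCentre a δ n l := by
  simp only [ha.volume_real_lossSet hδ, Finset.sum_const, Finset.card_range, nsmul_eq_mul,
    aHatCentre]
  ring

variable {L : Set (ℝ × ℝ) → Ω → ℝ}

lemma tendsto_centred_inter_box {X : Ω → ℝ} {B : Set (ℝ × ℝ)} (hB : volume B ≠ ⊤) {ns : ℕ → ℕ}
    (hns : StrictMono ns) {ω : Ω}
    (hω : Tendsto (fun j => L (B ∩ box (ns j)) ω) atTop (𝓝 (X ω))) :
    Tendsto (fun j => centred P L (B ∩ box (ns j)) ω) atTop
      (𝓝 (X ω - volume.real B * ∫ ω, L (strip 0 1) ω ∂P)) :=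
  hω.sub (((tendsto_volume_real_inter_box hB).comp hns.tendsto_atTop).mul_const _)

lemma IsGlobalTrawlFunction.isBoundedBorel_trawlSetAt_inter_box (ha : IsGlobalTrawlFunction a)
    (t : ℝ) (m : ℕ) : IsBoundedBorel (trawlSetAt a t ∩ box m) :=
  isBoundedBorel_inter_box (measurableSet_trawlSetAt ha.continuous.measurable t) m

lemma trawlSetAt_inter_box_inter_subset (ha : Antitone a) (hδ : 0 ≤ δ) (m i k j : ℕ) (hik : i ≤ k)
    (hkj : k ≤ j) :
    (trawlSetAt a (i * δ) ∩ box m) ∩ (trawlSetAt a (j * δ) ∩ box m)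
      ⊆ trawlSetAt a (k * δ) ∩ box m := fun _ hx =>
  ⟨trawlSetAt_inter_subset ha (by gcongr) (by gcongr) ⟨hx.1.1, hx.2.1⟩, hx.1.2⟩

variable [IsProbabilityMeasure P] {τ : Triplet} {seed : Measure ℝ}

lemma cellModel_trawlSetAt_inter_box (hL : IsLevyBasis P τ L) (hseed : τ.IsSeedLaw seed)
    (hvar : Var[id; seed] = 1) (hs : 2 ≤ s) (hmom : MemLp id (ENNReal.ofReal s) seed)
    (ha : IsGlobalTrawlFunction a) {K : ℝ} (hK : 0 ≤ K)
    (hKV : ∀ B, IsBoundedBorel B → volume.real B ≤ ∫ u in Ici 0, a u →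
      HasMomentLE P (centred P L B) s (K * volume.real B))
    (hδ : 0 ≤ δ) (n m : ℕ) :
    CellModel P n (fun c => centred P L (cellSet n (fun k => trawlSetAt a (k * δ) ∩ box m) c))
      (fun c => volume.real (cellSet n (fun k => trawlSetAt a (k * δ) ∩ box m) c))
      s K (∫ u in Ici 0, a u) (a 0) δ := by
  have hdiff : ∀ t u, (trawlSetAt a t ∩ box m) \ (trawlSetAt a u ∩ box m)
      ⊆ trawlSetAt a t \ trawlSetAt a u := fun t u x => by
    simp only [mem_inter_iff, Set.mem_sdiff]
    tauto
  have hfin : ∀ t u, volume (trawlSetAt a t \ trawlSetAt a u) ≠ ⊤ := fun t u =>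
    measure_ne_top_of_subset sdiff_subset (ha.volume_trawlSetAt_ne_top t)
  refine cellModel_cellSet hL hseed hvar hs hmom hKV hK (ha.nonneg 0) hδ
    (fun k => ha.isBoundedBorel_trawlSetAt_inter_box _ m)
    (trawlSetAt_inter_box_inter_subset ha.antitone hδ m) (fun k => ?_) (fun k => ?_) fun k => ?_
  · exact (measureReal_mono inter_subset_left (ha.volume_trawlSetAt_ne_top _)).trans_eq
      (ha.volume_real_trawlSetAt _)
  · rw [Nat.cast_succ, add_one_mul]
    exact (measureReal_mono (hdiff _ _) (hfin _ _)).trans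
      (volume_real_trawlSetAt_add_diff_le ha.antitone (ha.nonneg 0) _ hδ)
  · rw [Nat.cast_succ, add_one_mul]
    exact (measureReal_mono (hdiff _ _) (hfin _ _)).trans
      (ha.volume_real_trawlSetAt_diff_le _ hδ)

lemma hasMomentLE_aHat_centred_inter_box (hL : IsLevyBasis P τ L) (hseed : τ.IsSeedLaw seed)
    (hvar : Var[id; seed] = 1) (hmom : MemLp id (ENNReal.ofReal s) seed)
    (ha : IsGlobalTrawlFunction a) {K : ℝ} (hK : 0 ≤ K)
    (hKV : ∀ B, IsBoundedBorel B → volume.real B ≤ ∫ u in Ici 0, a u →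
      HasMomentLE P (centred P L B) s (K * volume.real B))
    (hr : 2 ≤ r) (hrs : 2 * r ≤ s) (hδ : 0 < δ) (hT : 1 ≤ n * δ) (hl : l ≤ n) (m : ℕ) :
    HasMomentLE P
      (fun ω => aHat (fun t => centred P L (trawlSetAt a t ∩ box m) ω) δ n (l * δ)
        - 1 / (n * δ) * ∑ i ∈ Finset.range (n - l), volume.real (lossSet a δ l i ∩ box m)) r
      (estimatorConst K (∫ u in Ici 0, a u) (a 0) r * (n * δ) ^ (-(r / 2))) := by
  have hE := fun k : ℕ => ha.isBoundedBorel_trawlSetAt_inter_box (k * δ) m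
  have hbetween := trawlSetAt_inter_box_inter_subset ha.antitone hδ.le m
  have hloss : ∀ i ∈ Finset.range (n - l), ∑ c ∈ cells n (aliveDies i (l + i)),
      volume.real (cellSet n (fun k => trawlSetAt a (k * δ) ∩ box m) c)
        = volume.real (lossSet a δ l i ∩ box m) := fun i hi => by
    rw [sum_volume_real_aliveDies hE hbetween (by omega) (by have := Finset.mem_range.1 hi; omega)]
    congr 1
    ext x
    simp only [lossSet, mem_inter_iff, Set.mem_sdiff]
    tauto
  rw [← Finset.sum_congr rfl hloss]
  exact (cellModel_trawlSetAt_inter_box hL hseed hvar (by linarith) hmom ha hK hKV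
    hδ.le n m).hasMomentLE_aHat_sub (Y := fun t => centred P L (trawlSetAt a t ∩ box m)) hδ hT hr
    hrs hl fun k hk => (ae_cellSum_alive hL hE hbetween hk).symm

theorem exists_hasMomentLE_aHat_sub_aHatCentre (hL : IsLevyBasis P τ L)
    (hseed : τ.IsSeedLaw seed) (hvar : Var[id; seed] = 1)
    (hmom : MemLp id (ENNReal.ofReal s) seed) (ha : IsGlobalTrawlFunction a) {X : ℝ → Ω → ℝ}
    (hX : IsTrawlProcess P L a X) (hr : 2 ≤ r) (hrs : 2 * r ≤ s) :
    ∃ C : ℝ, ∀ (δ : ℝ) (n l : ℕ), 0 < δ → 1 ≤ n * δ → l ≤ n →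
      HasMomentLE P (fun ω => aHat (fun t => X t ω) δ n (l * δ) - aHatCentre a δ n l) r
        (C * (n * δ) ^ (-(r / 2))) := by
  obtain ⟨K, hK, hKV⟩ := hL.exists_hasMomentLE_centred hseed (show 2 ≤ s by linarith) hmom
    (setIntegral_nonneg measurableSet_Ici fun u _ => ha.nonneg u : 0 ≤ ∫ u in Ici 0, a u)
  refine ⟨estimatorConst K (∫ u in Ici 0, a u) (a 0) r, fun δ n l hδ hT hl => ?_⟩
  have hn : n ≠ 0 := by
    rintro rfl
    norm_num at hT
  obtain ⟨ns, hns, hlim⟩ := exists_strictMono_forall_tendsto_ae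
    (f := fun (k m : ℕ) => L (trawlSetAt a (k * δ) ∩ box m)) (fun k => hX (k * δ))
    (Finset.range (n + 1))
  refine HasMomentLE.of_tendsto (by linarith) (fun j =>
    hasMomentLE_aHat_centred_inter_box hL hseed hvar hmom ha hK hKV hr hrs hδ hT hl (ns j)) ?_
  filter_upwards [hlim] with ω hω
  rw [← aHat_sub_const (fun t => X t ω) ((∫ u in Ici 0, a u) * ∫ ω, L (strip 0 1) ω ∂P) δ hn,
    ← ha.one_div_mul_sum_volume_real_lossSet hδ.le]
  refine (tendsto_aHat hδ l fun k hk => ?_).sub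
    (Tendsto.const_mul _ (tendsto_finsetSum _ fun i _ =>
      (tendsto_volume_real_inter_box (ha.volume_lossSet_ne_top l i)).comp hns.tendsto_atTop))
  rw [← ha.volume_real_trawlSetAt (k * δ)]
  exact tendsto_centred_inter_box (ha.volume_trawlSetAt_ne_top _) hns
    (hω k (Finset.mem_range.2 (by omega)))

end TrawlEstimator

/-! ### Test functions -/

section TestFunctions

variable {p q : ℝ} {g : ℝ → ℝ}

lemma TestClass.apply_zero (hg : TestClass 1 p q g) : g 0 = 0 := by
  simpa using hg.zero 0 one_pos

lemma TestClass.differentiable (hg : TestClass 1 p q g) : Differentiable ℝ g :=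
  hg.contDiff.differentiable (by simp)

lemma TestClass.continuous_deriv (hg : TestClass 1 p q g) : Continuous (deriv g) :=
  (contDiff_one_iff_deriv.1 (by simpa using hg.contDiff)).2

lemma TestClass.exists_abs_deriv_le (hp : 0 < p) (hg : TestClass 1 p q g) :
    ∃ C : ℝ, 0 ≤ C ∧ ∀ x, |deriv g x| ≤ C * (|x| ^ p + |x| ^ q) := by
  have near := hg.near_zero
  have far := hg.near_infty
  rw [iteratedDeriv_one] at near far
  obtain ⟨C₀, hC₀, near⟩ := near.exists_nonneg
  obtain ⟨C₁, hC₁, far⟩ := far.exists_nonneg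
  obtain ⟨ε, hε, near⟩ := Metric.eventually_nhds_iff.1 near.bound
  obtain ⟨K, hK, far⟩ := mem_cocompact.1 far.bound
  obtain ⟨M, hM⟩ := hK.exists_bound_of_continuousOn hg.continuous_deriv.continuousOn
  refine ⟨C₀ + C₁ + |M| / ε ^ p, by positivity, fun x => ?_⟩
  have hεp : 0 < ε ^ p := by positivity
  have hxp : 0 ≤ |x| ^ p := by positivity
  have hxq : 0 ≤ |x| ^ q := by positivity
  by_cases hx : |x| < ε
  · calc |deriv g x| ≤ C₀ * |x| ^ p := by
          simpa [abs_of_nonneg hxp] using near (y := x) (by simpa [Real.dist_eq] using hx)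
      _ ≤ (C₀ + C₁ + |M| / ε ^ p) * (|x| ^ p + |x| ^ q) := by
          gcongr
          · linarith [div_nonneg (abs_nonneg M) hεp.le]
          · linarith
  by_cases hxK : x ∈ K
  · calc |deriv g x| ≤ |M| := (hM x hxK).trans (le_abs_self M)
      _ = |M| / ε ^ p * ε ^ p := (div_mul_cancel₀ _ hεp.ne').symm
      _ ≤ |M| / ε ^ p * |x| ^ p := by
          gcongr
          exact not_lt.1 hx
      _ ≤ (C₀ + C₁ + |M| / ε ^ p) * (|x| ^ p + |x| ^ q) := by gcongr <;> linarith
  · calc |deriv g x| ≤ C₁ * |x| ^ q := by simpa [abs_of_nonneg hxq] using far hxK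
      _ ≤ (C₀ + C₁ + |M| / ε ^ p) * (|x| ^ p + |x| ^ q) := by
          gcongr
          · linarith [div_nonneg (abs_nonneg M) hεp.le]
          · linarith

lemma add_rpow_le_two_rpow_mul {r x y : ℝ} (hr : 1 ≤ r) (hx : 0 ≤ x) (hy : 0 ≤ y) :
    (x + y) ^ r ≤ 2 ^ (r - 1) * (x ^ r + y ^ r) := by
  simpa only [abs_of_nonneg hx, abs_of_nonneg hy, abs_of_nonneg (add_nonneg hx hy)]
    using abs_add_rpow_le_two_rpow_mul hr x y

lemma TestClass.exists_abs_sub_le (hp : 1 ≤ p) (hq : 1 ≤ q) (hg : TestClass 1 p q g) :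
    ∃ C : ℝ, 0 ≤ C ∧ ∀ x y, |g x - g y| ≤
      C * |x - y| * (|y| ^ p + |y| ^ q + |x - y| ^ p + |x - y| ^ q) := by
  obtain ⟨C, hC, deriv_le⟩ := hg.exists_abs_deriv_le (zero_lt_one.trans_le hp)
  refine ⟨C * (2 ^ (p - 1) + 2 ^ (q - 1)), by positivity, fun x y => ?_⟩
  set M := |y| + |x - y|
  have mem_ball {z : ℝ} : z ∈ Metric.closedBall 0 M ↔ |z| ≤ M := by
    rw [mem_closedBall_zero_iff, Real.norm_eq_abs]
  have hy : |y| ≤ M := le_add_of_nonneg_right (abs_nonneg _)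
  have hx : |x| ≤ M := by simpa only [add_sub_cancel] using abs_add_le y (x - y)
  have mean_value : |g x - g y| ≤ C * (M ^ p + M ^ q) * |x - y| := by
    refine (convex_closedBall (0 : ℝ) M).norm_image_sub_le_of_norm_deriv_le
      (fun z _ => hg.differentiable z) (fun z hz => ?_) (mem_ball.2 hy) (mem_ball.2 hx)
    have hz := mem_ball.1 hz
    exact (deriv_le z).trans (by gcongr)
  have power_le : M ^ p + M ^ q ≤ (2 ^ (p - 1) + 2 ^ (q - 1)) *
      (|y| ^ p + |y| ^ q + |x - y| ^ p + |x - y| ^ q) :=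
    calc M ^ p + M ^ q ≤ 2 ^ (p - 1) * (|y| ^ p + |x - y| ^ p)
          + 2 ^ (q - 1) * (|y| ^ q + |x - y| ^ q) :=
        add_le_add (add_rpow_le_two_rpow_mul hp (abs_nonneg y) (abs_nonneg (x - y)))
          (add_rpow_le_two_rpow_mul hq (abs_nonneg y) (abs_nonneg (x - y)))
      _ ≤ 2 ^ (p - 1) * (|y| ^ p + |y| ^ q + |x - y| ^ p + |x - y| ^ q)
          + 2 ^ (q - 1) * (|y| ^ p + |y| ^ q + |x - y| ^ p + |x - y| ^ q) := by
        have := Real.rpow_nonneg (abs_nonneg y) p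
        have := Real.rpow_nonneg (abs_nonneg y) q
        have := Real.rpow_nonneg (abs_nonneg (x - y)) p
        have := Real.rpow_nonneg (abs_nonneg (x - y)) q
        exact add_le_add (mul_le_mul_of_nonneg_left (by linarith) (by positivity))
          (mul_le_mul_of_nonneg_left (by linarith) (by positivity))
      _ = _ := (add_mul _ _ _).symm
  calc |g x - g y| ≤ C * (M ^ p + M ^ q) * |x - y| := mean_value
    _ ≤ C * ((2 ^ (p - 1) + 2 ^ (q - 1)) *
          (|y| ^ p + |y| ^ q + |x - y| ^ p + |x - y| ^ q)) * |x - y| := by gcongr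
    _ = _ := by ring

lemma TestClass.exists_abs_le_mul (hp : 1 ≤ p) (hq : 1 ≤ q) (hg : TestClass 1 p q g) (M : ℝ) :
    ∃ C : ℝ, 0 ≤ C ∧ ∀ x, 0 ≤ x → x ≤ M → |g x| ≤ C * x := by
  obtain ⟨C, hC, sub_le⟩ := hg.exists_abs_sub_le hp hq
  refine ⟨C * (|M| ^ p + |M| ^ q), by positivity, fun x hx hxM => ?_⟩
  have hxM : x ≤ |M| := hxM.trans (le_abs_self M)
  calc |g x| ≤ C * x * (x ^ p + x ^ q) := by
        simpa [hg.apply_zero, abs_of_nonneg hx, Real.zero_rpow (zero_lt_one.trans_le hp).ne',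
          Real.zero_rpow (zero_lt_one.trans_le hq).ne'] using sub_le x 0
    _ = C * (x ^ p + x ^ q) * x := by ring
    _ ≤ C * (|M| ^ p + |M| ^ q) * x := by gcongr

end TestFunctions

/-! ### Riemann sums -/

section Floor

variable {δ s : ℝ}

lemma floor_div_eq_of_mem_Ico (hδ : 0 < δ) {l : ℕ} (hs : s ∈ Ico (l * δ) ((l + 1 : ℕ) * δ)) :
    ⌊s / δ⌋₊ = l := by
  have hs0 : 0 ≤ s := le_trans (by positivity) hs.1
  rw [Nat.floor_eq_iff (by positivity), le_div_iff₀ hδ, div_lt_iff₀ hδ]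
  exact_mod_cast hs

lemma floor_div_mul_le (hδ : 0 < δ) (hs : 0 ≤ s) : ⌊s / δ⌋₊ * δ ≤ s :=
  (le_div_iff₀ hδ).1 (Nat.floor_le (by positivity))

lemma sub_lt_floor_div_mul (hδ : 0 < δ) (s : ℝ) : s - δ < ⌊s / δ⌋₊ * δ := by
  have := (div_lt_iff₀ hδ).1 (Nat.lt_floor_add_one (s / δ))
  linarith

lemma floor_div_lt (hδ : 0 < δ) (hs : 0 ≤ s) {n : ℕ} (hn : s < n * δ) : ⌊s / δ⌋₊ < n := by
  rwa [Nat.floor_lt (by positivity), div_lt_iff₀ hδ]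

lemma tendsto_floor_div_mul {Δ : ℕ → ℝ} (hΔpos : ∀ n, 0 < Δ n) (hΔ : Tendsto Δ atTop (𝓝 0))
    (hs : 0 ≤ s) : Tendsto (fun n => (⌊s / Δ n⌋₊ : ℝ) * Δ n) atTop (𝓝 s) :=
  tendsto_of_tendsto_of_tendsto_of_le_of_le (by simpa using hΔ.const_sub s) tendsto_const_nhds
    (fun n => (sub_lt_floor_div_mul (hΔpos n) s).le) (fun n => floor_div_mul_le (hΔpos n) hs)

end Floor

section GridStep

/-- The step function with value `φ l` on `[lδ, (l + 1)δ)` for `l < n` and `0` on `[nδ, ∞)`, whose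
integral is the Riemann sum `δ ∑_{l < n} φ l`. Its values on `(-∞, 0)` are irrelevant. -/
noncomputable def gridStep (φ : ℕ → ℝ) (δ : ℝ) (n : ℕ) : ℝ → ℝ :=
  (Iio (n * δ)).indicator fun s => φ ⌊s / δ⌋₊

variable {φ : ℕ → ℝ} {δ : ℝ} {k n : ℕ}

lemma gridStep_of_lt {s : ℝ} (hs : s < n * δ) : gridStep φ δ n s = φ ⌊s / δ⌋₊ :=
  indicator_of_mem (mem_Iio.2 hs) _

lemma measurable_gridStep (φ : ℕ → ℝ) (δ : ℝ) (n : ℕ) : Measurable (gridStep φ δ n) :=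
  ((measurable_of_countable φ).comp
    (Nat.measurable_floor.comp (measurable_id.div_const δ))).indicator measurableSet_Iio

lemma gridStep_nonneg (hφ : ∀ l, 0 ≤ φ l) (δ : ℝ) (n : ℕ) (s : ℝ) : 0 ≤ gridStep φ δ n s :=
  indicator_nonneg (fun _ _ => hφ _) s

lemma gridStep_le (hφ : ∀ l, 0 ≤ φ l) (δ : ℝ) (n : ℕ) (s : ℝ) :
    gridStep φ δ n s ≤ φ ⌊s / δ⌋₊ :=
  indicator_le_self' (fun _ _ => hφ _) s

lemma abs_gridStep_le {b : ℕ → ℝ} (hb : ∀ l, 0 ≤ b l) (hφ : ∀ l < n, |φ l| ≤ b l) (hδ : 0 < δ)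
    {s : ℝ} (hs : 0 ≤ s) : |gridStep φ δ n s| ≤ b ⌊s / δ⌋₊ := by
  by_cases hsn : s ∈ Iio (n * δ)
  · rw [gridStep_of_lt hsn]
    exact hφ _ (floor_div_lt hδ hs hsn)
  · rw [gridStep, indicator_of_notMem hsn, abs_zero]
    exact hb _

lemma integrableOn_and_setIntegral_floor (φ : ℕ → ℝ) (hδ : 0 < δ) (hkn : k ≤ n) :
    IntegrableOn (fun s : ℝ => φ ⌊s / δ⌋₊) (Ico (k * δ) (n * δ)) ∧
      ∫ s in Ico (k * δ) (n * δ), φ ⌊s / δ⌋₊ = δ * ∑ l ∈ Finset.Ico k n, φ l := by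
  induction n, hkn using Nat.le_induction with
  | base => simp
  | succ n hkn ih =>
    obtain ⟨integrable_init, integral_init⟩ := ih
    have hk : (k : ℝ) * δ ≤ n * δ := by gcongr
    have hn : (n : ℝ) * δ ≤ (n + 1 : ℕ) * δ := by gcongr; simp
    have const_last : EqOn (fun s : ℝ => φ ⌊s / δ⌋₊) (fun _ => φ n)
        (Ico (n * δ) ((n + 1 : ℕ) * δ)) := fun s hs => by
      simp only [floor_div_eq_of_mem_Ico hδ hs]
    have integrable_last : IntegrableOn (fun s : ℝ => φ ⌊s / δ⌋₊)
        (Ico (n * δ) ((n + 1 : ℕ) * δ)) :=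
      (integrableOn_const (by simp)).congr_fun const_last.symm measurableSet_Ico
    have volume_last : volume.real (Ico ((n : ℝ) * δ) ((n + 1 : ℕ) * δ)) = δ := by
      rw [Real.volume_real_Ico_of_le hn]
      push_cast
      ring
    rw [← Ico_union_Ico_eq_Ico hk hn]
    refine ⟨integrable_init.union integrable_last, ?_⟩
    rw [setIntegral_union (Ico_disjoint_Ico_same) measurableSet_Ico integrable_init
      integrable_last, integral_init, setIntegral_congr_fun measurableSet_Ico const_last,
      setIntegral_const, volume_last, smul_eq_mul, Finset.sum_Ico_succ_top hkn, mul_add]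

lemma integrableOn_gridStep (φ : ℕ → ℝ) (hδ : 0 < δ) (n : ℕ) :
    IntegrableOn (gridStep φ δ n) (Ici 0) := by
  rw [gridStep, integrableOn_indicator_iff measurableSet_Iio, inter_comm, Ici_inter_Iio]
  simpa using (integrableOn_and_setIntegral_floor φ hδ (Nat.zero_le n)).1

lemma setIntegral_Ici_gridStep (φ : ℕ → ℝ) (hδ : 0 < δ) (hkn : k ≤ n) :
    ∫ s in Ici (k * δ), gridStep φ δ n s = δ * ∑ l ∈ Finset.Ico k n, φ l := by
  rw [gridStep, setIntegral_indicator measurableSet_Iio, Ici_inter_Iio]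
  exact (integrableOn_and_setIntegral_floor φ hδ hkn).2

lemma setIntegral_Ici_zero_gridStep (φ : ℕ → ℝ) (hδ : 0 < δ) (n : ℕ) :
    ∫ s in Ici 0, gridStep φ δ n s = δ * ∑ l ∈ Finset.range n, φ l := by
  simpa only [Nat.cast_zero, zero_mul, ← Finset.range_eq_Ico]
    using setIntegral_Ici_gridStep φ hδ (Nat.zero_le n)

-- Replacing the left endpoint `⌊t / δ⌋ δ` of the sum by `t` costs at most `B δ`; the rest is
-- bounded by the distance of the integrands in `L¹`, uniformly in `t`.
lemma abs_riemannSum_sub_setIntegral_Ici_le {B t : ℝ} {F : ℝ → ℝ} (hφ : ∀ l, |φ l| ≤ B)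
    (hδ : 0 < δ) (hF : IntegrableOn F (Ici 0)) (ht : 0 ≤ t) (htn : t < n * δ) :
    |δ * ∑ l ∈ Finset.Ico ⌊t / δ⌋₊ n, φ l - ∫ s in Ici t, F s|
      ≤ B * δ + ∫ s in Ici 0, |gridStep φ δ n s - F s| := by
  have hB : 0 ≤ B := (abs_nonneg _).trans (hφ 0)
  have hkt : ⌊t / δ⌋₊ * δ ≤ t := floor_div_mul_le hδ ht
  have hk : 0 ≤ ⌊t / δ⌋₊ * δ := by positivity
  have step_integrable := integrableOn_gridStep φ hδ n
  have Ici_subset : Ici t ⊆ Ici 0 := Ici_subset_Ici.2 ht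
  have split : δ * ∑ l ∈ Finset.Ico ⌊t / δ⌋₊ n, φ l
      = (∫ s in Ico (⌊t / δ⌋₊ * δ) t, gridStep φ δ n s) + ∫ s in Ici t, gridStep φ δ n s := by
    rw [← setIntegral_Ici_gridStep φ hδ (floor_div_lt hδ ht htn).le, ← Ico_union_Ici_eq_Ici hkt,
      setIntegral_union (disjoint_left.2 fun s hs hs' => hs.2.not_ge hs') measurableSet_Ici
        (step_integrable.mono_set fun s hs => hk.trans hs.1) (step_integrable.mono_set Ici_subset)]
  have initial_le : |∫ s in Ico (⌊t / δ⌋₊ * δ) t, gridStep φ δ n s| ≤ B * δ :=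
    calc |∫ s in Ico (⌊t / δ⌋₊ * δ) t, gridStep φ δ n s|
        ≤ B * volume.real (Ico (⌊t / δ⌋₊ * δ) t) := by
          rw [← Real.norm_eq_abs]
          exact norm_setIntegral_le_of_norm_le_const measure_Ico_lt_top fun s hs =>
            abs_gridStep_le (fun _ => hB) (fun l _ => hφ l) hδ (hk.trans hs.1)
      _ ≤ B * δ := by
          rw [Real.volume_real_Ico_of_le hkt]
          gcongr
          linarith [sub_lt_floor_div_mul hδ t]
  have tail_le : |(∫ s in Ici t, gridStep φ δ n s) - ∫ s in Ici t, F s|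
      ≤ ∫ s in Ici 0, |gridStep φ δ n s - F s| := by
    rw [← integral_sub (step_integrable.mono_set Ici_subset) (hF.mono_set Ici_subset)]
    exact abs_integral_le_integral_abs.trans (setIntegral_mono_set (step_integrable.sub hF).abs
      (ae_of_all _ fun s => abs_nonneg _) Ici_subset.eventuallyLE)
  rw [split, add_sub_assoc]
  exact (abs_add_le _ _).trans (add_le_add initial_le tail_le)

end GridStep

section Riemann

variable {a : ℝ → ℝ}

lemma IsGlobalTrawlFunction.integrableOn_comp_sub_one (ha : IsGlobalTrawlFunction a) :
    IntegrableOn (fun s => a (s - 1)) (Ici 0) := by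
  have integrable_Ici_one : IntegrableOn (fun s => a (s - 1)) (Ici 1) := by
    have h := (measurePreserving_sub_right volume (1 : ℝ)).integrableOn_comp_preimage
      (MeasurableEquiv.subRight (1 : ℝ)).measurableEmbedding (f := a) (s := Ici 0)
    have preimage_eq : (fun x : ℝ => x - 1) ⁻¹' Ici 0 = Ici 1 := by ext x; simp
    exact (preimage_eq ▸ h).2 ha.integrable
  rw [← Icc_union_Ici_eq_Ici (zero_le_one (α := ℝ))]
  exact (ha.continuous.comp (continuous_sub_right 1)).integrableOn_Icc.union integrable_Ici_one

lemma IsGlobalTrawlFunction.floor_div_mul_le_sub_one (ha : IsGlobalTrawlFunction a) {δ : ℝ}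
    (hδ : 0 < δ) (hδ1 : δ ≤ 1) (s : ℝ) : a (⌊s / δ⌋₊ * δ) ≤ a (s - 1) :=
  ha.antitone (by linarith [sub_lt_floor_div_mul hδ s])

lemma IsGlobalTrawlFunction.riemannSum_le (ha : IsGlobalTrawlFunction a) {δ : ℝ} (hδ : 0 < δ)
    (hδ1 : δ ≤ 1) (n : ℕ) :
    δ * ∑ l ∈ Finset.range n, a (l * δ) ≤ ∫ s in Ici 0, a (s - 1) := by
  rw [← setIntegral_Ici_zero_gridStep (fun l => a (l * δ)) hδ n]
  exact setIntegral_mono_on (integrableOn_gridStep _ hδ n) ha.integrableOn_comp_sub_one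
    measurableSet_Ici fun s _ => (gridStep_le (fun _ => ha.nonneg _) δ n s).trans
      (ha.floor_div_mul_le_sub_one hδ hδ1 s)

variable {Δ : ℕ → ℝ} {φ : ℕ → ℕ → ℝ} {D : ℝ}

-- Once `Δ n ≤ 1`, monotonicity of `a` makes `s ↦ 2 D a(s - 1)` a dominating function.
lemma IsGlobalTrawlFunction.tendsto_integral_abs_gridStep_sub (ha : IsGlobalTrawlFunction a)
    (hΔpos : ∀ n, 0 < Δ n) (hΔ : Tendsto Δ atTop (𝓝 0)) (hD : 0 ≤ D)
    (hφ : ∀ n l, l < n → |φ n l| ≤ D * a (l * Δ n)) {F : ℝ → ℝ} (hFm : Measurable F)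
    (hF : ∀ s, 0 ≤ s → |F s| ≤ D * a s)
    (hlim : ∀ s, 0 ≤ s → Tendsto (fun n => gridStep (φ n) (Δ n) n s) atTop (𝓝 (F s))) :
    Tendsto (fun n => ∫ s in Ici 0, |gridStep (φ n) (Δ n) n s - F s|) atTop (𝓝 0) := by
  suffices h : Tendsto (fun n => ∫ s in Ici 0, |gridStep (φ n) (Δ n) n s - F s|) atTop
      (𝓝 (∫ _ in Ici (0 : ℝ), (0 : ℝ))) by simpa only [integral_zero] using h
  refine tendsto_integral_filter_of_dominated_convergence (fun s => 2 * D * a (s - 1))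
    (Eventually.of_forall fun n => ?_) ?_ (ha.integrableOn_comp_sub_one.const_mul (2 * D)) ?_
  · exact ((measurable_gridStep _ _ _).sub hFm).abs.aestronglyMeasurable
  · filter_upwards [hΔ.eventually (eventually_le_nhds one_pos)] with n hn
    refine (ae_restrict_iff' measurableSet_Ici).2 (ae_of_all _ fun s (hs : 0 ≤ s) => ?_)
    have step_le : |gridStep (φ n) (Δ n) n s| ≤ D * a (s - 1) :=
      (abs_gridStep_le (fun l => mul_nonneg hD (ha.nonneg (l * Δ n))) (hφ n) (hΔpos n) hs).trans
        (mul_le_mul_of_nonneg_left (ha.floor_div_mul_le_sub_one (hΔpos n) hn s) hD)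
    have limit_le : |F s| ≤ D * a (s - 1) :=
      (hF s hs).trans (mul_le_mul_of_nonneg_left (ha.antitone (by linarith)) hD)
    rw [Real.norm_eq_abs, abs_abs]
    linarith [abs_sub (gridStep (φ n) (Δ n) n s) (F s)]
  · refine (ae_restrict_iff' measurableSet_Ici).2 (ae_of_all _ fun s hs => ?_)
    simpa using ((hlim s hs).sub_const (F s)).abs

lemma IsGlobalTrawlFunction.tendsto_riemannSum_zero (ha : IsGlobalTrawlFunction a)
    (hΔpos : ∀ n, 0 < Δ n) (hΔ : Tendsto Δ atTop (𝓝 0)) (hφ0 : ∀ n l, 0 ≤ φ n l)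
    (hφ : ∀ n l, l < n → φ n l ≤ a (l * Δ n))
    (hlim : ∀ s, 0 ≤ s → Tendsto (fun n => φ n ⌊s / Δ n⌋₊) atTop (𝓝 0)) :
    Tendsto (fun n => Δ n * ∑ l ∈ Finset.range n, φ n l) atTop (𝓝 0) := by
  have hconv := ha.tendsto_integral_abs_gridStep_sub (F := 0) hΔpos hΔ zero_le_one
    (fun n l hl => by simpa [abs_of_nonneg (hφ0 n l)] using hφ n l hl) measurable_const
    (fun s _ => by simpa using ha.nonneg s)
    (fun s hs => squeeze_zero (fun n => gridStep_nonneg (hφ0 n) _ _ _)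
      (fun n => gridStep_le (hφ0 n) _ _ _) (hlim s hs))
  refine hconv.congr fun n => ?_
  rw [← setIntegral_Ici_zero_gridStep (φ n) (hΔpos n) n]
  simp only [Pi.zero_apply, sub_zero, abs_of_nonneg (gridStep_nonneg (hφ0 n) _ _ _)]

variable {p q : ℝ} {g : ℝ → ℝ}

lemma TestClass.integrableOn_comp (hp : 1 ≤ p) (hq : 1 ≤ q) (hg : TestClass 1 p q g)
    (ha : IsGlobalTrawlFunction a) : IntegrableOn (fun s => g (a s)) (Ici 0) := by
  obtain ⟨D, -, abs_le⟩ := hg.exists_abs_le_mul hp hq (a 0)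
  refine (ha.integrable.const_mul D).mono'
    (hg.differentiable.continuous.comp ha.continuous).aestronglyMeasurable ?_
  exact (ae_restrict_iff' measurableSet_Ici).2 (ae_of_all _ fun s hs =>
    abs_le _ (ha.nonneg s) (ha.antitone hs))

lemma TestClass.eventually_abs_riemannSum_sub_lambda_lt (hp : 1 ≤ p) (hq : 1 ≤ q)
    (hg : TestClass 1 p q g) (ha : IsGlobalTrawlFunction a) (hΔpos : ∀ n, 0 < Δ n)
    (hΔ : Tendsto Δ atTop (𝓝 0)) (hnΔ : Tendsto (fun n : ℕ => (n : ℝ) * Δ n) atTop atTop)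
    (T : ℝ) {ε : ℝ} (hε : 0 < ε) :
    ∀ᶠ n in atTop, ∀ t ∈ Icc 0 T,
      |Δ n * ∑ l ∈ Finset.Ico ⌊t / Δ n⌋₊ n, g (a (l * Δ n)) - lambda g a t| < ε := by
  obtain ⟨D, hD, abs_le⟩ := hg.exists_abs_le_mul hp hq (a 0)
  have continuous_comp : Continuous fun s => g (a s) :=
    hg.differentiable.continuous.comp ha.continuous
  have comp_le (s : ℝ) (hs : 0 ≤ s) : |g (a s)| ≤ D * a s :=
    abs_le _ (ha.nonneg s) (ha.antitone hs)
  have comp_grid_le (n l : ℕ) : |g (a (l * Δ n))| ≤ D * a (l * Δ n) :=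
    comp_le _ (mul_nonneg l.cast_nonneg (hΔpos n).le)
  have step_tendsto (s : ℝ) (hs : 0 ≤ s) :
      Tendsto (fun n => gridStep (fun l => g (a (l * Δ n))) (Δ n) n s) atTop (𝓝 (g (a s))) := by
    refine ((continuous_comp.tendsto s).comp (tendsto_floor_div_mul hΔpos hΔ hs)).congr' ?_
    filter_upwards [hnΔ.eventually_gt_atTop s] with n hn
    rw [gridStep_of_lt hn, Function.comp_apply]
  have bound_tendsto := (hΔ.const_mul (D * a 0)).add (ha.tendsto_integral_abs_gridStep_sub hΔpos hΔ
    hD (fun n l _ => comp_grid_le n l) continuous_comp.measurable comp_le step_tendsto)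
  rw [mul_zero, add_zero] at bound_tendsto
  filter_upwards [hnΔ.eventually_gt_atTop T, bound_tendsto.eventually (eventually_lt_nhds hε)]
    with n hnT hn t ht
  rw [lambda, ← integral_Ici_eq_integral_Ioi]
  refine (abs_riemannSum_sub_setIntegral_Ici_le (fun l => (comp_grid_le n l).trans ?_) (hΔpos n)
    (hg.integrableOn_comp hp hq ha) ht.1 (ht.2.trans_lt hnT)).trans_lt hn
  exact mul_le_mul_of_nonneg_left (ha.antitone (mul_nonneg l.cast_nonneg (hΔpos n).le)) hD

end Riemann

/-! ### Splitting the error of the estimator -/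

section ErrorMajorant

/-- A bound, up to a constant, for `|g x - g y|` when `g` is in the class `𝔆¹_{p,q}` and `x` differs
from `y ≥ 0` by a random part `η` and a bias `β`. The weight `w > 0` is free, and a choice balancing
`w` against the second moment of `η` keeps the factor `y` in front of the part of `η` of lower
order. -/
noncomputable def errorMajorant (p q w y β η : ℝ) : ℝ :=
  y * (w + w⁻¹ * |η| ^ (2 : ℝ)) + β + |η| ^ (p + 1) + |η| ^ (q + 1)

lemma rpow_le_rpow_sub_one_mul {y M s : ℝ} (hy : 0 ≤ y) (hyM : y ≤ M) (hs : 1 ≤ s) :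
    y ^ s ≤ M ^ (s - 1) * y :=
  calc y ^ s = y ^ (s - 1) * y := by
        rw [← Real.rpow_add_one' hy (by linarith), sub_add_cancel]
    _ ≤ M ^ (s - 1) * y := by gcongr

lemma le_add_inv_mul_sq {w η : ℝ} (hw : 0 < w) : η ≤ w + w⁻¹ * η ^ 2 := by
  have h : w + w⁻¹ * η ^ 2 = (w * w + η ^ 2) / w := by field_simp
  rw [h, le_div_iff₀ hw]
  nlinarith [sq_nonneg (η - w), sq_nonneg η, sq_nonneg w]

variable {M w y β η e : ℝ}

lemma mul_rpow_le_of_le_add {s : ℝ} (hs : 1 ≤ s) (hw : 0 < w) (hy : 0 ≤ y) (hyM : y ≤ M)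
    (hβ : 0 ≤ β) (he : e ≤ η + β) :
    e * y ^ s ≤ M ^ (s - 1) * (y * (w + w⁻¹ * η ^ 2) + M * β) := by
  have hM : 0 ≤ M := hy.trans hyM
  calc e * y ^ s ≤ (w + w⁻¹ * η ^ 2 + β) * y ^ s := by
        gcongr
        exact he.trans (by gcongr; exact le_add_inv_mul_sq hw)
    _ ≤ (w + w⁻¹ * η ^ 2 + β) * (M ^ (s - 1) * y) := by
        gcongr
        exact rpow_le_rpow_sub_one_mul hy hyM hs
    _ = M ^ (s - 1) * (y * (w + w⁻¹ * η ^ 2) + y * β) := by ring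
    _ ≤ M ^ (s - 1) * (y * (w + w⁻¹ * η ^ 2) + M * β) := by gcongr

lemma mul_rpow_self_le_of_le_add {s : ℝ} (hs : 0 ≤ s) (he0 : 0 ≤ e) (hη : 0 ≤ η) (hβ : 0 ≤ β)
    (hβM : β ≤ M) (he : e ≤ η + β) :
    e * e ^ s ≤ 2 ^ s * (1 + M ^ s) * (η ^ (s + 1) + β) := by
  have hM : 0 ≤ M := hβ.trans hβM
  have hcross : 0 ≤ M ^ s * η ^ (s + 1) := by positivity
  calc e * e ^ s = e ^ (s + 1) := by rw [Real.rpow_add_one' he0 (by linarith), mul_comm]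
    _ ≤ (η + β) ^ (s + 1) := by gcongr
    _ ≤ 2 ^ (s + 1 - 1) * (η ^ (s + 1) + β ^ (s + 1)) :=
        add_rpow_le_two_rpow_mul (by linarith) hη hβ
    _ ≤ 2 ^ (s + 1 - 1) * (η ^ (s + 1) + M ^ (s + 1 - 1) * β) := by
        gcongr
        exact rpow_le_rpow_sub_one_mul hβ hβM (by linarith)
    _ = 2 ^ s * (η ^ (s + 1) + M ^ s * β) := by rw [add_sub_cancel_right]
    _ ≤ 2 ^ s * ((1 + M ^ s) * (η ^ (s + 1) + β)) := by
        gcongr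
        linarith
    _ = 2 ^ s * (1 + M ^ s) * (η ^ (s + 1) + β) := (mul_assoc _ _ _).symm

lemma TestClass.exists_abs_sub_le_errorMajorant {p q : ℝ} {g : ℝ → ℝ} (hp : 1 ≤ p) (hq : 1 ≤ q)
    (hg : TestClass 1 p q g) (hM : 0 ≤ M) :
    ∃ K : ℝ, 0 ≤ K ∧ ∀ x b y w, 0 ≤ y → y ≤ M → |b - y| ≤ M → 0 < w →
      |g x - g y| ≤ K * errorMajorant p q w y |b - y| (x - b) := by
  obtain ⟨C, hC, sub_le⟩ := hg.exists_abs_sub_le hp hq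
  refine ⟨C * (M ^ (p - 1) * (1 + M) + M ^ (q - 1) * (1 + M) + 2 ^ p * (1 + M ^ p)
    + 2 ^ q * (1 + M ^ q)), by positivity, fun x b y w hy hyM hβM hw => ?_⟩
  have error_le : |x - y| ≤ |x - b| + |b - y| := abs_sub_le x b y
  have hβ : 0 ≤ |b - y| := abs_nonneg _
  have linear_nonneg : 0 ≤ y * (w + w⁻¹ * |x - b| ^ 2) := by positivity
  have hηp : 0 ≤ |x - b| ^ (p + 1) := by positivity
  have hηq : 0 ≤ |x - b| ^ (q + 1) := by positivity
  have majorant_eq : errorMajorant p q w y |b - y| (x - b)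
      = y * (w + w⁻¹ * |x - b| ^ 2) + |b - y| + |x - b| ^ (p + 1) + |x - b| ^ (q + 1) := by
    rw [errorMajorant, Real.rpow_two]
  set E := errorMajorant p q w y |b - y| (x - b)
  have lower_le {s : ℝ} (hs : 1 ≤ s) : |x - y| * |y| ^ s ≤ M ^ (s - 1) * (1 + M) * E := by
    rw [abs_of_nonneg hy, mul_assoc, add_mul, one_mul]
    refine (mul_rpow_le_of_le_add hs hw hy hyM hβ error_le).trans ?_
    gcongr <;> linarith
  have upper_le {s : ℝ} (hs : 1 ≤ s) (hsE : |x - b| ^ (s + 1) + |b - y| ≤ E) :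
      |x - y| * |x - y| ^ s ≤ 2 ^ s * (1 + M ^ s) * E :=
    (mul_rpow_self_le_of_le_add (by linarith) (abs_nonneg _) (abs_nonneg _) hβ hβM error_le).trans
      (by gcongr)
  calc |g x - g y|
      ≤ C * (|x - y| * |y| ^ p + |x - y| * |y| ^ q + |x - y| * |x - y| ^ p
          + |x - y| * |x - y| ^ q) := (sub_le x y).trans_eq (by ring)
    _ ≤ C * (M ^ (p - 1) * (1 + M) * E + M ^ (q - 1) * (1 + M) * E + 2 ^ p * (1 + M ^ p) * E
          + 2 ^ q * (1 + M ^ q) * E) := by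
        gcongr ?_ * (?_ + ?_ + ?_ + ?_)
        · exact lower_le hp
        · exact lower_le hq
        · exact upper_le hp (by linarith)
        · exact upper_le hq (by linarith)
    _ = _ := by ring

variable {Ω : Type*} [MeasurableSpace Ω] {P : Measure Ω} [IsProbabilityMeasure P] {p q : ℝ}
  {Y : Ω → ℝ} {m₂ mp mq : ℝ}

lemma integrable_errorMajorant (hp : 0 < p + 1) (hq : 0 < q + 1) (h₂ : HasMomentLE P Y 2 m₂)
    (hYp : HasMomentLE P Y (p + 1) mp) (hYq : HasMomentLE P Y (q + 1) mq) (w y β : ℝ) :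
    Integrable (fun ω => errorMajorant p q w y β (Y ω)) P :=
  (((((integrable_const w).add ((h₂.integrable two_pos).const_mul w⁻¹)).const_mul y).add
    (integrable_const β)).add (hYp.integrable hp)).add (hYq.integrable hq)

lemma integral_errorMajorant_le (hp : 0 < p + 1) (hq : 0 < q + 1) (h₂ : HasMomentLE P Y 2 m₂)
    (hYp : HasMomentLE P Y (p + 1) mp) (hYq : HasMomentLE P Y (q + 1) mq) (hw : 0 < w)
    (hy : 0 ≤ y) (β : ℝ) :
    ∫ ω, errorMajorant p q w y β (Y ω) ∂P ≤ y * (w + w⁻¹ * m₂) + β + mp + mq := by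
  have int_sq := (h₂.integrable two_pos).const_mul w⁻¹
  have int_linear : Integrable (fun ω => y * (w + w⁻¹ * |Y ω| ^ (2 : ℝ))) P :=
    ((integrable_const w).add int_sq).const_mul y
  have int_bias : Integrable (fun ω => y * (w + w⁻¹ * |Y ω| ^ (2 : ℝ)) + β) P :=
    int_linear.add (integrable_const β)
  have int_p := hYp.integrable hp
  have int_q := hYq.integrable hq
  have int_bias_p :
      Integrable (fun ω => y * (w + w⁻¹ * |Y ω| ^ (2 : ℝ)) + β + |Y ω| ^ (p + 1)) P :=
    int_bias.add int_p
  calc ∫ ω, errorMajorant p q w y β (Y ω) ∂P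
      = y * (w + w⁻¹ * ∫ ω, |Y ω| ^ (2 : ℝ) ∂P) + β + ∫ ω, |Y ω| ^ (p + 1) ∂P
          + ∫ ω, |Y ω| ^ (q + 1) ∂P := by
        unfold errorMajorant
        rw [integral_add int_bias_p int_q, integral_add int_bias int_p,
          integral_add int_linear (integrable_const β), integral_const_mul,
          integral_add (integrable_const w) int_sq, integral_const_mul]
        simp only [integral_const, probReal_univ, one_smul]
    _ ≤ y * (w + w⁻¹ * m₂) + β + mp + mq := by
        gcongr
        exacts [h₂.integral_le, hYp.integral_le, hYq.integral_le]

end ErrorMajorant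

/-! ### The bias of the estimator -/

namespace IsGlobalTrawlFunction

variable {a : ℝ → ℝ} {δ : ℝ} {n l : ℕ}

lemma aHatCentre_nonneg (ha : IsGlobalTrawlFunction a) (hδ : 0 < δ) (n l : ℕ) :
    0 ≤ aHatCentre a δ n l :=
  mul_nonneg (by positivity) (setIntegral_nonneg measurableSet_Ico fun u _ => ha.nonneg u)

lemma aHatCentre_le (ha : IsGlobalTrawlFunction a) (hδ : 0 < δ) (hl : l < n) :
    aHatCentre a δ n l ≤ a (l * δ) := by
  have hn : (0 : ℝ) < n := by exact_mod_cast (Nat.zero_le l).trans_lt hl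
  have hnl : ((n - l : ℕ) : ℝ) ≤ n := by exact_mod_cast Nat.sub_le n l
  have := ha.nonneg (l * δ)
  calc aHatCentre a δ n l ≤ n / (n * δ) * (a (l * δ) * δ) := by
        unfold aHatCentre
        gcongr
        · exact setIntegral_nonneg measurableSet_Ico fun u _ => ha.nonneg u
        · exact ha.setIntegral_Ico_le (by positivity) hδ.le
    _ = a (l * δ) := by field_simp

lemma le_aHatCentre (ha : IsGlobalTrawlFunction a) (hδ : 0 < δ) (hl : l < n) :
    (1 - l / n) * a (l * δ + δ) ≤ aHatCentre a δ n l := by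
  have hn : (0 : ℝ) < n := by exact_mod_cast (Nat.zero_le l).trans_lt hl
  calc (1 - l / n) * a (l * δ + δ) = ((n - l : ℕ) : ℝ) / (n * δ) * (a (l * δ + δ) * δ) := by
        rw [Nat.cast_sub hl.le]
        field_simp
    _ ≤ aHatCentre a δ n l := by
        unfold aHatCentre
        gcongr
        exact ha.le_setIntegral_Ico (by positivity) hδ.le

lemma abs_aHatCentre_sub_le (ha : IsGlobalTrawlFunction a) (hδ : 0 < δ) (hl : l < n) :
    |aHatCentre a δ n l - a (l * δ)| ≤ a (l * δ) := by
  rw [abs_sub_comm, abs_of_nonneg (sub_nonneg.2 (ha.aHatCentre_le hδ hl))]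
  linarith [ha.aHatCentre_nonneg hδ n l]

lemma tendsto_riemannSum_abs_aHatCentre_sub (ha : IsGlobalTrawlFunction a) {Δ : ℕ → ℝ}
    (hΔpos : ∀ n, 0 < Δ n) (hΔ : Tendsto Δ atTop (𝓝 0))
    (hnΔ : Tendsto (fun n : ℕ => (n : ℝ) * Δ n) atTop atTop) :
    Tendsto (fun n => Δ n * ∑ l ∈ Finset.range n, |aHatCentre a (Δ n) n l - a (l * Δ n)|)
      atTop (𝓝 0) := by
  refine ha.tendsto_riemannSum_zero hΔpos hΔ (fun n l => abs_nonneg _)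
    (fun n l hl => ha.abs_aHatCentre_sub_le (hΔpos n) hl) fun s hs => ?_
  have grid_tendsto := tendsto_floor_div_mul hΔpos hΔ hs
  have left_tendsto : Tendsto (fun n => a (⌊s / Δ n⌋₊ * Δ n)) atTop (𝓝 (a s)) :=
    (ha.continuous.tendsto s).comp grid_tendsto
  have right_tendsto : Tendsto (fun n => a (⌊s / Δ n⌋₊ * Δ n + Δ n)) atTop (𝓝 (a s)) :=
    (ha.continuous.tendsto s).comp (by simpa using grid_tendsto.add hΔ)
  have fraction_tendsto : Tendsto (fun n : ℕ => (⌊s / Δ n⌋₊ : ℝ) / n) atTop (𝓝 0) :=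
    (grid_tendsto.div_atTop hnΔ).congr fun n => mul_div_mul_right _ _ (hΔpos n).ne'
  have bound_tendsto := left_tendsto.sub ((fraction_tendsto.const_sub 1).mul right_tendsto)
  rw [sub_zero, one_mul, sub_self] at bound_tendsto
  refine squeeze_zero' (Eventually.of_forall fun n => abs_nonneg _) ?_ bound_tendsto
  filter_upwards [hnΔ.eventually_gt_atTop s] with n hn
  have hlt : ⌊s / Δ n⌋₊ < n := floor_div_lt (hΔpos n) hs hn
  rw [abs_sub_comm, abs_of_nonneg (sub_nonneg.2 (ha.aHatCentre_le (hΔpos n) hlt))]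
  linarith [ha.le_aHatCentre (hΔpos n) hlt]

end IsGlobalTrawlFunction

/-! ### Consistency -/

section MeanError

variable {a g : ℝ → ℝ} {p q : ℝ}

lemma IsGlobalTrawlFunction.riemannSum_mean_errorMajorant_le (ha : IsGlobalTrawlFunction a)
    {δ C : ℝ} {n : ℕ} {β : ℕ → ℝ} (hδ : 0 < δ) (hδ1 : δ ≤ 1) (hn : 1 ≤ n * δ) (hC : 0 ≤ C)
    (hβ : ∀ l, 0 ≤ β l) :
    δ * ∑ l ∈ Finset.range n, (a (l * δ) * ((n * δ) ^ (-(1 / 2) : ℝ)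
        + ((n * δ) ^ (-(1 / 2) : ℝ))⁻¹ * (C * (n * δ) ^ (-(2 / 2) : ℝ))) + β l
        + C * (n * δ) ^ (-((p + 1) / 2)) + C * (n * δ) ^ (-((q + 1) / 2)))
      ≤ (1 + C) * (1 + ∫ s in Ici 0, a (s - 1)) * ((n * δ) ^ (-(1 / 2) : ℝ)
        + δ * ∑ l ∈ Finset.range n, β l + (n * δ) ^ ((1 - p) / 2) + (n * δ) ^ ((1 - q) / 2)) := by
  have hT : (0 : ℝ) < n * δ := one_pos.trans_le hn
  set w := (n * δ : ℝ) ^ (-(1 / 2) : ℝ) with hw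
  set S := ∑ l ∈ Finset.range n, β l
  set I := ∫ s in Ici 0, a (s - 1)
  have hS : 0 ≤ S := Finset.sum_nonneg fun l _ => hβ l
  have hI : 0 ≤ I := setIntegral_nonneg measurableSet_Ici fun s _ => ha.nonneg _
  have second_moment : w⁻¹ * (C * (n * δ) ^ (-(2 / 2) : ℝ)) = C * w := by
    rw [mul_left_comm, hw, ← Real.rpow_neg hT.le, ← Real.rpow_add hT]
    norm_num
  have rate (r : ℝ) : δ * (n * (n * δ) ^ (-((r + 1) / 2))) = (n * δ) ^ ((1 - r) / 2) := by
    rw [show (1 - r) / 2 = 1 + -((r + 1) / 2) by ring, Real.rpow_add hT, Real.rpow_one]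
    ring
  calc _ = (1 + C) * (w * (δ * ∑ l ∈ Finset.range n, a (l * δ))) + 1 * (δ * S)
        + C * (δ * (n * (n * δ) ^ (-((p + 1) / 2))))
        + C * (δ * (n * (n * δ) ^ (-((q + 1) / 2)))) := by
        simp only [second_moment, Finset.sum_add_distrib, ← Finset.sum_mul, Finset.sum_const,
          Finset.card_range, nsmul_eq_mul]
        ring
    _ ≤ (1 + C) * (w * (1 + I)) + (1 + C) * (1 + I) * (δ * S)
        + (1 + C) * (1 + I) * (n * δ) ^ ((1 - p) / 2)
        + (1 + C) * (1 + I) * (n * δ) ^ ((1 - q) / 2) := by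
        have one_le : 1 ≤ (1 + C) * (1 + I) := by nlinarith
        have C_le : C ≤ (1 + C) * (1 + I) := by nlinarith
        rw [rate, rate]
        gcongr
        linarith [ha.riemannSum_le hδ hδ1 n]
    _ = _ := by ring

variable {Ω : Type*} [MeasurableSpace Ω] (P : Measure Ω) [IsProbabilityMeasure P]

lemma TestClass.exists_integral_abs_sub_le (hp : 1 ≤ p) (hq : 1 ≤ q) (hg : TestClass 1 p q g)
    {M : ℝ} (hM : 0 ≤ M) :
    ∃ K : ℝ, 0 ≤ K ∧ ∀ (Z : Ω → ℝ) (b y w m₂ mp mq : ℝ), 0 ≤ y → y ≤ M → |b - y| ≤ M → 0 < w →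
      HasMomentLE P (fun ω => Z ω - b) 2 m₂ → HasMomentLE P (fun ω => Z ω - b) (p + 1) mp →
      HasMomentLE P (fun ω => Z ω - b) (q + 1) mq →
      Integrable (fun ω => |g (Z ω) - g y|) P ∧
      ∫ ω, |g (Z ω) - g y| ∂P ≤ K * (y * (w + w⁻¹ * m₂) + |b - y| + mp + mq) := by
  obtain ⟨K, hK, sub_le⟩ := hg.exists_abs_sub_le_errorMajorant hp hq hM
  refine ⟨K, hK, fun Z b y w m₂ mp mq hy hyM hb hw h₂ hZp hZq => ?_⟩
  have hp1 : 0 < p + 1 := by linarith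
  have hq1 : 0 < q + 1 := by linarith
  have majorant_integrable :=
    (integrable_errorMajorant hp1 hq1 h₂ hZp hZq w y |b - y|).const_mul K
  have error_le (ω : Ω) : |g (Z ω) - g y| ≤ K * errorMajorant p q w y |b - y| (Z ω - b) :=
    sub_le _ _ _ _ hy hyM hb hw
  have measurable_Z : AEStronglyMeasurable Z P := by
    simpa using h₂.memLp.aestronglyMeasurable.add_const b
  have error_integrable : Integrable (fun ω => |g (Z ω) - g y|) P :=
    majorant_integrable.mono' ((hg.differentiable.continuous.comp_aestronglyMeasurable
      measurable_Z).sub aestronglyMeasurable_const).norm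
      (ae_of_all _ fun ω => by simpa only [Real.norm_eq_abs, abs_abs] using error_le ω)
  refine ⟨error_integrable, ?_⟩
  calc ∫ ω, |g (Z ω) - g y| ∂P ≤ ∫ ω, K * errorMajorant p q w y |b - y| (Z ω - b) ∂P :=
        integral_mono error_integrable majorant_integrable error_le
    _ = K * ∫ ω, errorMajorant p q w y |b - y| (Z ω - b) ∂P := integral_const_mul _ _
    _ ≤ K * (y * (w + w⁻¹ * m₂) + |b - y| + mp + mq) :=
        mul_le_mul_of_nonneg_left (integral_errorMajorant_le hp1 hq1 h₂ hZp hZq hw hy _) hK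

/-- The Riemann sum over the grid `0, δ, …, (n - 1)δ` of the errors made by plugging the estimator
computed from the path `x` into `g`. -/
noncomputable def plugInError (g a x : ℝ → ℝ) (δ : ℝ) (n : ℕ) : ℝ :=
  δ * ∑ l ∈ Finset.range n, |g (aHat x δ n (l * δ)) - g (a (l * δ))|

variable {P} {τ : Triplet} {L : Set (ℝ × ℝ) → Ω → ℝ} {seed : Measure ℝ} {X : ℝ → Ω → ℝ} {s : ℝ}

lemma exists_forall_hasMomentLE_aHat_sub_aHatCentre (hL : IsLevyBasis P τ L)
    (hseed : τ.IsSeedLaw seed) (hvar : Var[id; seed] = 1)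
    (hmom : MemLp id (ENNReal.ofReal s) seed) (ha : IsGlobalTrawlFunction a)
    (hX : IsTrawlProcess P L a X) (R : Finset ℝ) (hR : ∀ r ∈ R, 2 ≤ r ∧ 2 * r ≤ s) :
    ∃ C : ℝ, 0 ≤ C ∧ ∀ r ∈ R, ∀ (δ : ℝ) (n l : ℕ), 0 < δ → 1 ≤ n * δ → l ≤ n →
      HasMomentLE P (fun ω => aHat (fun t => X t ω) δ n (l * δ) - aHatCentre a δ n l) r
        (C * (n * δ) ^ (-(r / 2))) := by
  choose! C hC using fun r (hr : r ∈ R) =>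
    exists_hasMomentLE_aHat_sub_aHatCentre hL hseed hvar hmom ha hX (hR r hr).1 (hR r hr).2
  refine ⟨∑ r ∈ R, |C r|, Finset.sum_nonneg fun r _ => abs_nonneg _,
    fun r hr δ n l hδ hn hl => (hC r hr δ n l hδ hn hl).mono ?_⟩
  gcongr
  exact (le_abs_self _).trans
    (Finset.single_le_sum (f := fun r => |C r|) (fun r _ => abs_nonneg _) hr)

lemma TestClass.exists_integral_plugInError_le (hp : 1 ≤ p) (hq : 1 ≤ q) (hg : TestClass 1 p q g)
    (hL : IsLevyBasis P τ L) (hseed : τ.IsSeedLaw seed) (hvar : Var[id; seed] = 1)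
    (hmom : MemLp id (ENNReal.ofReal (2 * (max q p + 1))) seed) (ha : IsGlobalTrawlFunction a)
    (hX : IsTrawlProcess P L a X) :
    ∃ K : ℝ, ∀ (δ : ℝ) (n : ℕ), 0 < δ → δ ≤ 1 → 1 ≤ n * δ →
      Integrable (fun ω => plugInError g a (fun t => X t ω) δ n) P ∧
      ∫ ω, plugInError g a (fun t => X t ω) δ n ∂P
        ≤ K * ((n * δ) ^ (-(1 / 2) : ℝ)
          + δ * ∑ l ∈ Finset.range n, |aHatCentre a δ n l - a (l * δ)|
          + (n * δ) ^ ((1 - p) / 2) + (n * δ) ^ ((1 - q) / 2)) := by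
  have hqm := le_max_left q p
  have hpm := le_max_right q p
  obtain ⟨K, hK, term⟩ := hg.exists_integral_abs_sub_le P hp hq (ha.nonneg 0)
  obtain ⟨C, hC, moment⟩ := exists_forall_hasMomentLE_aHat_sub_aHatCentre hL hseed hvar hmom ha hX
    {2, p + 1, q + 1} (by
      simp only [Finset.forall_mem_insert, Finset.mem_singleton, forall_eq]
      exact ⟨by constructor <;> linarith, by constructor <;> linarith, by constructor <;> linarith⟩)
  refine ⟨K * ((1 + C) * (1 + ∫ s in Ici 0, a (s - 1))), fun δ n hδ hδ1 hn => ?_⟩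
  have hw : (0 : ℝ) < (n * δ) ^ (-(1 / 2) : ℝ) := Real.rpow_pos_of_pos (one_pos.trans_le hn) _
  have grid_term (l : ℕ) (hl : l ∈ Finset.range n) :=
    have hl : l < n := Finset.mem_range.1 hl
    have a_le : a (l * δ) ≤ a 0 := ha.antitone (by positivity)
    term (fun ω => aHat (fun t => X t ω) δ n (l * δ)) _ _ _ _ _ _ (ha.nonneg (l * δ)) a_le
      ((ha.abs_aHatCentre_sub_le hδ hl).trans a_le) hw (moment _ (by simp) δ n l hδ hn hl.le)
      (moment _ (by simp) δ n l hδ hn hl.le) (moment _ (by simp) δ n l hδ hn hl.le)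
  refine ⟨(integrable_finsetSum _ fun l hl => (grid_term l hl).1).const_mul δ, ?_⟩
  unfold plugInError
  rw [integral_const_mul, integral_finsetSum _ fun l hl => (grid_term l hl).1, mul_assoc]
  refine (mul_le_mul_of_nonneg_left (Finset.sum_le_sum fun l hl => (grid_term l hl).2) hδ.le).trans
    ?_
  rw [← Finset.mul_sum, mul_left_comm]
  exact mul_le_mul_of_nonneg_left
    (ha.riemannSum_mean_errorMajorant_le hδ hδ1 hn hC fun l => abs_nonneg _) hK

end MeanError

section Convergence

variable {a g : ℝ → ℝ} {p q : ℝ} {Ω : Type*} [MeasurableSpace Ω] {P : Measure Ω}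
  [IsProbabilityMeasure P] {τ : Triplet} {L : Set (ℝ × ℝ) → Ω → ℝ} {seed : Measure ℝ}
  {X : ℝ → Ω → ℝ} {Δ : ℕ → ℝ}

lemma tendsto_rpow_of_neg {T : ℕ → ℝ} (hT : Tendsto T atTop atTop) {e : ℝ} (he : e < 0) :
    Tendsto (fun n => T n ^ e) atTop (𝓝 0) := by
  simpa only [Function.comp_def, neg_neg]
    using (tendsto_rpow_neg_atTop (neg_pos.2 he)).comp hT

lemma plugInError_nonneg (g a x : ℝ → ℝ) {δ : ℝ} (hδ : 0 ≤ δ) (n : ℕ) :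
    0 ≤ plugInError g a x δ n :=
  mul_nonneg hδ (Finset.sum_nonneg fun _ _ => abs_nonneg _)

lemma abs_lambdaHat_sub_riemannSum_le (g a x : ℝ → ℝ) {δ : ℝ} (hδ : 0 ≤ δ) (n : ℕ) (t : ℝ) :
    |lambdaHat g x δ n t - δ * ∑ l ∈ Finset.Ico ⌊t / δ⌋₊ n, g (a (l * δ))|
      ≤ plugInError g a x δ n := by
  rw [lambdaHat, ← mul_sub, ← Finset.sum_sub_distrib, abs_mul, abs_of_nonneg hδ]
  refine mul_le_mul_of_nonneg_left ((Finset.abs_sum_le_sum_abs _ _).trans ?_) hδ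
  refine Finset.sum_le_sum_of_subset_of_nonneg (fun l hl => ?_) fun _ _ _ => abs_nonneg _
  exact Finset.mem_range.2 (Finset.mem_Ico.1 hl).2

lemma TestClass.tendsto_integral_plugInError (hp : 1 < p) (hq : 1 < q) (hg : TestClass 1 p q g)
    (hL : IsLevyBasis P τ L) (hseed : τ.IsSeedLaw seed) (hvar : Var[id; seed] = 1)
    (hmom : MemLp id (ENNReal.ofReal (2 * (max q p + 1))) seed) (ha : IsGlobalTrawlFunction a)
    (hX : IsTrawlProcess P L a X) (hΔpos : ∀ n, 0 < Δ n) (hΔ : Tendsto Δ atTop (𝓝 0))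
    (hnΔ : Tendsto (fun n : ℕ => (n : ℝ) * Δ n) atTop atTop) :
    (∀ᶠ n in atTop, Integrable (fun ω => plugInError g a (fun t => X t ω) (Δ n) n) P) ∧
      Tendsto (fun n => ∫ ω, plugInError g a (fun t => X t ω) (Δ n) n ∂P) atTop (𝓝 0) := by
  obtain ⟨K, error_le⟩ := hg.exists_integral_plugInError_le hp.le hq.le hL hseed hvar hmom ha hX
  have error_le_eventually := (hnΔ.eventually_ge_atTop 1).and
    (hΔ.eventually (eventually_le_nhds one_pos)) |>.mono fun n hn =>
      error_le (Δ n) n (hΔpos n) hn.2 hn.1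
  have bound_tendsto := ((((tendsto_rpow_of_neg hnΔ (e := -(1 / 2)) (by norm_num)).add
    (ha.tendsto_riemannSum_abs_aHatCentre_sub hΔpos hΔ hnΔ)).add
    (tendsto_rpow_of_neg hnΔ (e := (1 - p) / 2) (by linarith))).add
    (tendsto_rpow_of_neg hnΔ (e := (1 - q) / 2) (by linarith))).const_mul K
  simp only [add_zero, mul_zero] at bound_tendsto
  exact ⟨error_le_eventually.mono fun n hn => hn.1, squeeze_zero'
    (Eventually.of_forall fun n => integral_nonneg fun ω => plugInError_nonneg _ _ _ (hΔpos n).le n)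
    (error_le_eventually.mono fun n hn => hn.2) bound_tendsto⟩

lemma TestClass.tendstoUCP_lambdaHat (hp : 1 < p) (hq : 1 < q) (hg : TestClass 1 p q g)
    (hL : IsLevyBasis P τ L) (hseed : τ.IsSeedLaw seed) (hvar : Var[id; seed] = 1)
    (hmom : MemLp id (ENNReal.ofReal (2 * (max q p + 1))) seed) (ha : IsGlobalTrawlFunction a)
    (hX : IsTrawlProcess P L a X) (hΔpos : ∀ n, 0 < Δ n) (hΔ : Tendsto Δ atTop (𝓝 0))
    (hnΔ : Tendsto (fun n : ℕ => (n : ℝ) * Δ n) atTop atTop) :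
    TendstoUCP P (fun n t ω => lambdaHat g (fun s => X s ω) (Δ n) n t)
      (fun t _ => lambda g a t) := by
  intro T _ ε hε
  obtain ⟨error_integrable, mean_tendsto⟩ :=
    hg.tendsto_integral_plugInError hp hq hL hseed hvar hmom ha hX hΔpos hΔ hnΔ
  have bound_tendsto := ENNReal.tendsto_ofReal (mean_tendsto.div_const (ε / 2))
  rw [zero_div, ENNReal.ofReal_zero] at bound_tendsto
  refine tendsto_of_tendsto_of_tendsto_of_le_of_le' tendsto_const_nhds bound_tendsto
    (Eventually.of_forall fun _ => zero_le) ?_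
  filter_upwards [error_integrable, hg.eventually_abs_riemannSum_sub_lambda_lt hp.le hq.le ha
    hΔpos hΔ hnΔ T (half_pos hε)] with n integrable_n riemannSum_close
  set err : Ω → ℝ := fun ω => plugInError g a (fun t => X t ω) (Δ n) n
  have markov : ε / 2 * P.real {ω | ε / 2 ≤ err ω} ≤ ∫ ω, err ω ∂P :=
    mul_meas_ge_le_integral_of_nonneg
      (ae_of_all P fun ω => plugInError_nonneg _ _ _ (hΔpos n).le n) integrable_n (ε / 2)
  have event_subset :
      {ω | ∃ t ∈ Icc 0 T, ε < |lambdaHat g (fun s => X s ω) (Δ n) n t - lambda g a t|}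
        ⊆ {ω | ε / 2 ≤ err ω} := by
    rintro ω ⟨t, ht, hlt⟩
    have triangle := abs_sub_le (lambdaHat g (fun s => X s ω) (Δ n) n t)
      (Δ n * ∑ l ∈ Finset.Ico ⌊t / Δ n⌋₊ n, g (a (l * Δ n))) (lambda g a t)
    have random_part : _ ≤ err ω :=
      abs_lambdaHat_sub_riemannSum_le g a (fun s => X s ω) (hΔpos n).le n t
    rw [mem_ofPred_eq]
    linarith [riemannSum_close t ht]
  refine (measure_mono event_subset).trans ?_
  rw [← ofReal_measureReal]
  exact ENNReal.ofReal_le_ofReal ((le_div_iff₀' (half_pos hε)).2 markov)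

end Convergence

/-! ### Extension of the trawl function to the whole line -/

section Extension

variable {a : ℝ → ℝ}

/-- The extension of a function on `[0, ∞)` to the real line by its value at `0`. Trawl sets and
their functionals only see `[0, ∞)`, while monotonicity and continuity on all of `ℝ` spare case
distinctions at `0`. -/
def extendConst (a : ℝ → ℝ) (u : ℝ) : ℝ :=
  a (max u 0)

lemma extendConst_of_nonneg {u : ℝ} (hu : 0 ≤ u) : extendConst a u = a u := by
  rw [extendConst, max_eq_left hu]

lemma IsTrawlFunction.isGlobalTrawlFunction_extendConst (ha : IsTrawlFunction a) :
    IsGlobalTrawlFunction (extendConst a) where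
  nonneg _ := ha.nonneg _ (le_max_right _ _)
  antitone _ _ huv := ha.antitone (mem_Ici.2 (le_max_right _ _)) (mem_Ici.2 (le_max_right _ _))
    (max_le_max_right 0 huv)
  continuous := ha.continuous.comp_continuous (by fun_prop) fun _ => mem_Ici.2 (le_max_right _ _)
  integrable := ha.integrable.congr_fun (fun _ hu => (extendConst_of_nonneg hu).symm)
    measurableSet_Ici

lemma trawlSetAt_extendConst (a : ℝ → ℝ) (t : ℝ) :
    trawlSetAt (extendConst a) t = trawlSetAt a t := by
  ext x
  refine and_congr_right fun hx => ?_
  rw [extendConst_of_nonneg (neg_nonneg.2 hx)]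

lemma lambda_extendConst (g a : ℝ → ℝ) {t : ℝ} (ht : 0 ≤ t) :
    lambda g (extendConst a) t = lambda g a t :=
  setIntegral_congr_fun measurableSet_Ioi fun u hu => by
    simp only [extendConst_of_nonneg (ht.trans (le_of_lt hu))]

lemma TendstoUCP.congr_limit {Ω : Type*} [MeasurableSpace Ω] {P : Measure Ω}
    {Zn : ℕ → ℝ → Ω → ℝ} {Z Z' : ℝ → Ω → ℝ} (h : TendstoUCP P Zn Z)
    (hZ : ∀ t, 0 ≤ t → Z t = Z' t) : TendstoUCP P Zn Z' := by
  intro T hT ε hε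
  refine (h T hT ε hε).congr fun n => congrArg P <| Set.ext fun ω => ?_
  exact exists_congr fun t => and_congr_right fun ht => by rw [hZ t ht.1]

end Extension

end Trawl

theorem theorem2 {Ω : Type*} [MeasurableSpace Ω] (P : Measure Ω) [IsProbabilityMeasure P]
    (τ : Trawl.Triplet) (L : Set (ℝ × ℝ) → Ω → ℝ) (hL : Trawl.IsLevyBasis P τ L)
    (seed : Measure ℝ) (hseed : τ.IsSeedLaw seed) (hvar : Var[id; seed] = 1)
    (a : ℝ → ℝ) (ha : Trawl.IsTrawlFunction a)
    (X : ℝ → Ω → ℝ) (hX : Trawl.IsTrawlProcess P L a X)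
    (Δ : ℕ → ℝ) (hΔpos : ∀ n, 0 < Δ n) (hΔ : Tendsto Δ atTop (𝓝 0))
    (hnΔ : Tendsto (fun n : ℕ => (n : ℝ) * Δ n) atTop atTop)
    (p q : ℝ) (hp : 1 < p) (hq : 1 < q)
    (hmoment : Integrable (fun x : ℝ => |x| ^ (2 * (max q p + 1))) seed)
    (g : ℝ → ℝ) (hg : Trawl.TestClass 1 p q g) :
    IntegrableOn (fun s => g (a s)) (Ici 0) ∧
    Trawl.TendstoUCP P
      (fun n t ω => Trawl.lambdaHat g (fun s => X s ω) (Δ n) n t)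
      (fun t _ => Trawl.lambda g a t) := by
  have ha' := ha.isGlobalTrawlFunction_extendConst
  have hX' : Trawl.IsTrawlProcess P L (Trawl.extendConst a) X := fun t => by
    rw [Trawl.trawlSetAt_extendConst]
    exact hX t
  have hmom : MemLp id (ENNReal.ofReal (2 * (max q p + 1))) seed :=
    (Trawl.memLp_ofReal_iff_integrable_abs_rpow (by linarith [le_max_left q p])
      aestronglyMeasurable_id).2 hmoment
  refine ⟨?_, ?_⟩
  · exact (hg.integrableOn_comp hp.le hq.le ha').congr_fun
      (fun s hs => by simp only [Trawl.extendConst_of_nonneg hs]) measurableSet_Ici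
  · exact (hg.tendstoUCP_lambdaHat hp hq hL hseed hvar hmom ha' hX' hΔpos hΔ hnΔ).congr_limit
      fun t ht => by simp only [Trawl.lambda_extendConst g a ht]
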